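/- **Data.** Let $u_0,u_b:(0,\infty)\to\mathbb R$ be bounded and measurable with $u_b>0$, and let $\rho_0,\rho_b:(0,\infty)\to(0,\infty)$ be measurable and bounded on bounded sets. For $x\ge 0$, $t>0$, put $$F(y,x,t)=\int_0^y [tu_0(\eta)+\eta-x]\rho_0(\eta)\,d\eta,\qquad G(\tau,x,t)=\int_0^\tau [x-u_b(\eta)(t-\eta)]\rho_b(\eta)u_b(\eta)\,d\eta ,$$ $F(x,t)=\min_{y\ge0}F(y,x,t)$, $G(x,t)=\min_{\tau\ge0}G(\tau,x,t)$. Let $y_*\le y^*$ be the smallest and largest minimizers of $F(\cdot,x,t)$, and $\tau_*\le\tau^*$ the smallest and largest minimizers of $G(\cdot,x,t)$, on $[0,\infty)$. **The functions $u$ and $m$.** For $x,t>0$ define $u(x,t)$ by * if $F<G$ at $(x,t)$: $u=\frac{x-y_*}{t}$ when $y_*=y^*$, and $u=\int_{y_*}^{y^*}\rho_0u_0\big/\int_{y_*}^{y^*}\rho_0$ when $y_*<y^*$; * if $F>G$ at $(x,t)$: $u=\frac{x}{t-\tau_*}$ when $\tau_*=\tau^*$, and $u=\int_{\tau_*}^{\tau^*}\rho_bu_b^2\big/\int_{\tau_*}^{\tau^*}\rho_bu_b$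 when $\tau_*<\tau^*$; * if $F=G$ at $(x,t)$: $u=\dfrac{\int_0^{\tau^*}\rho_bu_b^2+\int_0^{y^*}\rho_0u_0}{\int_0^{\tau^*}\rho_bu_b+\int_0^{y^*}\rho_0}$ when $y^*\ne0$ or $\tau^*\neq0$, and $u=x/t$ when $y^*=\tau^*=0$. For $x=0$, $t>0$ let $u=u_b(t)$ if $F(0,t)>G(0,t)$, $u=0$ if $F(0,t)<G(0,t)$, and use the same formula as for $x>0$ if $F(0,t)=G(0,t)$. Further let $m(x,t)=\int_0^{y_*(x,t)}\rho_0$ if $F(x,t)\le G(x,t)$ and $x>0$, and $m(x,t)=-\int_0^{\tau_*(x,t)}\rho_bu_b$ if $F(x,t)>G(x,t)$ or $x=0$. **Theorem.** For every $t>0$ there is a (unique) Radon measure $\rho(\cdot,t)$ on $[0,\infty)$ whose restriction to $(0,\infty)$ is the distributional derivative $\partial_xm(\cdot,t)$ and whose point mass at $x=0$ is $\lim_{x\searrow0}(m(x,t)-m(0,t))$ if $F(0,t)\le G(0,t)$ and $0$ if $F(0,t)>G(0,t)$. With it the following hold. 1. *Solution.* On $(0,\infty)^2$ the functions $m$ and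 $u$ are measurable and locally bounded; for almost every $t>0$, $m(\cdot,t)$ is of locally bounded variation on $(0,\infty)$ and $u(\cdot,t)$ is $\rho(\cdot,t)$-measurable; and for all $\varphi,\psi\in C_c^\infty((0,\infty)^2)$ $$\iint\varphi_t\,m\,dx\,dt-\iint\varphi\,u\,\rho(dx,t)\,dt=0,\qquad \iint(\psi_tu+\psi_xu^2)\,\rho(dx,t)\,dt=0 .$$ In particular $\rho_t+(\rho u)_x=0$ and $(\rho u)_t+(\rho u^2)_x=0$ in the sense of distributions on $(0,\infty)^2$. 2. *Initial conditions.* For almost every $x>0$, $\lim_{t\searrow0}u(x,t)=u_0(x)$ and $\lim_{t\searrow0}m(x,t)=\int_0^x\rho_0(y)\,dy$. 3. *Boundary condition for $u$.* For almost every $t>0$ with $F(0,t)>G(0,t)$, $\lim_{x\searrow0}u(x,t)=u_b(t)$. 4. *Boundary condition for $\rho u$.* If in addition $u_b$ is continuously differentiable and $\rho_b$ is locally Lipschitz continuous on $(0,\infty)$, then for every $t>0$ with $F(0,t)>G(0,t)$ there is $\varepsilon>0$ such that $m(\cdot,t)$ is continuously differentiable on $(0,\varepsilon)$, $\rho(\cdot,t)$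 has there the density $\partial_xm(\cdot,t)\ge 0$ with respect to Lebesgue measure, and $\lim_{x\searrow0}\partial_xm(x,t)\,u(x,t)=\rho_b(t)u_b(t)$. -/

import Mathlib

open MeasureTheory Set Filter Topology
open scoped ContDiff

namespace PressurelessGas

/-- Initial data `(u₀, ρ₀)`, functions of `x > 0`, and boundary data `(ub, ρb)`, functions of
`t > 0`. The values at nonpositive arguments play no role. -/
structure Data where
  /-- initial velocity -/
  u₀ : ℝ → ℝ
  /-- initial density -/
  ρ₀ : ℝ → ℝ
  /-- boundary velocity -/
  ub : ℝ → ℝ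
  /-- boundary density -/
  ρb : ℝ → ℝ

namespace Data

/-- The standing assumptions: `u₀`, `ub` are bounded measurable, `ub > 0`, and `ρ₀`, `ρb` are
positive, measurable and locally bounded (bounded on bounded subsets of the half line). -/
structure Admissible (D : Data) : Prop where
  measurable_u₀ : Measurable D.u₀
  measurable_ρ₀ : Measurable D.ρ₀
  measurable_ub : Measurable D.ub
  measurable_ρb : Measurable D.ρb
  bounded_u₀ : ∃ C : ℝ, ∀ x : ℝ, 0 < x → |D.u₀ x| ≤ C
  bounded_ub : ∃ C : ℝ, ∀ t : ℝ, 0 < t → |D.ub t| ≤ C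
  locallyBounded_ρ₀ : ∀ R : ℝ, ∃ C : ℝ, ∀ x : ℝ, 0 < x → x ≤ R → D.ρ₀ x ≤ C
  locallyBounded_ρb : ∀ R : ℝ, ∃ C : ℝ, ∀ t : ℝ, 0 < t → t ≤ R → D.ρb t ≤ C
  ub_pos : ∀ t : ℝ, 0 < t → 0 < D.ub t
  ρ₀_pos : ∀ x : ℝ, 0 < x → 0 < D.ρ₀ x
  ρb_pos : ∀ t : ℝ, 0 < t → 0 < D.ρb t

noncomputable section

/-- The initial potential `F(y, x, t)`. -/
def Fpot (D : Data) (y x t : ℝ) : ℝ :=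
  ∫ η in (0 : ℝ)..y, (t * D.u₀ η + η - x) * D.ρ₀ η

/-- The boundary potential `G(τ, x, t)`. -/
def Gpot (D : Data) (τ x t : ℝ) : ℝ :=
  ∫ η in (0 : ℝ)..τ, (x - D.ub η * (t - η)) * (D.ρb η * D.ub η)

/-- `F(x, t) = min_{y ≥ 0} F(y, x, t)`. -/
def F (D : Data) (x t : ℝ) : ℝ := sInf ((fun y => D.Fpot y x t) '' Ici 0)

/-- `G(x, t) = min_{τ ≥ 0} G(τ, x, t)`. -/
def G (D : Data) (x t : ℝ) : ℝ := sInf ((fun τ => D.Gpot τ x t) '' Ici 0)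

/-- The set of minimizers of `F(·, x, t)` on `[0, ∞)`. -/
def Fmin (D : Data) (x t : ℝ) : Set ℝ :=
  {y | 0 ≤ y ∧ ∀ z : ℝ, 0 ≤ z → D.Fpot y x t ≤ D.Fpot z x t}

/-- The set of minimizers of `G(·, x, t)` on `[0, ∞)`. -/
def Gmin (D : Data) (x t : ℝ) : Set ℝ :=
  {τ | 0 ≤ τ ∧ ∀ σ : ℝ, 0 ≤ σ → D.Gpot τ x t ≤ D.Gpot σ x t}

/-- The leftmost minimizer `y_*(x, t)`. -/
def yLow (D : Data) (x t : ℝ) : ℝ := sInf (D.Fmin x t)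

/-- The rightmost minimizer `y^*(x, t)`. -/
def yUp (D : Data) (x t : ℝ) : ℝ := sSup (D.Fmin x t)

/-- The lowermost minimizer `τ_*(x, t)`. -/
def τLow (D : Data) (x t : ℝ) : ℝ := sInf (D.Gmin x t)

/-- The uppermost minimizer `τ^*(x, t)`. -/
def τUp (D : Data) (x t : ℝ) : ℝ := sSup (D.Gmin x t)

open Classical in
/-- The velocity `u(x, t)`, for `x ≥ 0` and `t > 0`. -/
def u (D : Data) (x t : ℝ) : ℝ :=
  if x = 0 ∧ D.G x t < D.F x t then D.ub t
  else if x = 0 ∧ D.F x t < D.G x t then 0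
  else if D.F x t < D.G x t then
    if D.yLow x t = D.yUp x t then (x - D.yLow x t) / t
    else (∫ η in (D.yLow x t)..(D.yUp x t), D.ρ₀ η * D.u₀ η) /
      (∫ η in (D.yLow x t)..(D.yUp x t), D.ρ₀ η)
  else if D.G x t < D.F x t then
    if D.τLow x t = D.τUp x t then x / (t - D.τLow x t)
    else (∫ η in (D.τLow x t)..(D.τUp x t), D.ρb η * D.ub η ^ 2) /
      (∫ η in (D.τLow x t)..(D.τUp x t), D.ρb η * D.ub η)
  else if D.yUp x t ≠ 0 ∨ D.τUp x t ≠ 0 then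
    ((∫ η in (0 : ℝ)..(D.τUp x t), D.ρb η * D.ub η ^ 2) +
        ∫ η in (0 : ℝ)..(D.yUp x t), D.ρ₀ η * D.u₀ η) /
      ((∫ η in (0 : ℝ)..(D.τUp x t), D.ρb η * D.ub η) +
        ∫ η in (0 : ℝ)..(D.yUp x t), D.ρ₀ η)
  else x / t

open Classical in
/-- The mass potential `m(x, t)`, for `x ≥ 0` and `t > 0`. -/
def m (D : Data) (x t : ℝ) : ℝ :=
  if 0 < x ∧ D.F x t ≤ D.G x t then ∫ η in (0 : ℝ)..(D.yLow x t), D.ρ₀ η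
  else -∫ η in (0 : ℝ)..(D.τLow x t), D.ρb η * D.ub η

end

/-- `ν` is the density `ρ(·, t)`, a Radon measure on `[0, ∞)`: on `(0, ∞)` it is the distributional
derivative of `m(·, t)`; at `x = 0` it has the Dirac mass `m(0+, t) - m(0, t)` if
`F(0, t) ≤ G(0, t)`, and no point mass if `F(0, t) > G(0, t)`. These properties determine `ν`. -/
structure IsDensity (D : Data) (t : ℝ) (ν : Measure ℝ) : Prop where
  neg : ν (Iio 0) = 0
  locallyFinite : ∀ R : ℝ, ν (Icc 0 R) < ⊤
  distribDeriv : ∀ φ : ℝ → ℝ, ContDiff ℝ ∞ φ → HasCompactSupport φ → tsupport φ ⊆ Ioi 0 →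
    ∫ x, φ x ∂ν = -∫ x in Ioi (0 : ℝ), deriv φ x * D.m x t
  atom : D.F 0 t ≤ D.G 0 t →
    Tendsto (fun x => D.m x t - D.m 0 t) (𝓝[>] 0) (𝓝 (ν.real {0}))
  noAtom : D.G 0 t < D.F 0 t → ν {0} = 0

end Data

/-- Test functions `φ(x, t)` on the open quarter plane: smooth with compact support in
`(0, ∞) × (0, ∞)`. -/
structure IsTest (φ : ℝ × ℝ → ℝ) : Prop where
  smooth : ContDiff ℝ ∞ φ
  compactSupport : HasCompactSupport φ
  support : tsupport φ ⊆ Ioi 0 ×ˢ Ioi 0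

noncomputable section

/-- The partial derivative `φ_x` at `(x, t)`. -/
def dx (φ : ℝ × ℝ → ℝ) (x t : ℝ) : ℝ := fderiv ℝ φ (x, t) (1, 0)

/-- The partial derivative `φ_t` at `(x, t)`. -/
def dt (φ : ℝ × ℝ → ℝ) (x t : ℝ) : ℝ := fderiv ℝ φ (x, t) (0, 1)

/-- `∬ g(x, t) ρ(dx, t) dt = c`, where both iterated integrals converge. -/
def HasDoubleIntegral (ρ : ℝ → Measure ℝ) (g : ℝ → ℝ → ℝ) (c : ℝ) : Prop :=
  (∀ᵐ t ∂(volume.restrict (Ioi (0 : ℝ))), Integrable (fun x => g x t) (ρ t)) ∧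
  IntegrableOn (fun t => ∫ x, g x t ∂(ρ t)) (Ioi 0) ∧
  ∫ t in Ioi (0 : ℝ), ∫ x, g x t ∂(ρ t) = c

end

/-- `(m, u)`, with `ρ(·, t) = m(dx, t)`, is a generalized solution of the pressureless system in
the open quarter plane: `m` and `u` are measurable and locally bounded, for almost all `t` the
function `m(·, t)` is of locally bounded variation and `u(·, t)` is `ρ(·, t)`-measurable, and
`∬ φ_t m dx dt - ∬ φ u dm dt = 0`, `∬ (ψ_t u + ψ_x u²) dm dt = 0` for all test functions. -/
structure IsGeneralizedSolution (m u : ℝ → ℝ → ℝ) (ρ : ℝ → Measure ℝ) : Prop where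
  measurable_m : Measurable fun p : Ioi (0 : ℝ) × Ioi (0 : ℝ) => m p.1 p.2
  measurable_u : Measurable fun p : Ioi (0 : ℝ) × Ioi (0 : ℝ) => u p.1 p.2
  locallyBounded : ∀ R : ℝ, ∃ C : ℝ, ∀ x ∈ Ioc 0 R, ∀ t ∈ Ioc 0 R, |m x t| ≤ C ∧ |u x t| ≤ C
  boundedVariation : ∀ᵐ t ∂(volume.restrict (Ioi (0 : ℝ))),
    LocallyBoundedVariationOn (fun x => m x t) (Ioi 0)
  aemeasurable_u : ∀ᵐ t ∂(volume.restrict (Ioi (0 : ℝ))), AEMeasurable (fun x => u x t) (ρ t)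
  mass : ∀ φ : ℝ × ℝ → ℝ, IsTest φ →
    HasDoubleIntegral ρ (fun x t => φ (x, t) * u x t)
      (∫ t in Ioi (0 : ℝ), ∫ x in Ioi (0 : ℝ), dt φ x t * m x t)
  momentum : ∀ ψ : ℝ × ℝ → ℝ, IsTest ψ →
    HasDoubleIntegral ρ (fun x t => dt ψ x t * u x t + dx ψ x t * u x t ^ 2) 0

/-- `(ρ, u)` solves `ρ_t + (ρ u)_x = 0` and `(ρ u)_t + (ρ u²)_x = 0` in the sense of distributions
on the open quarter plane. -/
structure IsDistributionalSolution (ρ : ℝ → Measure ℝ) (u : ℝ → ℝ → ℝ) : Prop where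
  mass : ∀ φ : ℝ × ℝ → ℝ, IsTest φ →
    HasDoubleIntegral ρ (fun x t => dt φ x t + dx φ x t * u x t) 0
  momentum : ∀ ψ : ℝ × ℝ → ℝ, IsTest ψ →
    HasDoubleIntegral ρ (fun x t => dt ψ x t * u x t + dx ψ x t * u x t ^ 2) 0

end PressurelessGas

/-! All particles are put on one line of labels: s > 0 is the particle that starts at s, s < 0 the
one that enters at x = 0 at the time -s. Then F(y, x, t) and G(τ, x, t) are the restrictions to the
two half lines of a single potential `pot` s x t = t mom(s) - x mass(s) + ener(s). Its s-derivative
is the density times the difference between the free flight position of s at time t and x. The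
potential is affine in (x, t), so adding the minimality inequalities at two points gives
`argmin_compare`. This yields monotonicity of the minimizers in x and, together with the strict
bound C on the velocities, finite speed of propagation. In terms of the smallest and largest
minimizers `lo` ≤ `hi` on the whole line, the case distinctions in the definition of u for x > 0
collapse to one formula, `speed`: the free flight velocity if `lo` = `hi`, otherwise the mean
velocity of the labels in between.

The intervals [lo, hi] are ordered in x, so each label has a position `pos` s t, the generalized
inverse of `hi`, and it is Lipschitz in t. The measure ρ(·, t) is the image under `pos` of the mass
of the labels that have entered, and Fubini identifies it with the derivative of m. Two facts carry
the weak equations.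

The first is `ae_hasDerivAt_pos`: outside a countable set of labels, a trajectory has the velocity u
at almost every time at which it is off the boundary. If the minimizer is single, the trajectory
agrees at rational earlier times with the straight line of free flight. At a jump, comparison with
minimizers along the trajectory shows that both `lo` and `hi` minimize mom - w mass among the
minimizers, where w is the derivative. The two values are therefore equal, and w is the quotient of
the increments of mom and mass.

The second is `integral_pos_mul_u`: at each time u(pos) is the mean of the starting velocities of
the labels at the same place. Integrating the total derivative of a test function along each
trajectory against the mass gives the continuity equation. Integrating it against the starting
momentum, and replacing one factor u by the starting velocity, gives the momentum equation. The
identity for m follows by writing ∫ φ dX along a path X as the integral of φ_t over the region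
beyond X.

The limits of u at t = 0 and at x = 0 are local. Near a point of differentiability of the
primitives, the potential is ε P + Q with P almost linear and Q almost quadratic, which fixes the
minimizer to first order in ε; u is squeezed between the velocities of the extreme minimizers. For
the limit of the momentum, the smooth data make the minimizing label a C¹ function of x near 0, by
inverting the flight map s ↦ (t + s) vel(s). -/

namespace PressurelessGas

/-! ### The line of labels and the common potential -/

namespace Data

noncomputable section

/-- Mass density on the line of labels: the label `s > 0` stands for the initial particle at `s`,
the label `s < 0` for the particle which enters through the boundary at the time `-s`. -/
def dens (D : Data) (s : ℝ) : ℝ :=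
  -- The label 0 carries no mass; the value 1 keeps the density positive everywhere.
  if 0 < s then D.ρ₀ s else if s < 0 then D.ρb (-s) * D.ub (-s) else 1

/-- The velocity with which the particle labelled `s` starts. -/
def vel (D : Data) (s : ℝ) : ℝ :=
  if 0 < s then D.u₀ s else if s < 0 then D.ub (-s) else 0

/-- The density of the part of the potential which does not depend on `(x, t)`. -/
def arm (D : Data) (s : ℝ) : ℝ :=
  if 0 ≤ s then s * D.dens s else s * (D.vel s * D.dens s)

/-- Mass of the labels between `0` and `s`. -/
def mass (D : Data) (s : ℝ) : ℝ := ∫ η in (0 : ℝ)..s, D.dens η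

/-- Momentum of the labels between `0` and `s`. -/
def mom (D : Data) (s : ℝ) : ℝ := ∫ η in (0 : ℝ)..s, D.vel η * D.dens η

/-- The part of the potential which does not depend on `(x, t)`. -/
def ener (D : Data) (s : ℝ) : ℝ := ∫ η in (0 : ℝ)..s, D.arm η

/-- The potential on the line of labels, which unites `F(y, x, t)` and `G(τ, x, t)`. -/
def pot (D : Data) (s x t : ℝ) : ℝ := t * D.mom s - x * D.mass s + D.ener s

/-- The density of the potential. -/
def kern (D : Data) (x t s : ℝ) : ℝ := t * (D.vel s * D.dens s) - x * D.dens s + D.arm s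

end

variable {D : Data}

lemma dens_of_pos {s : ℝ} (h : 0 < s) : D.dens s = D.ρ₀ s := by simp [dens, h]

lemma dens_of_neg {s : ℝ} (h : s < 0) : D.dens s = D.ρb (-s) * D.ub (-s) := by
  simp [dens, h, h.le.not_gt]

lemma vel_of_pos {s : ℝ} (h : 0 < s) : D.vel s = D.u₀ s := by simp [vel, h]

lemma vel_of_neg {s : ℝ} (h : s < 0) : D.vel s = D.ub (-s) := by
  simp [vel, h, h.le.not_gt]

/-- The bracket is the free flight position s + t vel(s) minus x; for s ≤ 0 it is (t + s) vel(s) -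
x, since the flight starts at 0 at the time -s. So the sign of the kernel tells whether the freely
flying particle is beyond x. Both formulas hold at s = 0 because `vel` vanishes there. -/
lemma kern_of_nonneg {x t s : ℝ} (h : 0 ≤ s) :
    D.kern x t s = (t * D.vel s + s - x) * D.dens s := by
  simp only [kern, arm, h, if_true]; ring

lemma kern_of_nonpos {x t s : ℝ} (h : s ≤ 0) :
    D.kern x t s = ((t + s) * D.vel s - x) * D.dens s := by
  rcases h.lt_or_eq with h | rfl
  · simp only [kern, arm, h.not_ge, if_false]; ring
  · simp only [kern, arm, vel]; simp

lemma intervalIntegrable_of_locallyBounded {f : ℝ → ℝ} (hf : Measurable f)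
    (hb : ∀ R : ℝ, ∃ C : ℝ, ∀ s : ℝ, |s| ≤ R → |f s| ≤ C) (a b : ℝ) :
    IntervalIntegrable f volume a b := by
  obtain ⟨C, hC⟩ := hb (max |a| |b|)
  rw [intervalIntegrable_iff]
  refine Measure.integrableOn_of_bounded (M := C) (by simp) hf.aestronglyMeasurable ?_
  filter_upwards [ae_restrict_mem measurableSet_uIoc] with s hs
  refine hC s ?_
  have := uIoc_subset_uIcc hs
  exact (abs_le_max_abs_abs this.1 this.2).trans (by
    rcases le_total a b with h | h <;> simp [h, max_comm])

namespace Admissible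

lemma measurable_dens (hD : D.Admissible) : Measurable D.dens := by
  unfold dens
  refine Measurable.ite measurableSet_Ioi hD.measurable_ρ₀
    (Measurable.ite measurableSet_Iio ?_ measurable_const)
  exact (hD.measurable_ρb.comp measurable_neg).mul (hD.measurable_ub.comp measurable_neg)

lemma measurable_vel (hD : D.Admissible) : Measurable D.vel := by
  unfold vel
  exact Measurable.ite measurableSet_Ioi hD.measurable_u₀
    (Measurable.ite measurableSet_Iio (hD.measurable_ub.comp measurable_neg) measurable_const)

lemma measurable_arm (hD : D.Admissible) : Measurable D.arm := by
  unfold arm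
  exact Measurable.ite measurableSet_Ici (measurable_id.mul hD.measurable_dens)
    (measurable_id.mul (hD.measurable_vel.mul hD.measurable_dens))

lemma dens_pos (hD : D.Admissible) (s : ℝ) : 0 < D.dens s := by
  rcases lt_trichotomy s 0 with h | rfl | h
  · rw [dens_of_neg h]
    exact mul_pos (hD.ρb_pos _ (by linarith)) (hD.ub_pos _ (by linarith))
  · simp [dens]
  · rw [dens_of_pos h]; exact hD.ρ₀_pos _ h

lemma vel_pos_of_neg (hD : D.Admissible) {s : ℝ} (h : s < 0) : 0 < D.vel s := by
  rw [vel_of_neg h]; exact hD.ub_pos _ (by linarith)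

/-- The strict bound turns the comparisons of finite propagation speed into strict inequalities,
which exclude minimizers. -/
lemma exists_speed_bound (hD : D.Admissible) : ∃ C : ℝ, 0 < C ∧ ∀ s, |D.vel s| < C := by
  obtain ⟨C₁, h₁⟩ := hD.bounded_u₀
  obtain ⟨C₂, h₂⟩ := hD.bounded_ub
  refine ⟨max 0 (max C₁ C₂) + 1, by positivity, fun s => ?_⟩
  have a1 := le_max_left 0 (max C₁ C₂)
  have a2 := le_max_right 0 (max C₁ C₂)
  have a3 := le_max_left C₁ C₂
  have a4 := le_max_right C₁ C₂
  rcases lt_trichotomy s 0 with h | rfl | h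
  · rw [vel_of_neg h]; linarith [h₂ (-s) (by linarith)]
  · simp [vel]; linarith
  · rw [vel_of_pos h]; linarith [h₁ s h]

lemma dens_locallyBounded (hD : D.Admissible) (R : ℝ) :
    ∃ C : ℝ, ∀ s : ℝ, |s| ≤ R → |D.dens s| ≤ C := by
  obtain ⟨C₁, h₁⟩ := hD.locallyBounded_ρ₀ R
  obtain ⟨C₂, h₂⟩ := hD.bounded_ub
  obtain ⟨C₃, h₃⟩ := hD.locallyBounded_ρb R
  refine ⟨max 1 (max C₁ (C₃ * C₂)), fun s hs => ?_⟩
  rw [abs_of_pos (hD.dens_pos s)]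
  rcases lt_trichotomy s 0 with h | rfl | h
  · rw [dens_of_neg h]
    refine le_max_of_le_right (le_max_of_le_right ?_)
    have h4 := h₃ (-s) (by linarith) ((neg_le_abs s).trans hs)
    have h5 := hD.ρb_pos (-s) (by linarith)
    have h6 := hD.ub_pos (-s) (by linarith)
    have h7 := (le_abs_self _).trans (h₂ (-s) (by linarith))
    exact mul_le_mul h4 h7 h6.le (by linarith)
  · simp [dens]
  · rw [dens_of_pos h]
    exact le_max_of_le_right (le_max_of_le_left (h₁ s h ((le_abs_self s).trans hs)))

lemma vel_mul_dens_locallyBounded (hD : D.Admissible) (R : ℝ) :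
    ∃ C : ℝ, ∀ s : ℝ, |s| ≤ R → |D.vel s * D.dens s| ≤ C := by
  obtain ⟨C, hC0, hC⟩ := hD.exists_speed_bound
  obtain ⟨K, hK⟩ := hD.dens_locallyBounded R
  refine ⟨C * K, fun s hs => ?_⟩
  rw [abs_mul]
  exact mul_le_mul (hC s).le (hK s hs) (abs_nonneg _) hC0.le

lemma arm_locallyBounded (hD : D.Admissible) (R : ℝ) :
    ∃ C : ℝ, ∀ s : ℝ, |s| ≤ R → |D.arm s| ≤ C := by
  obtain ⟨C₁, h₁⟩ := hD.dens_locallyBounded R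
  obtain ⟨C₂, h₂⟩ := hD.vel_mul_dens_locallyBounded R
  refine ⟨R * (C₁ + C₂), fun s hs => ?_⟩
  have h1 := h₁ s hs
  have h2 := h₂ s hs
  have hR := (abs_nonneg s).trans hs
  have p1 := (abs_nonneg _).trans h1
  have p2 := (abs_nonneg _).trans h2
  unfold arm
  split_ifs
  · rw [abs_mul]; exact mul_le_mul hs (by linarith) (abs_nonneg _) hR
  · rw [abs_mul]; exact mul_le_mul hs (by linarith) (abs_nonneg _) hR

lemma dens_intervalIntegrable (hD : D.Admissible) (a b : ℝ) :
    IntervalIntegrable D.dens volume a b :=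
  intervalIntegrable_of_locallyBounded hD.measurable_dens hD.dens_locallyBounded a b

lemma vel_mul_dens_intervalIntegrable (hD : D.Admissible) (a b : ℝ) :
    IntervalIntegrable (fun s => D.vel s * D.dens s) volume a b :=
  intervalIntegrable_of_locallyBounded (hD.measurable_vel.mul hD.measurable_dens)
    hD.vel_mul_dens_locallyBounded a b

lemma arm_intervalIntegrable (hD : D.Admissible) (a b : ℝ) :
    IntervalIntegrable D.arm volume a b :=
  intervalIntegrable_of_locallyBounded hD.measurable_arm hD.arm_locallyBounded a b

lemma kern_intervalIntegrable (hD : D.Admissible) (x t a b : ℝ) :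
    IntervalIntegrable (D.kern x t) volume a b := by
  unfold kern
  exact (((hD.vel_mul_dens_intervalIntegrable a b).const_mul t).sub
    ((hD.dens_intervalIntegrable a b).const_mul x)).add (hD.arm_intervalIntegrable a b)

lemma mass_sub (hD : D.Admissible) (a b : ℝ) : D.mass b - D.mass a = ∫ s in a..b, D.dens s :=
  intervalIntegral.integral_interval_sub_left (hD.dens_intervalIntegrable _ _)
    (hD.dens_intervalIntegrable _ _)

lemma mom_sub (hD : D.Admissible) (a b : ℝ) :
    D.mom b - D.mom a = ∫ s in a..b, D.vel s * D.dens s :=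
  intervalIntegral.integral_interval_sub_left (hD.vel_mul_dens_intervalIntegrable _ _)
    (hD.vel_mul_dens_intervalIntegrable _ _)

lemma ener_sub (hD : D.Admissible) (a b : ℝ) : D.ener b - D.ener a = ∫ s in a..b, D.arm s :=
  intervalIntegral.integral_interval_sub_left (hD.arm_intervalIntegrable _ _)
    (hD.arm_intervalIntegrable _ _)

lemma pot_sub (hD : D.Admissible) (a b x t : ℝ) :
    D.pot b x t - D.pot a x t = ∫ s in a..b, D.kern x t s := by
  unfold kern
  rw [intervalIntegral.integral_add _ (hD.arm_intervalIntegrable a b),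
    intervalIntegral.integral_sub, intervalIntegral.integral_const_mul,
    intervalIntegral.integral_const_mul, ← hD.mass_sub, ← hD.mom_sub, ← hD.ener_sub]
  · unfold pot; ring
  · exact (hD.vel_mul_dens_intervalIntegrable a b).const_mul t
  · exact (hD.dens_intervalIntegrable a b).const_mul x
  · exact ((hD.vel_mul_dens_intervalIntegrable a b).const_mul t).sub
      ((hD.dens_intervalIntegrable a b).const_mul x)

lemma continuous_mass (hD : D.Admissible) : Continuous D.mass :=
  intervalIntegral.continuous_primitive hD.dens_intervalIntegrable 0

lemma continuous_mom (hD : D.Admissible) : Continuous D.mom :=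
  intervalIntegral.continuous_primitive hD.vel_mul_dens_intervalIntegrable 0

lemma continuous_ener (hD : D.Admissible) : Continuous D.ener :=
  intervalIntegral.continuous_primitive hD.arm_intervalIntegrable 0

lemma continuous_pot (hD : D.Admissible) :
    Continuous fun q : ℝ × ℝ × ℝ => D.pot q.1 q.2.1 q.2.2 := by
  unfold pot
  have := hD.continuous_mass
  have := hD.continuous_mom
  have := hD.continuous_ener
  fun_prop

lemma strictMono_mass (hD : D.Admissible) : StrictMono D.mass := by
  intro a b hab
  have := intervalIntegral.intervalIntegral_pos_of_pos (hD.dens_intervalIntegrable a b)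
    hD.dens_pos hab
  linarith [hD.mass_sub a b]

lemma abs_mom_sub_le (hD : D.Admissible) {C : ℝ} (hC : ∀ s, |D.vel s| < C) {a b : ℝ}
    (hab : a ≤ b) : |D.mom b - D.mom a| ≤ C * (D.mass b - D.mass a) := by
  rw [hD.mass_sub, hD.mom_sub, ← intervalIntegral.integral_const_mul]
  refine (intervalIntegral.abs_integral_le_integral_abs hab).trans ?_
  refine intervalIntegral.integral_mono_on hab (hD.vel_mul_dens_intervalIntegrable a b).abs
    ((hD.dens_intervalIntegrable a b).const_mul C) fun s _ => ?_
  rw [abs_mul, abs_of_pos (hD.dens_pos s)]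
  exact mul_le_mul_of_nonneg_right (hC s).le (hD.dens_pos s).le

lemma abs_mom_sub_lt (hD : D.Admissible) {C : ℝ} (hC : ∀ s, |D.vel s| < C) {a b : ℝ}
    (hab : a < b) : |D.mom b - D.mom a| < C * (D.mass b - D.mass a) := by
  -- The two one-sided inequalities are the cases σ = 1 and σ = -1 of the positivity of ∫ (C - σ
  -- vel) dens.
  have e : ∀ σ : ℝ, |σ| = 1 → 0 < C * (D.mass b - D.mass a) - σ * (D.mom b - D.mom a) := by
    intro σ hσ
    rw [hD.mass_sub, hD.mom_sub, ← intervalIntegral.integral_const_mul,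
      ← intervalIntegral.integral_const_mul, ← intervalIntegral.integral_sub
      ((hD.dens_intervalIntegrable a b).const_mul C)
      ((hD.vel_mul_dens_intervalIntegrable a b).const_mul σ)]
    refine intervalIntegral.intervalIntegral_pos_of_pos
      (((hD.dens_intervalIntegrable a b).const_mul C).sub
        ((hD.vel_mul_dens_intervalIntegrable a b).const_mul σ)) (fun s => ?_) hab
    have h1 : σ * D.vel s < C := (le_abs_self _).trans_lt (by rw [abs_mul, hσ, one_mul]; exact hC s)
    have := mul_pos (sub_pos.2 h1) (hD.dens_pos s)
    nlinarith
  have h1 := e 1 (by simp)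
  have h2 := e (-1) (by simp)
  rw [abs_lt]; constructor <;> linarith

/-- A positive integrand on an open interval makes the potential increase. -/
lemma pot_lt_pot_of_kern_pos (hD : D.Admissible) {a b x t : ℝ} (hab : a < b)
    (h : ∀ s ∈ Ioo a b, 0 < D.kern x t s) : D.pot a x t < D.pot b x t := by
  have := intervalIntegral.intervalIntegral_pos_of_pos_on (hD.kern_intervalIntegrable x t a b)
    h hab
  linarith [hD.pot_sub a b x t]

lemma pot_lt_pot_of_kern_neg (hD : D.Admissible) {a b x t : ℝ} (hab : a < b)
    (h : ∀ s ∈ Ioo a b, D.kern x t s < 0) : D.pot b x t < D.pot a x t := by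
  have := intervalIntegral.intervalIntegral_pos_of_pos_on
    (hD.kern_intervalIntegrable x t a b).neg (fun s hs => by simpa using h s hs) hab
  simp only [Pi.neg_apply, intervalIntegral.integral_neg] at this
  linarith [hD.pot_sub a b x t]

section

variable {C : ℝ} {x t a b : ℝ}

/-- Finite propagation speed: labels beyond x + C t are still to the right of x at time t, so the
kernel is positive there. In the next two lemmas the labels cannot have reached x, and the kernel is
negative. -/
lemma pot_lt_of_right (hD : D.Admissible) (hC : ∀ s, |D.vel s| < C) (ht : 0 ≤ t) (h0 : 0 ≤ a)
    (ha : x + C * t ≤ a) (hab : a < b) : D.pot a x t < D.pot b x t := by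
  refine hD.pot_lt_pot_of_kern_pos hab fun s hs => ?_
  rw [kern_of_nonneg (by linarith [hs.1])]
  refine mul_pos ?_ (hD.dens_pos s)
  have h1 := (abs_lt.1 (hC s)).1
  nlinarith [hs.1]

lemma pot_lt_of_left (hD : D.Admissible) (hC : ∀ s, |D.vel s| < C) (ht : 0 ≤ t) (h0 : 0 ≤ a)
    (hb : b ≤ x - C * t) (hab : a < b) : D.pot b x t < D.pot a x t := by
  refine hD.pot_lt_pot_of_kern_neg hab fun s hs => ?_
  rw [kern_of_nonneg (by linarith [hs.1])]
  refine mul_neg_of_neg_of_pos ?_ (hD.dens_pos s)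
  have h1 := (abs_lt.1 (hC s)).2
  nlinarith [hs.2]

lemma pot_lt_of_neg (hD : D.Admissible) (hC : ∀ s, |D.vel s| < C) (hx : 0 ≤ x) (h0 : b ≤ 0)
    (hb : C * (t + b) ≤ x) (hab : a < b) : D.pot b x t < D.pot a x t := by
  refine hD.pot_lt_pot_of_kern_neg hab fun s hs => ?_
  have hs0 : s < 0 := by linarith [hs.2]
  rw [kern_of_nonpos hs0.le]
  refine mul_neg_of_neg_of_pos ?_ (hD.dens_pos s)
  have h1 := (abs_lt.1 (hC s)).2
  have h2 := hD.vel_pos_of_neg hs0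
  have h3 := hs.2
  rcases lt_or_ge (t + s) 0 with h | h
  · nlinarith
  · nlinarith

end

end Admissible

lemma pot_zero (x t : ℝ) : D.pot 0 x t = 0 := by simp [pot, mass, mom, ener]

lemma Admissible.Fpot_eq (hD : D.Admissible) {y : ℝ} (hy : 0 ≤ y) (x t : ℝ) :
    D.Fpot y x t = D.pot y x t := by
  have h := hD.pot_sub 0 y x t
  rw [pot_zero, sub_zero] at h
  rw [h, Fpot]
  refine intervalIntegral.integral_congr_ae (ae_of_all _ fun s hs => ?_)
  rw [uIoc_of_le hy] at hs
  rw [kern_of_nonneg hs.1.le, vel_of_pos hs.1, dens_of_pos hs.1]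

lemma integral_zero_neg (f : ℝ → ℝ) (τ : ℝ) :
    ∫ s in (0 : ℝ)..(-τ), f s = -∫ s in (0 : ℝ)..τ, f (-s) := by
  rw [intervalIntegral.integral_comp_neg, neg_zero, ← intervalIntegral.integral_symm]

lemma Admissible.Gpot_eq (hD : D.Admissible) {τ : ℝ} (hτ : 0 ≤ τ) (x t : ℝ) :
    D.Gpot τ x t = D.pot (-τ) x t := by
  have h := hD.pot_sub 0 (-τ) x t
  rw [pot_zero, sub_zero] at h
  rw [h, Gpot, integral_zero_neg, ← intervalIntegral.integral_neg]
  refine intervalIntegral.integral_congr_ae (ae_of_all _ fun s hs => ?_)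
  rw [uIoc_of_le hτ] at hs
  have := neg_neg_of_pos hs.1
  rw [kern_of_nonpos this.le, vel_of_neg this, dens_of_neg this, neg_neg]
  ring

lemma mass_of_nonneg {y : ℝ} (hy : 0 ≤ y) : D.mass y = ∫ s in (0 : ℝ)..y, D.ρ₀ s := by
  refine intervalIntegral.integral_congr_ae (ae_of_all _ fun s hs => ?_)
  rw [uIoc_of_le hy] at hs
  rw [dens_of_pos hs.1]

lemma mom_of_nonneg {y : ℝ} (hy : 0 ≤ y) : D.mom y = ∫ s in (0 : ℝ)..y, D.ρ₀ s * D.u₀ s := by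
  refine intervalIntegral.integral_congr_ae (ae_of_all _ fun s hs => ?_)
  rw [uIoc_of_le hy] at hs
  rw [dens_of_pos hs.1, vel_of_pos hs.1, mul_comm]

lemma mass_neg {τ : ℝ} (hτ : 0 ≤ τ) :
    D.mass (-τ) = -∫ s in (0 : ℝ)..τ, D.ρb s * D.ub s := by
  rw [mass, integral_zero_neg]
  congr 1
  refine intervalIntegral.integral_congr_ae (ae_of_all _ fun s hs => ?_)
  rw [uIoc_of_le hτ] at hs
  rw [dens_of_neg (neg_neg_of_pos hs.1), neg_neg]

lemma mom_neg {τ : ℝ} (hτ : 0 ≤ τ) :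
    D.mom (-τ) = -∫ s in (0 : ℝ)..τ, D.ρb s * D.ub s ^ 2 := by
  rw [mom, integral_zero_neg]
  congr 1
  refine intervalIntegral.integral_congr_ae (ae_of_all _ fun s hs => ?_)
  rw [uIoc_of_le hτ] at hs
  rw [dens_of_neg (neg_neg_of_pos hs.1), vel_of_neg (neg_neg_of_pos hs.1), neg_neg]
  ring

end Data
end PressurelessGas

/-! ### Minimizers: existence, semicontinuity, comparison -/

namespace PressurelessGas

namespace Data

/-- The minimizers of the potential among the labels in `I`. -/
def argmin (D : Data) (I : Set ℝ) (x t : ℝ) : Set ℝ :=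
  {s | s ∈ I ∧ ∀ σ ∈ I, D.pot s x t ≤ D.pot σ x t}

noncomputable section

/-- The smallest minimizer in `I`. -/
def lo (D : Data) (I : Set ℝ) (x t : ℝ) : ℝ := sInf (D.argmin I x t)

/-- The largest minimizer in `I`. -/
def hi (D : Data) (I : Set ℝ) (x t : ℝ) : ℝ := sSup (D.argmin I x t)

end

/-- The closed intervals of labels around `0`, among them the line and its two half lines. -/
structure LabelRange (I : Set ℝ) : Prop where
  closed : IsClosed I
  ordConnected : I.OrdConnected
  zero_mem : (0 : ℝ) ∈ I

lemma LabelRange.univ : LabelRange Set.univ := ⟨isClosed_univ, ordConnected_univ, mem_univ _⟩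
lemma LabelRange.Ici : LabelRange (Set.Ici 0) := ⟨isClosed_Ici, ordConnected_Ici, by simp⟩
lemma LabelRange.Iic : LabelRange (Set.Iic 0) := ⟨isClosed_Iic, ordConnected_Iic, by simp⟩

/-- The closed quarter plane. -/
def quarter : Set (ℝ × ℝ) := {p | 0 ≤ p.1 ∧ 0 ≤ p.2}

lemma isClosed_quarter : IsClosed quarter :=
  (isClosed_le continuous_const continuous_fst).inter
    (isClosed_le continuous_const continuous_snd)

variable {D : Data} {C : ℝ} {I : Set ℝ} {x t x' t' s s' c : ℝ}

/-- Comparison of minimizers at two points of the quarter plane. -/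
lemma argmin_compare (h : s ∈ D.argmin I x t) (h' : s' ∈ D.argmin I x' t') :
    (t' - t) * (D.mom s' - D.mom s) ≤ (x' - x) * (D.mass s' - D.mass s) := by
  have h1 := h.2 s' h'.1
  have h2 := h'.2 s h.1
  unfold pot at h1 h2
  linarith

namespace Admissible

/-- Outside these bounds the potential is strictly monotone: labels below -t have not entered yet,
labels above x + C t cannot have come back to x. -/
lemma argmin_subset_Icc (hD : D.Admissible) (hC : ∀ s, |D.vel s| < C) (hI : LabelRange I)
    (hx : 0 ≤ x) (ht : 0 ≤ t) : D.argmin I x t ⊆ Icc (-t) (x + C * t) := by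
  have hC0 : 0 < C := (abs_nonneg _).trans_lt (hC 0)
  intro s hs
  constructor
  · by_contra! h
    have hm : -t ∈ I := hI.ordConnected.out hs.1 hI.zero_mem ⟨h.le, by linarith⟩
    have := hD.pot_lt_of_neg hC hx (by linarith) (by simpa using hx) h (t := t)
    linarith [hs.2 _ hm]
  · by_contra! h
    have h0 : 0 ≤ x + C * t := by positivity
    have hm : x + C * t ∈ I := hI.ordConnected.out hI.zero_mem hs.1 ⟨h0, h.le⟩
    have := hD.pot_lt_of_right hC ht h0 le_rfl h
    linarith [hs.2 _ hm]

lemma argmin_nonempty (hD : D.Admissible) (hI : LabelRange I) (hx : 0 ≤ x) (ht : 0 ≤ t) :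
    (D.argmin I x t).Nonempty := by
  obtain ⟨C, hC0, hC⟩ := hD.exists_speed_bound
  have h0 : 0 ≤ x + C * t := by positivity
  have hc : Continuous fun s => D.pot s x t :=
    hD.continuous_pot.comp (by fun_prop : Continuous fun s : ℝ => (s, x, t))
  have hcomp : IsCompact (I ∩ Icc (-t) (x + C * t)) := isCompact_Icc.inter_left hI.closed
  obtain ⟨s, hs, hmin⟩ := hcomp.exists_isMinOn
    ⟨0, hI.zero_mem, by constructor <;> linarith⟩ hc.continuousOn
  refine ⟨s, hs.1, fun σ hσ => ?_⟩
  rcases lt_or_ge σ (-t) with h | h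
  · have hm : -t ∈ I := hI.ordConnected.out hσ hI.zero_mem ⟨h.le, by linarith⟩
    have h1 := hD.pot_lt_of_neg hC hx (by linarith) (by simpa using hx) h (t := t)
    have h2 : D.pot s x t ≤ D.pot (-t) x t := hmin ⟨hm, le_rfl, by linarith⟩
    linarith
  rcases lt_or_ge (x + C * t) σ with h' | h'
  · have hm : x + C * t ∈ I := hI.ordConnected.out hI.zero_mem hσ ⟨h0, h'.le⟩
    have h1 := hD.pot_lt_of_right hC ht h0 le_rfl h'
    have h2 : D.pot s x t ≤ D.pot (x + C * t) x t := hmin ⟨hm, by linarith, le_rfl⟩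
    linarith
  · exact hmin ⟨hσ, h, h'⟩

/-- The potential is jointly continuous, and minimality is an intersection of closed conditions, one
for each competitor. -/
lemma isClosed_graph_argmin (hD : D.Admissible) (hI : LabelRange I) :
    IsClosed {q : ℝ × ℝ × ℝ | q.1 ∈ D.argmin I q.2.1 q.2.2} := by
  have : {q : ℝ × ℝ × ℝ | q.1 ∈ D.argmin I q.2.1 q.2.2} =
      (Prod.fst ⁻¹' I) ∩ ⋂ σ ∈ I, {q | D.pot q.1 q.2.1 q.2.2 ≤ D.pot σ q.2.1 q.2.2} := by
    ext q; simp [argmin]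
  rw [this]
  refine (hI.closed.preimage continuous_fst).inter (isClosed_biInter fun σ _ => ?_)
  exact isClosed_le hD.continuous_pot
    (hD.continuous_pot.comp (by fun_prop : Continuous fun q : ℝ × ℝ × ℝ => (σ, q.2.1, q.2.2)))

lemma isClosed_argmin (hD : D.Admissible) (hI : LabelRange I) : IsClosed (D.argmin I x t) :=
  (hD.isClosed_graph_argmin hI).preimage (by fun_prop : Continuous fun s : ℝ => (s, x, t))

lemma isCompact_argmin (hD : D.Admissible) (hI : LabelRange I) (hx : 0 ≤ x) (ht : 0 ≤ t) :
    IsCompact (D.argmin I x t) := by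
  obtain ⟨C, hC0, hC⟩ := hD.exists_speed_bound
  exact isCompact_Icc.of_isClosed_subset (hD.isClosed_argmin hI)
    (hD.argmin_subset_Icc hC hI hx ht)

lemma lo_mem (hD : D.Admissible) (hI : LabelRange I) (hx : 0 ≤ x) (ht : 0 ≤ t) :
    D.lo I x t ∈ D.argmin I x t :=
  (hD.isCompact_argmin hI hx ht).sInf_mem (hD.argmin_nonempty hI hx ht)

lemma hi_mem (hD : D.Admissible) (hI : LabelRange I) (hx : 0 ≤ x) (ht : 0 ≤ t) :
    D.hi I x t ∈ D.argmin I x t :=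
  (hD.isCompact_argmin hI hx ht).sSup_mem (hD.argmin_nonempty hI hx ht)

lemma lo_le (hD : D.Admissible) (hI : LabelRange I) (hx : 0 ≤ x) (ht : 0 ≤ t)
    (hs : s ∈ D.argmin I x t) : D.lo I x t ≤ s :=
  csInf_le (hD.isCompact_argmin hI hx ht).bddBelow hs

lemma le_hi (hD : D.Admissible) (hI : LabelRange I) (hx : 0 ≤ x) (ht : 0 ≤ t)
    (hs : s ∈ D.argmin I x t) : s ≤ D.hi I x t :=
  le_csSup (hD.isCompact_argmin hI hx ht).bddAbove hs

lemma lo_le_hi (hD : D.Admissible) (hI : LabelRange I) (hx : 0 ≤ x) (ht : 0 ≤ t) :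
    D.lo I x t ≤ D.hi I x t := hD.lo_le hI hx ht (hD.hi_mem hI hx ht)

/-- Limits of minimizers are minimizers, and minimizers stay bounded. -/
lemma exists_subseq_argmin (hD : D.Admissible) (hI : LabelRange I) {p : ℕ → ℝ × ℝ}
    {p₀ : ℝ × ℝ} (hp : ∀ n, p n ∈ quarter) (hlim : Tendsto p atTop (𝓝 p₀)) {σ : ℕ → ℝ}
    (hσ : ∀ n, σ n ∈ D.argmin I (p n).1 (p n).2) :
    ∃ s ∈ D.argmin I p₀.1 p₀.2, ∃ φ : ℕ → ℕ, StrictMono φ ∧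
      Tendsto (σ ∘ φ) atTop (𝓝 s) := by
  obtain ⟨C, hC0, hC⟩ := hD.exists_speed_bound
  have hb : Bornology.IsBounded (range p) := Metric.isBounded_range_of_tendsto p hlim
  obtain ⟨R, hR⟩ := hb.exists_norm_le
  have hσb : ∀ n, σ n ∈ Icc (-R) (R + C * R) := fun n => by
    have h1 := hD.argmin_subset_Icc hC hI (hp n).1 (hp n).2 (hσ n)
    have h2 : ‖p n‖ ≤ R := hR _ ⟨n, rfl⟩
    have h3 := (le_abs_self _).trans ((norm_fst_le (p n)).trans h2)
    have h4 := (le_abs_self _).trans ((norm_snd_le (p n)).trans h2)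
    refine ⟨by linarith [h1.1], h1.2.trans ?_⟩
    have := mul_le_mul_of_nonneg_left h4 hC0.le
    linarith
  obtain ⟨s, -, φ, hφ, hs⟩ := isCompact_Icc.tendsto_subseq hσb
  refine ⟨s, ?_, φ, hφ, hs⟩
  have hl : Tendsto (fun n => ((σ ∘ φ) n, p (φ n))) atTop (𝓝 (s, p₀)) :=
    hs.prodMk_nhds (hlim.comp hφ.tendsto_atTop)
  exact (hD.isClosed_graph_argmin hI).mem_of_tendsto hl
    (Eventually.of_forall fun n => hσ (φ n))

/-- Upper semicontinuity of the largest minimizer: a limit of largest minimizers is a minimizer,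
hence at most the largest one. The smallest minimizer is lower semicontinuous for the same reason.
-/
lemma isClosed_le_hi (hD : D.Admissible) (hI : LabelRange I) (c : ℝ) :
    IsClosed {p : ℝ × ℝ | p ∈ quarter ∧ c ≤ D.hi I p.1 p.2} := by
  refine isClosed_of_closure_subset fun p₀ hp₀ => ?_
  obtain ⟨p, hp, hlim⟩ := mem_closure_iff_seq_limit.1 hp₀
  have hq : p₀ ∈ quarter := isClosed_quarter.mem_of_tendsto hlim
    (Eventually.of_forall fun n => (hp n).1)
  obtain ⟨s, hs, φ, hφ, hlim'⟩ := hD.exists_subseq_argmin hI (fun n => (hp n).1) hlim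
    (fun n => hD.hi_mem hI (hp n).1.1 (hp n).1.2)
  refine ⟨hq, (ge_of_tendsto' hlim' fun n => (hp (φ n)).2).trans ?_⟩
  exact hD.le_hi hI hq.1 hq.2 hs

lemma isClosed_lo_le (hD : D.Admissible) (hI : LabelRange I) (c : ℝ) :
    IsClosed {p : ℝ × ℝ | p ∈ quarter ∧ D.lo I p.1 p.2 ≤ c} := by
  refine isClosed_of_closure_subset fun p₀ hp₀ => ?_
  obtain ⟨p, hp, hlim⟩ := mem_closure_iff_seq_limit.1 hp₀
  have hq : p₀ ∈ quarter := isClosed_quarter.mem_of_tendsto hlim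
    (Eventually.of_forall fun n => (hp n).1)
  obtain ⟨s, hs, φ, hφ, hlim'⟩ := hD.exists_subseq_argmin hI (fun n => (hp n).1) hlim
    (fun n => hD.lo_mem hI (hp n).1.1 (hp n).1.2)
  refine ⟨hq, le_trans ?_ (le_of_tendsto' hlim' fun n => (hp (φ n)).2)⟩
  exact hD.lo_le hI hq.1 hq.2 hs

lemma eventually_hi_lt (hD : D.Admissible) (hI : LabelRange I)
    (hc : D.hi I x t < c) : ∀ᶠ p in 𝓝[quarter] (x, t), D.hi I p.1 p.2 < c := by
  have h := (hD.isClosed_le_hi hI c).isOpen_compl.mem_nhds (x := (x, t))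
    (by simp only [mem_compl_iff, mem_ofPred_eq, not_and, not_le]; exact fun _ => hc)
  filter_upwards [mem_nhdsWithin_of_mem_nhds h, self_mem_nhdsWithin] with p hp hq
  by_contra! h'
  exact hp ⟨hq, h'⟩

lemma eventually_lt_lo (hD : D.Admissible) (hI : LabelRange I)
    (hc : c < D.lo I x t) : ∀ᶠ p in 𝓝[quarter] (x, t), c < D.lo I p.1 p.2 := by
  have h := (hD.isClosed_lo_le hI c).isOpen_compl.mem_nhds (x := (x, t))
    (by simp only [mem_compl_iff, mem_ofPred_eq, not_and, not_le]; exact fun _ => hc)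
  filter_upwards [mem_nhdsWithin_of_mem_nhds h, self_mem_nhdsWithin] with p hp hq
  by_contra! h'
  exact hp ⟨hq, h'⟩

/-- Minimizers are nondecreasing in `x`. -/
lemma argmin_mono (hD : D.Admissible) (h : s ∈ D.argmin I x t) (h' : s' ∈ D.argmin I x' t)
    (hx : x < x') : s ≤ s' := by
  have := argmin_compare h h'
  rw [sub_self, zero_mul] at this
  have h1 := nonneg_of_mul_nonneg_right this (sub_pos.2 hx)
  exact hD.strictMono_mass.le_iff_le.1 (by linarith)

/-- Along a path to the right that is at least as fast as C, minimizers cannot decrease: otherwise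
`argmin_compare` would contradict |Δmom| < C |Δmass|. The mirror image for paths to the left
follows. -/
lemma argmin_mono_fast (hD : D.Admissible) (hC : ∀ s, |D.vel s| < C)
    (h : s ∈ D.argmin I x t) (h' : s' ∈ D.argmin I x' t') (ht : t < t')
    (hx : x + C * (t' - t) ≤ x') : s ≤ s' := by
  by_contra! hlt
  have h1 := argmin_compare h h'
  have h2 := (abs_lt.1 (hD.abs_mom_sub_lt hC hlt)).2
  have h3 := hD.strictMono_mass hlt
  nlinarith [mul_lt_mul_of_pos_left h2 (sub_pos.2 ht)]

lemma argmin_anti_fast (hD : D.Admissible) (hC : ∀ s, |D.vel s| < C)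
    (h : s ∈ D.argmin I x t) (h' : s' ∈ D.argmin I x' t') (ht : t < t')
    (hx : x' ≤ x - C * (t' - t)) : s' ≤ s := by
  by_contra! hlt
  have h1 := argmin_compare h h'
  have h2 := (abs_lt.1 (hD.abs_mom_sub_lt hC hlt)).1
  have h3 := hD.strictMono_mass hlt
  nlinarith [mul_lt_mul_of_pos_left h2 (sub_pos.2 ht)]

/-- A minimizer `s ≤ 0` has entered early enough to reach `x`. -/
lemma le_of_mem_argmin_of_neg (hD : D.Admissible) (hC : ∀ s, |D.vel s| < C) (hx : 0 ≤ x)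
    (hI : LabelRange I) (h : s ∈ D.argmin I x t) (h0 : s < 0) : x ≤ C * (t + s) := by
  by_contra! hlt
  have hC0 : 0 < C := (abs_nonneg _).trans_lt (hC 0)
  -- The label x / C - t is the last one that could arrive at x by time t at speed C. Up to it, cut
  -- off at 0, the potential still decreases, so no smaller label is minimal.
  have h2 : min 0 (x / C - t) ∈ I := hI.ordConnected.out h.1 hI.zero_mem
    ⟨le_min h0.le (by rw [le_sub_iff_add_le, le_div_iff₀ hC0]; linarith), min_le_left _ _⟩
  have h3 : s < min 0 (x / C - t) :=
    lt_min h0 (by rw [lt_sub_iff_add_lt, lt_div_iff₀ hC0]; linarith)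
  have h4 : C * (t + min 0 (x / C - t)) ≤ x := by
    have h5 := min_le_right 0 (x / C - t)
    have h6 : C * (x / C) = x := by field_simp
    nlinarith
  have := hD.pot_lt_of_neg hC hx (min_le_left _ _) h4 h3
  linarith [h.2 _ h2]

/-- Far from the boundary the minimizers lie on the positive half line. -/
lemma le_of_mem_argmin (hD : D.Admissible) (hC : ∀ s, |D.vel s| < C) (hx : 0 ≤ x) (ht : 0 ≤ t)
    (hI : LabelRange I) (hIci : Set.Ici 0 ⊆ I) (hCt : C * t ≤ x) (h : s ∈ D.argmin I x t) :
    x - C * t ≤ s := by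
  by_contra! hlt
  rcases le_or_gt 0 s with h0 | h0
  · have := hD.pot_lt_of_left hC ht h0 le_rfl hlt
    linarith [h.2 _ (hIci (h0.trans hlt.le))]
  · have := hD.le_of_mem_argmin_of_neg hC hx hI h h0
    have hC0 : 0 < C := (abs_nonneg _).trans_lt (hC 0)
    nlinarith

end Admissible

end Data
end PressurelessGas

/-! ### F, G, u and m in terms of labels -/

namespace PressurelessGas

namespace Data

variable {D : Data} {C : ℝ} {I : Set ℝ} {x t x' t' s s' c : ℝ}

namespace Admissible

lemma Fmin_eq (hD : D.Admissible) : D.Fmin x t = D.argmin (Ici 0) x t := by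
  ext y
  simp only [Fmin, argmin, mem_ofPred_eq, mem_Ici]
  refine and_congr_right fun hy => forall_congr' fun z => forall_congr' fun hz => ?_
  rw [hD.Fpot_eq hy, hD.Fpot_eq hz]

lemma Gmin_eq (hD : D.Admissible) : D.Gmin x t = -D.argmin (Iic 0) x t := by
  ext y
  simp only [Gmin, argmin, mem_ofPred_eq, mem_Iic, Set.mem_neg, neg_nonpos]
  refine and_congr_right fun hy => ⟨fun h σ hσ => ?_, fun h z hz => ?_⟩
  · have := h (-σ) (by linarith)
    rwa [hD.Gpot_eq hy, hD.Gpot_eq (by linarith), neg_neg] at this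
  · rw [hD.Gpot_eq hy, hD.Gpot_eq hz]
    exact h (-z) (by linarith)

lemma yLow_eq (hD : D.Admissible) : D.yLow x t = D.lo (Ici 0) x t := by
  rw [yLow, hD.Fmin_eq, lo]

lemma yUp_eq (hD : D.Admissible) : D.yUp x t = D.hi (Ici 0) x t := by
  rw [yUp, hD.Fmin_eq, hi]

/-- The reflection τ = -s exchanges smallest and largest minimizers. -/
lemma τLow_eq (hD : D.Admissible) : D.τLow x t = -D.hi (Iic 0) x t := by
  rw [τLow, hD.Gmin_eq, Real.sInf_def, neg_neg, hi]

lemma τUp_eq (hD : D.Admissible) : D.τUp x t = -D.lo (Iic 0) x t := by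
  rw [τUp, hD.Gmin_eq, lo, Real.sInf_def, neg_neg]

lemma F_eq (hD : D.Admissible) (hs : s ∈ D.argmin (Ici 0) x t) : D.F x t = D.pot s x t := by
  refine IsLeast.csInf_eq ⟨⟨s, hs.1, hD.Fpot_eq hs.1 x t⟩, ?_⟩
  rintro _ ⟨y, hy, rfl⟩
  simp only [hD.Fpot_eq hy]
  exact hs.2 y hy

lemma G_eq (hD : D.Admissible) (hs : s ∈ D.argmin (Iic 0) x t) : D.G x t = D.pot s x t := by
  have h0 : s ≤ 0 := hs.1
  refine IsLeast.csInf_eq ⟨⟨-s, by simpa using h0, by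
    simp only [hD.Gpot_eq (neg_nonneg.2 h0), neg_neg]⟩, ?_⟩
  rintro _ ⟨y, hy, rfl⟩
  simp only [hD.Gpot_eq hy]
  exact hs.2 _ (by simpa using hy)

lemma F_le (hD : D.Admissible) (hx : 0 ≤ x) (ht : 0 ≤ t) (hs : 0 ≤ s) :
    D.F x t ≤ D.pot s x t := by
  rw [hD.F_eq (hD.lo_mem .Ici hx ht)]
  exact (hD.lo_mem .Ici hx ht).2 s hs

lemma G_le (hD : D.Admissible) (hx : 0 ≤ x) (ht : 0 ≤ t) (hs : s ≤ 0) :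
    D.G x t ≤ D.pot s x t := by
  rw [hD.G_eq (hD.lo_mem .Iic hx ht)]
  exact (hD.lo_mem .Iic hx ht).2 s hs

lemma mem_argmin_univ_of_F_le (hD : D.Admissible) (hx : 0 ≤ x) (ht : 0 ≤ t)
    (h : D.F x t ≤ D.G x t) (hs : s ∈ D.argmin (Ici 0) x t) : s ∈ D.argmin univ x t := by
  refine ⟨mem_univ _, fun σ _ => ?_⟩
  rw [← hD.F_eq hs]
  rcases le_total 0 σ with h0 | h0
  · exact hD.F_le hx ht h0
  · exact h.trans (hD.G_le hx ht h0)

lemma mem_argmin_univ_of_G_le (hD : D.Admissible) (hx : 0 ≤ x) (ht : 0 ≤ t)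
    (h : D.G x t ≤ D.F x t) (hs : s ∈ D.argmin (Iic 0) x t) : s ∈ D.argmin univ x t := by
  refine ⟨mem_univ _, fun σ _ => ?_⟩
  rw [← hD.G_eq hs]
  rcases le_total 0 σ with h0 | h0
  · exact h.trans (hD.F_le hx ht h0)
  · exact hD.G_le hx ht h0

/-- A nonpositive label has potential at least G > F, so it cannot be minimal. The label 0 belongs
to both half lines and is excluded as well, which makes the sign strict. -/
lemma pos_of_F_lt (hD : D.Admissible) (hx : 0 ≤ x) (ht : 0 ≤ t)
    (h : D.F x t < D.G x t) (hs : s ∈ D.argmin univ x t) : 0 < s := by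
  by_contra! h0
  have h1 := hD.G_le hx ht h0
  have h2 := hs.2 _ (mem_univ (D.lo (Ici 0) x t))
  rw [← hD.F_eq (hD.lo_mem .Ici hx ht)] at h2
  linarith

lemma neg_of_G_lt (hD : D.Admissible) (hx : 0 ≤ x) (ht : 0 ≤ t)
    (h : D.G x t < D.F x t) (hs : s ∈ D.argmin univ x t) : s < 0 := by
  by_contra! h0
  have h1 := hD.F_le hx ht h0
  have h2 := hs.2 _ (mem_univ (D.lo (Iic 0) x t))
  rw [← hD.G_eq (hD.lo_mem .Iic hx ht)] at h2
  linarith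

lemma argmin_of_univ (hs : s ∈ D.argmin univ x t) (hI : s ∈ I) : s ∈ D.argmin I x t :=
  ⟨hI, fun σ _ => hs.2 σ (mem_univ _)⟩

lemma argmin_univ_of_F_lt (hD : D.Admissible) (hx : 0 ≤ x) (ht : 0 ≤ t)
    (h : D.F x t < D.G x t) : D.argmin univ x t = D.argmin (Ici 0) x t :=
  Subset.antisymm (fun _ hs => argmin_of_univ hs (hD.pos_of_F_lt hx ht h hs).le)
    fun _ hs => hD.mem_argmin_univ_of_F_le hx ht h.le hs

lemma argmin_univ_of_G_lt (hD : D.Admissible) (hx : 0 ≤ x) (ht : 0 ≤ t)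
    (h : D.G x t < D.F x t) : D.argmin univ x t = D.argmin (Iic 0) x t :=
  Subset.antisymm (fun _ hs => argmin_of_univ hs (hD.neg_of_G_lt hx ht h hs).le)
    fun _ hs => hD.mem_argmin_univ_of_G_le hx ht h.le hs

/-- If F = G, the minimizers on both half lines are minimizers on the whole line, so the extreme
ones come from opposite half lines. -/
lemma lo_univ_of_eq (hD : D.Admissible) (hx : 0 ≤ x) (ht : 0 ≤ t)
    (h : D.F x t = D.G x t) : D.lo univ x t = D.lo (Iic 0) x t := by
  have h1 := hD.lo_le .univ hx ht
    (hD.mem_argmin_univ_of_G_le hx ht h.ge (hD.lo_mem .Iic hx ht))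
  exact le_antisymm h1 (hD.lo_le .Iic hx ht (argmin_of_univ (hD.lo_mem .univ hx ht)
    (h1.trans (hD.lo_mem .Iic hx ht).1)))

lemma hi_univ_of_eq (hD : D.Admissible) (hx : 0 ≤ x) (ht : 0 ≤ t)
    (h : D.F x t = D.G x t) : D.hi univ x t = D.hi (Ici 0) x t := by
  have h1 := hD.le_hi .univ hx ht
    (hD.mem_argmin_univ_of_F_le hx ht h.le (hD.hi_mem .Ici hx ht))
  exact le_antisymm (hD.le_hi .Ici hx ht (argmin_of_univ (hD.hi_mem .univ hx ht)
    (le_trans (hD.hi_mem .Ici hx ht).1 h1))) h1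

lemma integral_dens_of_nonneg (hD : D.Admissible) {a b : ℝ} (ha : 0 ≤ a) (hab : a ≤ b) :
    ∫ η in a..b, D.ρ₀ η = D.mass b - D.mass a := by
  rw [hD.mass_sub]
  refine intervalIntegral.integral_congr_ae (ae_of_all _ fun s hs => ?_)
  rw [uIoc_of_le hab] at hs
  rw [dens_of_pos (ha.trans_lt hs.1)]

lemma integral_mom_of_nonneg (hD : D.Admissible) {a b : ℝ} (ha : 0 ≤ a) (hab : a ≤ b) :
    ∫ η in a..b, D.ρ₀ η * D.u₀ η = D.mom b - D.mom a := by
  rw [hD.mom_sub]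
  refine intervalIntegral.integral_congr_ae (ae_of_all _ fun s hs => ?_)
  rw [uIoc_of_le hab] at hs
  rw [dens_of_pos (ha.trans_lt hs.1), vel_of_pos (ha.trans_lt hs.1), mul_comm]

lemma integral_dens_neg (hD : D.Admissible) {a b : ℝ} (hb : b ≤ 0) (hab : a ≤ b) :
    ∫ η in (-b)..(-a), D.ρb η * D.ub η = D.mass b - D.mass a := by
  rw [hD.mass_sub, ← intervalIntegral.integral_comp_neg]
  refine intervalIntegral.integral_congr_ae ?_
  -- When b = 0 the interval contains the label 0, where the formula for the boundary density fails;
  -- it is a null set.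
  filter_upwards [measure_singleton (μ := volume) (0 : ℝ) |> compl_mem_ae_iff.2] with s h0 hs
  rw [uIoc_of_le hab] at hs
  have : s < 0 := lt_of_le_of_ne (hs.2.trans hb) h0
  rw [dens_of_neg this]

lemma integral_mom_neg (hD : D.Admissible) {a b : ℝ} (hb : b ≤ 0) (hab : a ≤ b) :
    ∫ η in (-b)..(-a), D.ρb η * D.ub η ^ 2 = D.mom b - D.mom a := by
  rw [hD.mom_sub, ← intervalIntegral.integral_comp_neg]
  refine intervalIntegral.integral_congr_ae ?_
  filter_upwards [measure_singleton (μ := volume) (0 : ℝ) |> compl_mem_ae_iff.2] with s h0 hs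
  rw [uIoc_of_le hab] at hs
  have : s < 0 := lt_of_le_of_ne (hs.2.trans hb) h0
  rw [dens_of_neg this, vel_of_neg this]
  ring

end Admissible

open Classical in
/-- The velocity in terms of the extreme minimizers on the line of labels. -/
noncomputable def speed (a b x t : ℝ) (D : Data) : ℝ :=
  if a = b then if 0 ≤ a then (x - a) / t else x / (t + a)
  else (D.mom b - D.mom a) / (D.mass b - D.mass a)

namespace Admissible

/-- For F < G and F > G all minimizers lie on one half line and the formulas agree termwise. For F =
G, `lo` ≤ 0 ≤ `hi`, and the boundary and initial integrals add up to the increments of mass and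
momentum from `lo` to `hi`; if these coincide, both are 0 and the velocity is x / t. -/
lemma u_eq (hD : D.Admissible) (hx : 0 < x) (ht : 0 < t) :
    D.u x t = speed (D.lo univ x t) (D.hi univ x t) x t D := by
  have hlohi := hD.lo_le_hi .univ hx.le ht.le
  have hx0 := hx.ne'
  unfold u speed
  rw [hD.yLow_eq, hD.yUp_eq, hD.τLow_eq, hD.τUp_eq]
  rcases lt_trichotomy (D.F x t) (D.G x t) with h | h | h
  · have h1 : D.lo (Ici 0) x t = D.lo univ x t := by
      rw [lo, lo, hD.argmin_univ_of_F_lt hx.le ht.le h]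
    have h2 : D.hi (Ici 0) x t = D.hi univ x t := by
      rw [hi, hi, hD.argmin_univ_of_F_lt hx.le ht.le h]
    have h3 := (hD.pos_of_F_lt hx.le ht.le h (hD.lo_mem .univ hx.le ht.le)).le
    simp only [hx0, h, h1, h2, h3, false_and, if_false, if_true]
    rw [hD.integral_dens_of_nonneg h3 hlohi, hD.integral_mom_of_nonneg h3 hlohi]
  · have h1 := hD.lo_univ_of_eq hx.le ht.le h
    have h2 := hD.hi_univ_of_eq hx.le ht.le h
    have h3 : D.lo univ x t ≤ 0 := h1 ▸ (hD.lo_mem .Iic hx.le ht.le).1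
    have h4 : 0 ≤ D.hi univ x t := h2 ▸ (hD.hi_mem .Ici hx.le ht.le).1
    simp only [hx0, h, lt_irrefl, false_and, if_false, ← h1, ← h2]
    by_cases he : D.lo univ x t = D.hi univ x t
    · have h5 : D.hi univ x t = 0 := le_antisymm (he ▸ h3) h4
      simp [he, h5]
    · have : D.hi univ x t ≠ 0 ∨ -D.lo univ x t ≠ 0 := by
        by_contra! h'
        exact he (by linarith [h'.1, h'.2])
      rw [if_pos this, if_neg he, ← mass_of_nonneg h4, ← mom_of_nonneg h4]
      have e1 := mass_neg (D := D) (neg_nonneg.2 h3)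
      have e2 := mom_neg (D := D) (neg_nonneg.2 h3)
      rw [neg_neg] at e1 e2
      rw [e1, e2]
      congr 1 <;> ring
  · have h1 : D.lo (Iic 0) x t = D.lo univ x t := by
      rw [lo, lo, hD.argmin_univ_of_G_lt hx.le ht.le h]
    have h2 : D.hi (Iic 0) x t = D.hi univ x t := by
      rw [hi, hi, hD.argmin_univ_of_G_lt hx.le ht.le h]
    have h3 := hD.neg_of_G_lt hx.le ht.le h (hD.hi_mem .univ hx.le ht.le)
    have h4 : ¬ 0 ≤ D.lo univ x t := by linarith
    simp only [hx0, h, h.not_gt, h1, h2, h4, false_and, if_false, if_true, neg_inj]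
    rw [hD.integral_dens_neg h3.le hlohi, hD.integral_mom_neg h3.le hlohi]
    by_cases he : D.lo univ x t = D.hi univ x t
    · rw [if_pos he.symm, if_pos he, sub_neg_eq_add, he]
    · rw [if_neg (Ne.symm he), if_neg he]

end Admissible

open Classical in
/-- The minimizer which determines `m(x, t)`. -/
noncomputable def label (D : Data) (x t : ℝ) : ℝ :=
  if D.F x t ≤ D.G x t then D.lo (Ici 0) x t else D.hi (Iic 0) x t

namespace Admissible

lemma label_mem (hD : D.Admissible) (hx : 0 ≤ x) (ht : 0 ≤ t) :
    D.label x t ∈ D.argmin univ x t := by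
  unfold label
  split_ifs with h
  · exact hD.mem_argmin_univ_of_F_le hx ht h (hD.lo_mem .Ici hx ht)
  · exact hD.mem_argmin_univ_of_G_le hx ht (not_le.1 h).le (hD.hi_mem .Iic hx ht)

/-- At x = 0 the kernel is (t + s) vel(s) dens(s) > 0 for -t < s < 0, so the potential increases
from -t on, and no minimizer lies below -t. -/
lemma argmin_Iic_zero (hD : D.Admissible) (ht : 0 ≤ t) (hs : s ∈ D.argmin (Iic 0) 0 t) :
    s = -t := by
  obtain ⟨C, hC0, hC⟩ := hD.exists_speed_bound
  have h1 := (hD.argmin_subset_Icc hC .Iic le_rfl ht hs).1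
  refine h1.eq_or_lt.elim Eq.symm fun h => ?_
  have h0 : s ≤ 0 := hs.1
  have := hD.pot_lt_pot_of_kern_pos (x := 0) (t := t) h fun σ hσ => ?_
  · linarith [hs.2 (-t) (by simpa using ht)]
  · rw [kern_of_nonpos (by linarith [hσ.2])]
    have := hD.vel_pos_of_neg (show σ < 0 by linarith [hσ.2])
    have h2 := hD.dens_pos σ
    have h3 : 0 < t + σ := by linarith [hσ.1]
    simp only [sub_zero]
    positivity

lemma m_eq (hD : D.Admissible) (hx : 0 < x) (ht : 0 ≤ t) : D.m x t = D.mass (D.label x t) := by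
  unfold m label
  by_cases h : D.F x t ≤ D.G x t
  · rw [if_pos ⟨hx, h⟩, if_pos h, hD.yLow_eq, mass_of_nonneg (hD.lo_mem .Ici hx.le ht).1]
  · have h1 : D.hi (Iic 0) x t ≤ 0 := (hD.hi_mem .Iic hx.le ht).1
    rw [if_neg (by tauto), if_neg h, hD.τLow_eq, ← mass_neg (by linarith), neg_neg]

lemma m_zero (hD : D.Admissible) (ht : 0 ≤ t) : D.m 0 t = D.mass (-t) := by
  unfold m
  rw [if_neg (by simp), hD.τLow_eq, hD.argmin_Iic_zero ht (hD.hi_mem .Iic le_rfl ht), neg_neg,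
    mass_neg ht]

/-- By semicontinuity the sublevel sets are closed in the quarter plane; the truncation at 0
projects the plane continuously onto it. -/
lemma measurable_lo_max (hD : D.Admissible) (hI : LabelRange I) :
    Measurable fun p : ℝ × ℝ => D.lo I (max p.1 0) (max p.2 0) := by
  refine measurable_of_Iic fun c => ?_
  have h := ((hD.isClosed_lo_le hI c).preimage
    (by fun_prop : Continuous fun p : ℝ × ℝ => (max p.1 0, max p.2 0))).measurableSet
  refine cast (congrArg _ ?_) h
  ext p
  simp [quarter]

lemma measurable_hi_max (hD : D.Admissible) (hI : LabelRange I) :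
    Measurable fun p : ℝ × ℝ => D.hi I (max p.1 0) (max p.2 0) := by
  refine measurable_of_Ici fun c => ?_
  have h := ((hD.isClosed_le_hi hI c).preimage
    (by fun_prop : Continuous fun p : ℝ × ℝ => (max p.1 0, max p.2 0))).measurableSet
  refine cast (congrArg _ ?_) h
  ext p
  simp [quarter]

end Admissible

/-- A version of the velocity which is measurable on the whole plane. -/
noncomputable def speedMax (D : Data) (p : ℝ × ℝ) : ℝ :=
  speed (D.lo univ (max p.1 0) (max p.2 0)) (D.hi univ (max p.1 0) (max p.2 0)) p.1 p.2 D

/-- A version of `m` which is measurable on the whole plane. -/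
noncomputable def massMax (D : Data) (p : ℝ × ℝ) : ℝ :=
  D.mass (D.label (max p.1 0) (max p.2 0))

namespace Admissible

lemma measurable_speedMax (hD : D.Admissible) : Measurable D.speedMax := by
  unfold speedMax speed
  have h1 := hD.measurable_lo_max .univ
  have h2 := hD.measurable_hi_max .univ
  have h3 := hD.continuous_mass.measurable
  have h4 := hD.continuous_mom.measurable
  refine Measurable.ite (measurableSet_eq_fun h1 h2)
    (Measurable.ite (measurableSet_le measurable_const h1) ?_ ?_) ?_
  · exact (measurable_fst.sub h1).div measurable_snd
  · exact measurable_fst.div (measurable_snd.add h1)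
  · exact ((h4.comp h2).sub (h4.comp h1)).div ((h3.comp h2).sub (h3.comp h1))

lemma measurable_massMax (hD : D.Admissible) : Measurable D.massMax := by
  refine hD.continuous_mass.measurable.comp ?_
  have h1 := hD.measurable_lo_max .Ici
  have h2 := hD.measurable_hi_max .Iic
  have h3 := hD.continuous_pot.measurable
  unfold label
  refine Measurable.ite ?_ h1 h2
  have e : ∀ p : ℝ × ℝ, D.F (max p.1 0) (max p.2 0) =
      D.pot (D.lo (Ici 0) (max p.1 0) (max p.2 0)) (max p.1 0) (max p.2 0) := fun p =>
    hD.F_eq (hD.lo_mem .Ici (le_max_right _ _) (le_max_right _ _))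
  have e' : ∀ p : ℝ × ℝ, D.G (max p.1 0) (max p.2 0) =
      D.pot (D.hi (Iic 0) (max p.1 0) (max p.2 0)) (max p.1 0) (max p.2 0) := fun p =>
    hD.G_eq (hD.hi_mem .Iic (le_max_right _ _) (le_max_right _ _))
  simp only [e, e']
  have h4 : Measurable fun p : ℝ × ℝ => (max p.1 0, max p.2 0) := by fun_prop
  exact measurableSet_le (h3.comp (h1.prodMk h4)) (h3.comp (h2.prodMk h4))

lemma u_eq_speedMax (hD : D.Admissible) (hx : 0 < x) (ht : 0 < t) :
    D.u x t = D.speedMax (x, t) := by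
  simp only [speedMax, hD.u_eq hx ht, max_eq_left hx.le, max_eq_left ht.le]

lemma m_eq_massMax (hD : D.Admissible) (hx : 0 < x) (ht : 0 ≤ t) :
    D.m x t = D.massMax (x, t) := by
  simp only [massMax, hD.m_eq hx ht, max_eq_left hx.le, max_eq_left ht]

/-- The velocity is bounded. -/
lemma abs_u_le (hD : D.Admissible) (hC : ∀ s, |D.vel s| < C) (hx : 0 < x) (ht : 0 < t) :
    |D.u x t| ≤ C := by
  have hC0 : 0 < C := (abs_nonneg _).trans_lt (hC 0)
  have hlo := hD.lo_mem .univ hx.le ht.le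
  have hlohi := hD.lo_le_hi .univ hx.le ht.le
  rw [hD.u_eq hx ht]
  unfold speed
  split_ifs with h1 h2
  · rw [abs_div, abs_of_pos ht, div_le_iff₀ ht, abs_le]
    have h3 := (hD.argmin_subset_Icc hC .univ hx.le ht.le hlo).2
    refine ⟨by linarith, ?_⟩
    rcases le_total (C * t) x with h4 | h4
    · linarith [hD.le_of_mem_argmin hC hx.le ht.le .univ (subset_univ _) h4 hlo]
    · linarith
  · have h3 := hD.le_of_mem_argmin_of_neg hC hx.le .univ hlo (not_le.1 h2)
    have h4 : 0 < t + D.lo univ x t := by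
      by_contra! h
      nlinarith
    rwa [abs_of_pos (div_pos hx h4), div_le_iff₀ h4]
  · have h3 := hD.strictMono_mass (lt_of_le_of_ne hlohi h1)
    rw [abs_div, abs_of_pos (sub_pos.2 h3), div_le_iff₀ (sub_pos.2 h3)]
    exact hD.abs_mom_sub_le hC hlohi

end Admissible

end Data
end PressurelessGas

/-! ### Trajectories -/

namespace PressurelessGas

namespace Data

/-- The position at time `t` of the particle with the label `s`. -/
noncomputable def pos (D : Data) (s t : ℝ) : ℝ := sInf {x | 0 ≤ x ∧ s ≤ D.hi univ x t}

variable {D : Data} {C : ℝ} {I : Set ℝ} {x t x' t' s s' c : ℝ}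

lemma pos_nonneg : 0 ≤ D.pos s t := Real.sInf_nonneg fun _ h => h.1

namespace Admissible

/-- The label intervals belonging to different points at the same time overlap at most in an
endpoint. -/
lemma hi_lt_lo (hD : D.Admissible) (hx : 0 ≤ x) (ht : 0 ≤ t) (hxx : x < x') :
    D.hi univ x t ≤ D.lo univ x' t :=
  hD.argmin_mono (hD.hi_mem .univ hx ht) (hD.lo_mem .univ (hx.trans hxx.le) ht) hxx

lemma hi_mono (hD : D.Admissible) (hx : 0 ≤ x) (ht : 0 ≤ t) (hxx : x ≤ x') :
    D.hi univ x t ≤ D.hi univ x' t := by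
  rcases hxx.eq_or_lt with rfl | h
  · rfl
  · exact (hD.hi_lt_lo hx ht h).trans (hD.lo_le_hi .univ (hx.trans hxx) ht)

lemma le_hi_far (hD : D.Admissible) (hC : ∀ s, |D.vel s| < C) (ht : 0 ≤ t) :
    s ≤ D.hi univ (max s 0 + C * t) t := by
  have hC0 : 0 < C := (abs_nonneg _).trans_lt (hC 0)
  have h0 : 0 ≤ max s 0 + C * t := by positivity
  have h1 := hD.le_of_mem_argmin hC h0 ht .univ (subset_univ _) (by simp)
    (hD.hi_mem .univ h0 ht)
  have := le_max_left s 0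
  linarith

lemma le_hi_pos (hD : D.Admissible) (ht : 0 ≤ t) : s ≤ D.hi univ (D.pos s t) t := by
  obtain ⟨C, hC0, hC⟩ := hD.exists_speed_bound
  have hcl : IsClosed {x | 0 ≤ x ∧ s ≤ D.hi univ x t} := by
    have h := (hD.isClosed_le_hi .univ s).preimage (by fun_prop : Continuous fun x : ℝ => (x, t))
    refine cast (congrArg _ ?_) h
    ext x
    simp [quarter, ht]
  exact (hcl.csInf_mem ⟨_, by positivity, hD.le_hi_far hC ht⟩ ⟨0, fun x hx => hx.1⟩).2

/-- The Galois connection between `pos` and `hi`, valid because the infimum defining `pos` is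
attained. Monotonicity, the Lipschitz bounds and measurability of `pos` are read off from it. -/
lemma pos_le_iff (hD : D.Admissible) (hx : 0 ≤ x) (ht : 0 ≤ t) :
    D.pos s t ≤ x ↔ s ≤ D.hi univ x t :=
  ⟨fun h => (hD.le_hi_pos ht).trans (hD.hi_mono pos_nonneg ht h),
    fun h => csInf_le ⟨0, fun _ hx => hx.1⟩ ⟨hx, h⟩⟩

lemma lt_pos_iff (hD : D.Admissible) (hx : 0 ≤ x) (ht : 0 ≤ t) :
    x < D.pos s t ↔ D.hi univ x t < s := by
  rw [← not_le, hD.pos_le_iff hx ht, not_le]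

/-- Together with `le_hi_pos` this puts s into [lo, hi] at its own position. If s < `lo` held there,
lower semicontinuity would give s < `lo` ≤ `hi` slightly to the left, so s would already have been
reached; points to the left exist because the position is positive. -/
lemma lo_pos_le (hD : D.Admissible) (ht : 0 ≤ t) (hpos : 0 < D.pos s t) :
    D.lo univ (D.pos s t) t ≤ s := by
  by_contra! h
  have h1 := hD.eventually_lt_lo .univ h
  have h2 : Tendsto (fun x : ℝ => (x, t)) (𝓝[<] (D.pos s t)) (𝓝[quarter] (D.pos s t, t)) := by
    refine tendsto_nhdsWithin_iff.2 ⟨?_, ?_⟩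
    · exact (Continuous.tendsto (by fun_prop : Continuous fun x : ℝ => (x, t)) _).mono_left
        nhdsWithin_le_nhds
    · filter_upwards [Ioo_mem_nhdsLT hpos] with x hx using ⟨hx.1.le, ht⟩
  obtain ⟨x, hx1, hx2⟩ := ((h2.eventually h1).and (Ioo_mem_nhdsLT hpos)).exists
  have h3 := (hD.lt_pos_iff hx2.1.le ht).1 hx2.2
  linarith [hD.lo_le_hi .univ hx2.1.le ht, show s < D.lo univ x t from hx1]

lemma pos_eq (hD : D.Admissible) (hx : 0 ≤ x) (ht : 0 ≤ t) (h1 : D.lo univ x t < s)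
    (h2 : s ≤ D.hi univ x t) : D.pos s t = x := by
  refine le_antisymm ((hD.pos_le_iff hx ht).2 h2) ?_
  by_contra! h
  have := hD.hi_lt_lo pos_nonneg ht h
  linarith [hD.le_hi_pos (s := s) ht]

lemma pos_mono (hD : D.Admissible) (ht : 0 ≤ t) (h : s ≤ s') : D.pos s t ≤ D.pos s' t :=
  (hD.pos_le_iff pos_nonneg ht).2 (h.trans (hD.le_hi_pos ht))

lemma le_pos_add (hD : D.Admissible) (hC : ∀ s, |D.vel s| < C) (ht : 0 ≤ t) :
    s ≤ D.pos s t + C * t :=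
  (hD.le_hi_pos ht).trans
    (hD.argmin_subset_Icc hC .univ pos_nonneg ht (hD.hi_mem .univ pos_nonneg ht)).2

lemma pos_of_le_neg (hD : D.Admissible) (ht : 0 ≤ t) (hs : s ≤ -t) : D.pos s t = 0 := by
  obtain ⟨C, hC0, hC⟩ := hD.exists_speed_bound
  refine le_antisymm ((hD.pos_le_iff le_rfl ht).2 (hs.trans ?_)) pos_nonneg
  exact (hD.argmin_subset_Icc hC .univ le_rfl ht (hD.hi_mem .univ le_rfl ht)).1

/-- On the ray of speed C from the old position the largest minimizer does not decrease, so s has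
been reached on it. The lower bound uses the ray of speed -C. -/
lemma pos_le_pos_add (hD : D.Admissible) (hC : ∀ s, |D.vel s| < C) (ht : 0 ≤ t) (h : t ≤ t') :
    D.pos s t' ≤ D.pos s t + C * (t' - t) := by
  have hC0 : 0 < C := (abs_nonneg _).trans_lt (hC 0)
  have h0 : 0 ≤ D.pos s t + C * (t' - t) :=
    add_nonneg pos_nonneg (mul_nonneg hC0.le (sub_nonneg.2 h))
  rcases h.eq_or_lt with rfl | h
  · simp
  refine (hD.pos_le_iff h0 (ht.trans h.le)).2 ((hD.le_hi_pos ht).trans ?_)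
  exact hD.argmin_mono_fast hC (hD.hi_mem .univ pos_nonneg ht)
    (hD.hi_mem .univ h0 (ht.trans h.le)) h le_rfl

lemma pos_sub_le_pos (hD : D.Admissible) (hC : ∀ s, |D.vel s| < C) (ht : 0 ≤ t) (h : t ≤ t') :
    D.pos s t - C * (t' - t) ≤ D.pos s t' := by
  have hC0 : 0 < C := (abs_nonneg _).trans_lt (hC 0)
  rcases h.eq_or_lt with rfl | h
  · simp
  by_contra! hlt
  have h0 : 0 ≤ D.pos s t' + C * (t' - t) :=
    add_nonneg pos_nonneg (mul_nonneg hC0.le (sub_nonneg.2 h.le))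
  have h1 := (hD.lt_pos_iff h0 ht).1 (by linarith : _ < D.pos s t)
  have h2 := hD.argmin_anti_fast hC (hD.hi_mem .univ h0 ht)
    (hD.hi_mem .univ (pos_nonneg (s := s)) (ht.trans h.le)) h
    (add_sub_cancel_right _ _).ge
  linarith [hD.le_hi_pos (s := s) (ht.trans h.le)]

lemma abs_pos_sub_pos_le (hD : D.Admissible) (hC : ∀ s, |D.vel s| < C) (ht : 0 ≤ t)
    (ht' : 0 ≤ t') : |D.pos s t - D.pos s t'| ≤ C * |t - t'| := by
  rcases le_total t t' with h | h
  · have h1 := hD.pos_le_pos_add hC (s := s) ht h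
    have h2 := hD.pos_sub_le_pos hC (s := s) ht h
    rw [abs_of_nonpos (sub_nonpos.2 h), abs_le]
    constructor <;> linarith
  · have h1 := hD.pos_le_pos_add hC (s := s) ht' h
    have h2 := hD.pos_sub_le_pos hC (s := s) ht' h
    rw [abs_of_nonneg (sub_nonneg.2 h), abs_le]
    constructor <;> linarith

/-- The trajectories, continued by a constant to negative times, are Lipschitz continuous. -/
lemma lipschitzWith_pos (hD : D.Admissible) (hC : ∀ s, |D.vel s| < C) (s : ℝ) :
    LipschitzWith C.toNNReal fun t => D.pos s (max t 0) := by
  have hC0 : 0 < C := (abs_nonneg _).trans_lt (hC 0)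
  refine LipschitzWith.of_dist_le_mul fun t t' => ?_
  rw [Real.dist_eq, Real.dist_eq, Real.coe_toNNReal _ hC0.le]
  refine (hD.abs_pos_sub_pos_le hC (le_max_right _ _) (le_max_right _ _)).trans ?_
  exact mul_le_mul_of_nonneg_left (abs_max_sub_max_le_abs _ _ _) hC0.le

lemma measurable_pos_max (hD : D.Admissible) :
    Measurable fun q : ℝ × ℝ => D.pos q.1 (max q.2 0) := by
  refine measurable_of_Iic fun c => ?_
  by_cases hc : 0 ≤ c
  · have h : Measurable fun q : ℝ × ℝ => D.hi univ (max c 0) (max q.2 0) :=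
      (hD.measurable_hi_max .univ).comp (by fun_prop : Measurable fun q : ℝ × ℝ => (c, q.2))
    refine cast (congrArg _ ?_) (measurableSet_le measurable_fst h)
    ext q
    simp only [mem_ofPred_eq, mem_preimage, mem_Iic, hD.pos_le_iff hc (le_max_right q.2 0),
      max_eq_left hc]
  · have : (fun q : ℝ × ℝ => D.pos q.1 (max q.2 0)) ⁻¹' Iic c = ∅ := by
      ext q
      simp only [mem_preimage, mem_Iic, mem_empty_iff_false, iff_false, not_le]
      exact (not_le.1 hc).trans_le pos_nonneg
    rw [this]; exact MeasurableSet.empty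

lemma monotone_pos (hD : D.Admissible) (ht : 0 ≤ t) : Monotone fun s => D.pos s t :=
  fun _ _ h => hD.pos_mono ht h

end Admissible

end Data
end PressurelessGas

/-! ### The velocity of the trajectories -/

namespace PressurelessGas

namespace Data

/-- The labels which are the only minimizer at some rational point. Outside of this countable set
no label spreads out into a fan. -/
def fanLabels (D : Data) : Set ℝ := range fun q : ℚ × ℚ => D.hi univ q.1 q.2

lemma countable_fanLabels (D : Data) : D.fanLabels.Countable := countable_range _

variable {D : Data} {C : ℝ} {I : Set ℝ} {x t x' t' s s' c : ℝ}

namespace Admissible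

/-- At the point of departure (s, 0) the label s is the strict global minimizer. For boundary labels
the next lemma gives this only among nonpositive competitors. -/
lemma pot_lt_start_of_nonneg (hD : D.Admissible) (h0 : 0 ≤ s) (h : s ≠ s') :
    D.pot s s 0 < D.pot s' s 0 := by
  rcases h.lt_or_gt with h | h
  · refine hD.pot_lt_pot_of_kern_pos h fun σ hσ => ?_
    rw [kern_of_nonneg (h0.trans hσ.1.le)]
    exact mul_pos (by linarith [hσ.1]) (hD.dens_pos σ)
  · refine hD.pot_lt_pot_of_kern_neg h fun σ hσ => ?_
    rcases le_or_gt 0 σ with h1 | h1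
    · rw [kern_of_nonneg h1]
      exact mul_neg_of_neg_of_pos (by linarith [hσ.2]) (hD.dens_pos σ)
    · rw [kern_of_nonpos h1.le]
      have := hD.vel_pos_of_neg h1
      exact mul_neg_of_neg_of_pos (by nlinarith) (hD.dens_pos σ)

lemma pot_lt_start_of_neg (hD : D.Admissible) (h0 : s < 0) (h1 : s' ≤ 0) (h : s ≠ s') :
    D.pot s 0 (-s) < D.pot s' 0 (-s) := by
  rcases h.lt_or_gt with h | h
  · refine hD.pot_lt_pot_of_kern_pos h fun σ hσ => ?_
    have h2 : σ < 0 := hσ.2.trans_le h1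
    rw [kern_of_nonpos h2.le]
    have := hD.vel_pos_of_neg h2
    refine mul_pos ?_ (hD.dens_pos σ)
    have h3 : 0 < -s + σ := by linarith [hσ.1]
    simp only [sub_zero]; positivity
  · refine hD.pot_lt_pot_of_kern_neg h fun σ hσ => ?_
    have h2 : σ < 0 := hσ.2.trans h0
    rw [kern_of_nonpos h2.le]
    have := hD.vel_pos_of_neg h2
    exact mul_neg_of_neg_of_pos (by nlinarith [hσ.2]) (hD.dens_pos σ)

/-- Differences of the potential are affine in (x, t), so minimality at both ends of a segment
passes to the segment. -/
lemma pot_sub_convex (D : Data) (l a b x₀ t₀ x₁ t₁ : ℝ) :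
    D.pot a (l * x₁ + (1 - l) * x₀) (l * t₁ + (1 - l) * t₀) -
      D.pot b (l * x₁ + (1 - l) * x₀) (l * t₁ + (1 - l) * t₀) =
    l * (D.pot a x₁ t₁ - D.pot b x₁ t₁) + (1 - l) * (D.pot a x₀ t₀ - D.pot b x₀ t₀) := by
  unfold pot; ring

/-- On the backward line to its point of departure, a single minimizer remains a minimizer. -/
lemma mem_argmin_backward (hD : D.Admissible) (hx : 0 < x) (ht : 0 < t)
    (hlo : D.lo univ x t = s) (hhi : D.hi univ x t = s) :
    ∀ᶠ θ in 𝓝[<] t, 0 ≤ θ ∧ 0 ≤ x + speed s s x t D * (θ - t) ∧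
      s ∈ D.argmin univ (x + speed s s x t D * (θ - t)) θ := by
  have hs : s ∈ D.argmin univ x t := hlo ▸ hD.lo_mem .univ hx.le ht.le
  unfold speed
  rw [if_pos rfl]
  rcases le_or_gt 0 s with h0 | h0
  · rw [if_pos h0]
    filter_upwards [Ioo_mem_nhdsLT ht] with θ hθ
    have hl : 0 < θ / t := div_pos hθ.1 ht
    have hl1 : θ / t < 1 := (div_lt_one ht).2 hθ.2
    -- The backward line is the segment from (s, 0) to (x, t), with parameter θ / t.
    have e1 : x + (x - s) / t * (θ - t) = θ / t * x + (1 - θ / t) * s := by field_simp; ring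
    have e2 : θ = θ / t * t + (1 - θ / t) * 0 := by field_simp; ring
    have hX : 0 ≤ θ / t * x + (1 - θ / t) * s :=
      add_nonneg (by positivity) (mul_nonneg (by linarith) h0)
    refine ⟨hθ.1.le, e1 ▸ hX, mem_univ _, fun σ _ => ?_⟩
    have h := pot_sub_convex D (θ / t) σ s s 0 x t
    rw [← e1, ← e2] at h
    have h1 := mul_nonneg hl.le (sub_nonneg.2 (hs.2 σ (mem_univ _)))
    have h2 : 0 ≤ (1 - θ / t) * (D.pot σ s 0 - D.pot s s 0) := by
      refine mul_nonneg (by linarith) (sub_nonneg.2 ?_)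
      rcases eq_or_ne s σ with rfl | hne
      · rfl
      · exact (hD.pot_lt_start_of_nonneg h0 hne).le
    linarith
  · rw [if_neg h0.not_ge]
    obtain ⟨C, hC0, hC⟩ := hD.exists_speed_bound
    have hts : 0 < t + s := by
      have := hD.le_of_mem_argmin_of_neg hC hx.le .univ hs h0
      by_contra! h
      nlinarith
    have hlim : Tendsto (fun θ => (x + x / (t + s) * (θ - t), θ)) (𝓝[<] t) (𝓝 (x, t)) := by
      have : Continuous fun θ => (x + x / (t + s) * (θ - t), θ) := by fun_prop
      have := (this.tendsto t).mono_left (nhdsWithin_le_nhds (s := Iio t))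
      simpa using this
    have hX0 : ∀ θ, -s < θ → 0 ≤ x + x / (t + s) * (θ - t) := fun θ hθ => by
      have : x + x / (t + s) * (θ - t) = x * (θ + s) / (t + s) := by field_simp; ring
      rw [this]
      have : 0 < θ + s := by linarith
      positivity
    have hlim' : Tendsto (fun θ => (x + x / (t + s) * (θ - t), θ)) (𝓝[<] t)
        (𝓝[quarter] (x, t)) := by
      refine tendsto_nhdsWithin_iff.2 ⟨hlim, ?_⟩
      filter_upwards [Ioo_mem_nhdsLT (show -s < t by linarith)] with θ hθ
      exact ⟨hX0 θ hθ.1, by linarith [hθ.1]⟩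
    -- At the entry point (0, -s) the label s is known to win only against nonpositive labels. Upper
    -- semicontinuity keeps the minimizers negative near (x, t), which is why the claim is local in
    -- θ.
    have hneg := hlim'.eventually (hD.eventually_hi_lt .univ (hhi.trans_lt h0))
    filter_upwards [hneg, Ioo_mem_nhdsLT (show -s < t by linarith)] with θ hθ' hθ
    have hθ0 : 0 ≤ θ := by linarith [hθ.1]
    have hX := hX0 θ hθ.1
    have hl : 0 < (θ + s) / (t + s) := div_pos (by linarith [hθ.1]) hts
    have hl1 : (θ + s) / (t + s) < 1 := (div_lt_one hts).2 (by linarith [hθ.2])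
    set l := (θ + s) / (t + s) with hldef
    have hl' : l * (t + s) = θ + s := by rw [hldef]; field_simp
    have e1 : x + x / (t + s) * (θ - t) = l * x + (1 - l) * 0 := by
      rw [hldef]; field_simp; ring
    have e2 : θ = l * t + (1 - l) * (-s) := by linarith
    refine ⟨hθ0, hX, ?_⟩
    have hmem := hD.hi_mem .univ hX hθ0
    suffices hσs : D.hi univ (x + x / (t + s) * (θ - t)) θ = s by rwa [hσs] at hmem
    by_contra! hne
    set σ := D.hi univ (x + x / (t + s) * (θ - t)) θ
    have hσ0 : σ < 0 := hθ'
    have h := pot_sub_convex D l σ s 0 (-s) x t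
    rw [← e1, ← e2] at h
    have h1 := mul_nonneg hl.le (sub_nonneg.2 (hs.2 σ (mem_univ _)))
    have h2 := mul_pos (sub_pos.2 hl1)
      (sub_pos.2 (hD.pot_lt_start_of_neg h0 hσ0.le hne.symm))
    linarith [hmem.2 s (mem_univ _)]

/-- If s were minimal at x and already reached at a smaller position, then at a rational q in
between the largest minimizer would be exactly s, which makes s a fan label. Here the time must be
rational too. -/
lemma pos_eq_of_mem_argmin (hD : D.Admissible) (hs : s ∉ D.fanLabels) {θ : ℚ}
    (hθ : (0 : ℝ) ≤ θ) (hx : 0 ≤ x) (h : s ∈ D.argmin univ x θ) : D.pos s θ = x := by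
  refine le_antisymm ((hD.pos_le_iff hx hθ).2 (hD.le_hi .univ hx hθ h)) ?_
  by_contra! hlt
  obtain ⟨q, hq1, hq2⟩ := exists_rat_btwn hlt
  have hq0 : (0 : ℝ) ≤ q := pos_nonneg.trans hq1.le
  have h1 := (hD.pos_le_iff hq0 hθ).1 hq1.le
  have h2 := hD.argmin_mono (hD.hi_mem .univ hq0 hθ) h hq2
  exact hs ⟨(q, θ), le_antisymm h2 h1⟩

/-- At rational times shortly before t the trajectory lies on the straight line of free flight. The
difference quotients at these times are constant and determine the derivative. -/
lemma deriv_pos_of_single (hD : D.Admissible) (hs : s ∉ D.fanLabels) (ht : 0 < t)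
    (hpos : 0 < D.pos s t) {w : ℝ} (hw : HasDerivAt (fun θ => D.pos s θ) w t)
    (he : D.lo univ (D.pos s t) t = D.hi univ (D.pos s t) t) :
    w = speed (D.lo univ (D.pos s t) t) (D.hi univ (D.pos s t) t) (D.pos s t) t D := by
  have h1 := hD.lo_pos_le ht.le hpos
  have h2 := hD.le_hi_pos (s := s) ht.le
  have hlo : D.lo univ (D.pos s t) t = s := by linarith
  have hhi : D.hi univ (D.pos s t) t = s := by linarith
  have hb := hD.mem_argmin_backward hpos ht hlo hhi
  rw [hlo, hhi]
  have hsl : Tendsto (slope (fun θ => D.pos s θ) t) (𝓝[<] t) (𝓝 w) :=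
    (hasDerivAt_iff_tendsto_slope.1 hw).mono_left (nhdsWithin_mono _ fun y hy => ne_of_lt hy)
  refine tendsto_nhds_unique_of_frequently_eq hsl tendsto_const_nhds ?_
  have hrat : ∃ᶠ θ in 𝓝[<] t, θ ∈ range ((↑) : ℚ → ℝ) := by
    rw [frequently_iff]
    intro U hU
    obtain ⟨l, hl, hU⟩ := (mem_nhdsLT_iff_exists_Ioo_subset).1 hU
    obtain ⟨q, hq1, hq2⟩ := exists_rat_btwn (show l < t from hl)
    exact ⟨q, hU ⟨hq1, hq2⟩, q, rfl⟩
  refine (hrat.and_eventually (hb.and self_mem_nhdsWithin)).mono ?_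
  rintro _ ⟨⟨θ, rfl⟩, ⟨hθ0, hX, hmem⟩, hlt⟩
  have h3 := hD.pos_eq_of_mem_argmin hs hθ0 hX hmem
  have h4 : (θ : ℝ) - t ≠ 0 := sub_ne_zero.2 (ne_of_lt hlt)
  rw [slope_def_field, h3]
  field_simp
  ring

/-- At a jump, the minimal value of `mom - w * mass` among the minimizers is attained at any
minimizer which is a limit of minimizers along the trajectory. -/
lemma mom_sub_le_of_frequently (hD : D.Admissible) {w κ μ : ℝ}
    (hw : HasDerivAt (fun θ => D.pos s θ) w t) (hκ : κ ∈ D.argmin univ (D.pos s t) t)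
    (h : ∀ δ > 0, ∃ᶠ θ in 𝓝[>] t, ∃ σ ∈ D.argmin univ (D.pos s θ) θ, |σ - μ| < δ) :
    D.mom μ - w * D.mass μ ≤ D.mom κ - w * D.mass κ := by
  refine le_of_forall_pos_le_add fun ε hε => ?_
  have hg : Continuous fun q : ℝ × ℝ =>
      (D.mom q.1 - q.2 * D.mass q.1) - (D.mom κ - q.2 * D.mass κ) := by
    have := hD.continuous_mass
    have := hD.continuous_mom
    fun_prop
  have h1 := (hg.tendsto (μ, w)).eventually (lt_mem_nhds (sub_lt_self _ hε))
  rw [nhds_prod_eq, eventually_prod_iff] at h1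
  obtain ⟨P, hP, R, hR, hPR⟩ := h1
  obtain ⟨δ, hδ, hP⟩ := Metric.eventually_nhds_iff.1 hP
  have hsl : Tendsto (slope (fun θ => D.pos s θ) t) (𝓝[>] t) (𝓝 w) :=
    (hasDerivAt_iff_tendsto_slope.1 hw).mono_left (nhdsWithin_mono _ fun y hy => ne_of_gt hy)
  obtain ⟨θ, ⟨σ, hσ, hσδ⟩, hRθ, hθ⟩ :=
    ((h δ hδ).and_eventually ((hsl.eventually hR).and self_mem_nhdsWithin)).exists
  have h2 := hPR (hP (by rwa [Real.dist_eq])) hRθ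
  -- Divided by θ - t, the comparison bounds the increment of mom by the difference quotient of the
  -- trajectory times the increment of mass.
  have h3 := argmin_compare hκ hσ
  have h4 : 0 < θ - t := sub_pos.2 hθ
  rw [slope_def_field] at h2
  have h5 : D.mom σ - D.mom κ ≤
      (D.pos s θ - D.pos s t) / (θ - t) * (D.mass σ - D.mass κ) := by
    rw [div_mul_eq_mul_div, le_div_iff₀ h4]
    linarith
  simp only at h2
  linarith

/-- Both `lo` and `hi` are approached by minimizers along the later trajectory, so both minimize mom
- w mass among the minimizers at t. Equality of the two values is the formula for w. The hypothesis
`hT` supplies the approach: a rational label near the endpoint sits on the same trajectory at times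
arbitrarily close after t, and semicontinuity controls the other side. -/
lemma deriv_pos_of_jump (hD : D.Admissible) (ht : 0 < t)
    (hpos : 0 < D.pos s t) {w : ℝ} (hw : HasDerivAt (fun θ => D.pos s θ) w t)
    (hT : ∀ r : ℚ, D.pos r t = D.pos s t → ∃ᶠ θ in 𝓝[>] t, D.pos r θ = D.pos s θ)
    (hlt : D.lo univ (D.pos s t) t < D.hi univ (D.pos s t) t) :
    w = speed (D.lo univ (D.pos s t) t) (D.hi univ (D.pos s t) t) (D.pos s t) t D := by
  obtain ⟨C, hC0, hC⟩ := hD.exists_speed_bound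
  have h1 := hD.lo_pos_le ht.le hpos
  have h2 := hD.le_hi_pos (s := s) ht.le
  have hlomem := hD.lo_mem .univ hpos.le ht.le
  have himem := hD.hi_mem .univ hpos.le ht.le
  have hlim : Tendsto (fun θ => (D.pos s θ, θ)) (𝓝[>] t) (𝓝[quarter] (D.pos s t, t)) := by
    refine tendsto_nhdsWithin_iff.2 ⟨?_, ?_⟩
    · exact (hw.continuousAt.tendsto.prodMk_nhds tendsto_id).mono_left nhdsWithin_le_nhds
    · filter_upwards [self_mem_nhdsWithin] with θ hθ using ⟨pos_nonneg, ht.le.trans (le_of_lt hθ)⟩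
  have hposθ : ∀ᶠ θ in 𝓝[>] t, 0 < D.pos s θ ∧ 0 ≤ θ := by
    filter_upwards [(hw.continuousAt.eventually (lt_mem_nhds hpos)).filter_mono
      nhdsWithin_le_nhds, self_mem_nhdsWithin] with θ h hθ using ⟨h, ht.le.trans (le_of_lt hθ)⟩
  have hlo : ∀ κ ∈ D.argmin univ (D.pos s t) t,
      D.mom (D.lo univ (D.pos s t) t) - w * D.mass (D.lo univ (D.pos s t) t) ≤
        D.mom κ - w * D.mass κ := by
    refine fun κ hκ => hD.mom_sub_le_of_frequently hw hκ fun δ hδ => ?_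
    have hev := hlim.eventually (hD.eventually_lt_lo .univ (sub_lt_self _ hδ))
    rcases h1.eq_or_lt with h | h
    · refine (hev.and hposθ).frequently.mono fun θ hθ => ⟨_, hD.lo_mem .univ hθ.2.1.le hθ.2.2, ?_⟩
      have h3 := hD.lo_pos_le hθ.2.2 hθ.2.1
      rw [abs_lt]; constructor <;> linarith [hθ.1]
    · obtain ⟨r, hr1, hr2⟩ := exists_rat_btwn (lt_min h (lt_add_of_pos_right _ hδ))
      have hr3 := hr2.trans_le (min_le_left _ _)
      have hr4 := hr2.trans_le (min_le_right _ _)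
      have hf := hT r (hD.pos_eq hpos.le ht.le hr1 (hr3.le.trans h2))
      refine (hf.and_eventually (hev.and hposθ)).mono fun θ hθ =>
        ⟨_, hD.lo_mem .univ hθ.2.2.1.le hθ.2.2.2, ?_⟩
      have h3 := hD.lo_pos_le (s := r) hθ.2.2.2 (by rw [hθ.1]; exact hθ.2.2.1)
      rw [hθ.1] at h3
      rw [abs_lt]; constructor <;> linarith [hθ.2.1]
  have hhi : ∀ κ ∈ D.argmin univ (D.pos s t) t,
      D.mom (D.hi univ (D.pos s t) t) - w * D.mass (D.hi univ (D.pos s t) t) ≤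
        D.mom κ - w * D.mass κ := by
    refine fun κ hκ => hD.mom_sub_le_of_frequently hw hκ fun δ hδ => ?_
    have hev := hlim.eventually (hD.eventually_hi_lt .univ (lt_add_of_pos_right _ hδ))
    rcases h2.eq_or_lt with h | h
    · refine (hev.and hposθ).frequently.mono fun θ hθ => ⟨_, hD.hi_mem .univ hθ.2.1.le hθ.2.2, ?_⟩
      have h3 := hD.le_hi_pos (s := s) hθ.2.2
      rw [abs_lt]; constructor <;> linarith [hθ.1]
    · obtain ⟨r, hr1, hr2⟩ := exists_rat_btwn (max_lt h (sub_lt_self (D.hi univ (D.pos s t) t) hδ))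
      have hr3 := (le_max_left _ _).trans_lt hr1
      have hr4 := (le_max_right _ _).trans_lt hr1
      have hf := hT r (hD.pos_eq hpos.le ht.le (h1.trans_lt hr3) hr2.le)
      refine (hf.and_eventually (hev.and hposθ)).mono fun θ hθ =>
        ⟨_, hD.hi_mem .univ hθ.2.2.1.le hθ.2.2.2, ?_⟩
      have h3 := hD.le_hi_pos (s := r) hθ.2.2.2
      rw [hθ.1] at h3
      rw [abs_lt]; constructor <;> linarith [hθ.2.1]
  have h3 := hlo _ himem
  have h4 := hhi _ hlomem
  have h5 := hD.strictMono_mass hlt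
  unfold speed
  rw [if_neg hlt.ne, eq_div_iff (by linarith)]
  linarith

/-- Particles move with the velocity `u`. -/
lemma ae_hasDerivAt_pos (hD : D.Admissible) (hs : s ∉ D.fanLabels) :
    ∀ᵐ t ∂(volume : Measure ℝ), 0 < t → 0 < D.pos s t →
      HasDerivAt (fun θ => D.pos s θ) (D.u (D.pos s t) t) t := by
  obtain ⟨C, hC0, hC⟩ := hD.exists_speed_bound
  have h1 := (hD.lipschitzWith_pos hC s).ae_differentiableAt_real
  -- For fixed r, the times of coincidence that are isolated from the right within the coincidence
  -- set are countable; a countable union over r is still null.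
  have h2 : ∀ᵐ t ∂(volume : Measure ℝ), ∀ r : ℚ, D.pos r t = D.pos s t →
      ∃ᶠ θ in 𝓝[>] t, D.pos r θ = D.pos s θ := by
    rw [ae_all_iff]
    intro r
    have := (countable_setOfPred_isolated_right_within
      (s := {t | D.pos r t = D.pos s t})).ae_notMem (μ := volume)
    filter_upwards [this] with t ht he
    simp only [not_and] at ht
    have h3 := ht he
    rw [← ne_eq, ← neBot_iff, inter_comm, nhdsWithin_inter'] at h3
    rw [frequently_iff_neBot]
    exact h3
  filter_upwards [h1, h2] with t h1 h2 ht hpos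
  have hd : DifferentiableAt ℝ (fun θ => D.pos s θ) t := by
    refine h1.congr_of_eventuallyEq ?_
    filter_upwards [lt_mem_nhds ht] with θ hθ
    rw [max_eq_left hθ.le]
  have hw := hd.hasDerivAt
  suffices he : deriv (fun θ => D.pos s θ) t = D.u (D.pos s t) t by rwa [he] at hw
  rw [hD.u_eq hpos ht]
  rcases (hD.lo_le_hi .univ hpos.le ht.le).eq_or_lt with h | h
  · exact (hD.deriv_pos_of_single hs ht hpos hw h)
  · exact (hD.deriv_pos_of_jump ht hpos hw h2 h)

end Admissible

end Data
end PressurelessGas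

/-! ### u as a mean of the starting velocities -/

namespace PressurelessGas

lemma locallyIntegrable_of_intervalIntegrable {f : ℝ → ℝ}
    (hf : ∀ a b : ℝ, IntervalIntegrable f volume a b) : LocallyIntegrable f volume := by
  refine locallyIntegrable_iff.2 fun K hK => ?_
  obtain ⟨R, hR⟩ := hK.isBounded.subset_closedBall 0
  rw [Real.closedBall_eq_Icc] at hR
  rcases le_total (0 - R) (0 + R) with h | h
  · exact ((intervalIntegrable_iff_integrableOn_Icc_of_le h).1 (hf _ _)).mono_set hR
  · refine ((intervalIntegrable_iff_integrableOn_Icc_of_le h).1 (hf _ _)).mono_set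
      fun x hx => ⟨?_, ?_⟩ <;> linarith [(hR hx).1, (hR hx).2]

namespace Data

variable {D : Data} {C : ℝ} {I : Set ℝ} {x t x' t' s s' c : ℝ}

/-- The points of concentration at the time `t`. -/
def jumps (D : Data) (t : ℝ) : Set ℝ := {x | 0 < x ∧ D.lo univ x t < D.hi univ x t}

namespace Admissible

lemma pairwiseDisjoint_jumps (hD : D.Admissible) (ht : 0 ≤ t) :
    (D.jumps t).PairwiseDisjoint fun x => Ioo (D.lo univ x t) (D.hi univ x t) := by
  have key : ∀ x ∈ D.jumps t, ∀ y, x < y →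
      Disjoint (Ioo (D.lo univ x t) (D.hi univ x t)) (Ioo (D.lo univ y t) (D.hi univ y t)) := by
    intro x hx y hxy
    refine Set.disjoint_left.2 fun s hs hs' => ?_
    linarith [hD.hi_lt_lo hx.1.le ht hxy, hs.2, hs'.1]
  intro x hx y hy hne
  rcases hne.lt_or_gt with h | h
  · exact key x hx y h
  · exact (key y hy x h).symm

lemma countable_jumps (hD : D.Admissible) (ht : 0 ≤ t) : (D.jumps t).Countable :=
  (hD.pairwiseDisjoint_jumps ht).countable_of_isOpen (fun _ _ => isOpen_Ioo)
    fun _ hx => nonempty_Ioo.2 hx.2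

lemma ae_hasDerivAt_pot (hD : D.Admissible) :
    ∀ᵐ s ∂(volume : Measure ℝ), HasDerivAt D.mass (D.dens s) s ∧
      HasDerivAt D.mom (D.vel s * D.dens s) s ∧ HasDerivAt D.ener (D.arm s) s := by
  filter_upwards [_root_.LocallyIntegrable.ae_hasDerivAt_integral
      (locallyIntegrable_of_intervalIntegrable hD.dens_intervalIntegrable),
    _root_.LocallyIntegrable.ae_hasDerivAt_integral
      (locallyIntegrable_of_intervalIntegrable hD.vel_mul_dens_intervalIntegrable),
    _root_.LocallyIntegrable.ae_hasDerivAt_integral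
      (locallyIntegrable_of_intervalIntegrable hD.arm_intervalIntegrable)] with s h1 h2 h3
  exact ⟨h1 0, h2 0, h3 0⟩

/-- The first order condition for minimizers. -/
lemma ae_kern_eq_zero (hD : D.Admissible) :
    ∀ᵐ s ∂(volume : Measure ℝ), ∀ x t, s ∈ D.argmin univ x t → D.kern x t s = 0 := by
  filter_upwards [hD.ae_hasDerivAt_pot] with s ⟨h1, h2, h3⟩ x t hs
  have h : HasDerivAt (fun σ => D.pot σ x t) (D.kern x t s) s :=
    ((h2.const_mul t).sub (h1.const_mul x)).add h3
  have hmin : IsLocalMin (fun σ => D.pot σ x t) s :=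
    Eventually.of_forall fun σ => hs.2 σ (mem_univ _)
  exact hmin.hasDerivAt_eq_zero h

/-- A vanishing kernel says that the free flight of s passes through x at time t, so the flight
velocity is the starting velocity. -/
lemma speed_single (hD : D.Admissible) (hx : 0 < x) (ht : 0 < t)
    (hk : D.kern x t s = 0) : speed s s x t D = D.vel s := by
  have hd := hD.dens_pos s
  unfold speed
  rw [if_pos rfl]
  split_ifs with h
  · rw [kern_of_nonneg h] at hk
    have := (mul_eq_zero.1 hk).resolve_right hd.ne'
    rw [div_eq_iff ht.ne']; linarith
  · rw [kern_of_nonpos (not_le.1 h).le] at hk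
    have := (mul_eq_zero.1 hk).resolve_right hd.ne'
    have hne : t + s ≠ 0 := fun h0 => by rw [h0] at this; linarith
    rw [div_eq_iff hne]; linarith

/-- On the line of labels, `u` is the mean of the initial velocities of the particles which have
met: `u(·, t) ρ(dx, t)` is the image of the momentum measure. -/
lemma integral_pos_mul_u (hD : D.Admissible) (ht : 0 < t) {g : ℝ → ℝ} (hg : g 0 = 0)
    (hint : Integrable fun s => g (D.pos s t) * (D.u (D.pos s t) t - D.vel s) * D.dens s) :
    ∫ s, g (D.pos s t) * (D.u (D.pos s t) t - D.vel s) * D.dens s = 0 := by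
  -- S collects the labels inside concentrations. On each of the countably many disjoint intervals
  -- the position and u are constant, and u times the mass is the momentum, so the integral
  -- vanishes.
  set S := ⋃ x : D.jumps t, Ioo (D.lo univ x t) (D.hi univ x t) with hS
  have hSm : MeasurableSet S := by
    have := (hD.countable_jumps ht.le).to_subtype
    exact MeasurableSet.iUnion fun _ => measurableSet_Ioo
  rw [← integral_add_compl hSm hint]
  have h1 : ∫ s in S, g (D.pos s t) * (D.u (D.pos s t) t - D.vel s) * D.dens s = 0 := by
    have := (hD.countable_jumps ht.le).to_subtype
    rw [hS, integral_iUnion (fun _ => measurableSet_Ioo) ?_ hint.integrableOn]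
    · refine (tsum_congr fun x => ?_).trans tsum_zero
      obtain ⟨x, hx0, hx⟩ := x
      have e : ∀ s ∈ Ioo (D.lo univ x t) (D.hi univ x t),
          g (D.pos s t) * (D.u (D.pos s t) t - D.vel s) * D.dens s =
          g x * (D.u x t * D.dens s - D.vel s * D.dens s) := fun s hs => by
        rw [hD.pos_eq hx0.le ht.le hs.1 hs.2.le]; ring
      simp only
      rw [setIntegral_congr_fun measurableSet_Ioo e, ← integral_Ioc_eq_integral_Ioo,
        ← intervalIntegral.integral_of_le hx.le, intervalIntegral.integral_const_mul,
        intervalIntegral.integral_sub ((hD.dens_intervalIntegrable _ _).const_mul _)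
          (hD.vel_mul_dens_intervalIntegrable _ _), intervalIntegral.integral_const_mul,
        ← hD.mass_sub, ← hD.mom_sub, hD.u_eq hx0 ht]
      unfold speed
      have := hD.strictMono_mass hx
      rw [if_neg hx.ne, div_mul_cancel₀ _ (by linarith), sub_self, mul_zero]
    · exact (hD.pairwiseDisjoint_jumps ht.le).subtype _ _
  -- Off S and off the countably many endpoints, a label at a positive position is the only
  -- minimizer there, and the first order condition gives u = vel almost everywhere. At position 0
  -- the factor g vanishes.
  have h2 : ∫ s in Sᶜ, g (D.pos s t) * (D.u (D.pos s t) t - D.vel s) * D.dens s = 0 := by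
    refine setIntegral_eq_zero_of_ae_eq_zero ?_
    have hc := hD.countable_jumps ht.le
    filter_upwards [hD.ae_kern_eq_zero, (hc.image fun x => D.lo univ x t).ae_notMem (μ := volume),
      (hc.image fun x => D.hi univ x t).ae_notMem (μ := volume)] with s h1 h2 h3 hs
    rcases (pos_nonneg (D := D) (s := s) (t := t)).eq_or_lt with h0 | h0
    · rw [← h0, hg]; ring
    have h4 := hD.lo_pos_le ht.le h0
    have h5 := hD.le_hi_pos (s := s) ht.le
    have h6 : D.lo univ (D.pos s t) t = D.hi univ (D.pos s t) t := by
      by_contra hne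
      have hj : D.pos s t ∈ D.jumps t := ⟨h0, lt_of_le_of_ne (h4.trans h5) hne⟩
      refine hs (mem_iUnion.2 ⟨⟨_, hj⟩, lt_of_le_of_ne h4 fun h => h2 ⟨_, hj, h⟩,
        lt_of_le_of_ne h5 fun h => h3 ⟨_, hj, h.symm⟩⟩)
    have h7 : D.lo univ (D.pos s t) t = s := by linarith
    have h8 : D.hi univ (D.pos s t) t = s := by linarith
    have h9 := hD.lo_mem .univ h0.le ht.le
    rw [h7] at h9
    rw [hD.u_eq h0 ht, h7, h8, hD.speed_single h0 ht (h1 _ _ h9)]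
    ring
  rw [h1, h2, add_zero]

end Admissible

/-! ### The measure ρ(·, t) as an image of the mass on the labels -/

noncomputable section

/-- The mass measure on the line of labels. -/
def massMeasure (D : Data) : Measure ℝ := volume.withDensity fun s => ENNReal.ofReal (D.dens s)

/-- The distribution of mass at the time `t`. -/
def massAt (D : Data) (t : ℝ) : Measure ℝ :=
  -- Labels below -t have not entered, yet `pos` places them at 0; without the restriction they
  -- would create a false atom there.
  (D.massMeasure.restrict (Ioi (-t))).map fun s => D.pos s t

end

namespace Admissible

lemma massMeasure_Ioc (hD : D.Admissible) {a b : ℝ} (hab : a ≤ b) :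
    D.massMeasure (Ioc a b) = ENNReal.ofReal (D.mass b - D.mass a) := by
  rw [massMeasure, withDensity_apply _ measurableSet_Ioc, hD.mass_sub,
    intervalIntegral.integral_of_le hab, ofReal_integral_eq_lintegral_ofReal]
  · exact (hD.dens_intervalIntegrable a b).1
  · exact ae_of_all _ fun s => (hD.dens_pos s).le

lemma measurable_pos (hD : D.Admissible) (ht : 0 ≤ t) : Measurable fun s => D.pos s t :=
  (hD.monotone_pos ht).measurable

/-- By `pos_le_iff`, the labels that have entered and lie at or before x form the interval (-t, hi].
-/
lemma massAt_Iic (hD : D.Admissible) (ht : 0 ≤ t) (hx : 0 ≤ x) :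
    D.massAt t (Iic x) = ENNReal.ofReal (D.mass (D.hi univ x t) - D.mass (-t)) := by
  obtain ⟨C, hC0, hC⟩ := hD.exists_speed_bound
  have h1 := (hD.argmin_subset_Icc hC .univ hx ht (hD.hi_mem .univ hx ht)).1
  rw [massAt, Measure.map_apply (hD.measurable_pos ht) measurableSet_Iic,
    Measure.restrict_apply (hD.measurable_pos ht measurableSet_Iic), ← hD.massMeasure_Ioc h1]
  congr 1
  ext s
  simp only [mem_inter_iff, mem_preimage, mem_Iic, mem_Ioi, mem_Ioc, hD.pos_le_iff hx ht]
  tauto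

lemma massAt_Iio_zero (hD : D.Admissible) (ht : 0 ≤ t) : D.massAt t (Iio 0) = 0 := by
  rw [massAt, Measure.map_apply (hD.measurable_pos ht) measurableSet_Iio]
  convert measure_empty
  · ext s
    simpa using pos_nonneg
  · infer_instance

lemma massAt_Icc_lt_top (hD : D.Admissible) (ht : 0 ≤ t) (R : ℝ) :
    D.massAt t (Icc 0 R) < ⊤ := by
  rcases lt_or_ge R 0 with h | h
  · simp [Icc_eq_empty h.not_ge]
  · refine (measure_mono Icc_subset_Iic_self).trans_lt ?_
    rw [hD.massAt_Iic ht h]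
    exact ENNReal.ofReal_lt_top

lemma massAt_singleton_zero (hD : D.Admissible) (ht : 0 ≤ t) :
    D.massAt t {0} = ENNReal.ofReal (D.mass (D.hi univ 0 t) - D.mass (-t)) := by
  rw [← hD.massAt_Iic ht le_rfl, ← Iio_union_right,
    measure_union (by simp) (measurableSet_singleton 0), hD.massAt_Iio_zero ht, zero_add]

lemma noAtom_massAt (hD : D.Admissible) (ht : 0 ≤ t) (h : D.G 0 t < D.F 0 t) :
    D.massAt t {0} = 0 := by
  have h1 := hD.hi_mem .univ le_rfl ht
  rw [hD.argmin_univ_of_G_lt le_rfl ht h] at h1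
  rw [hD.massAt_singleton_zero ht, hD.argmin_Iic_zero ht h1]
  simp

/-- As x decreases to 0, the label of x tends to `hi` at x = 0: it is at least that by monotonicity,
and not more in the limit by upper semicontinuity. Moreover m(0, t) is the value of `mass` at -t. -/
lemma atom_massAt (hD : D.Admissible) (ht : 0 ≤ t) :
    Tendsto (fun x => D.m x t - D.m 0 t) (𝓝[>] 0) (𝓝 ((D.massAt t).real {0})) := by
  obtain ⟨C, hC0, hC⟩ := hD.exists_speed_bound
  have h1 := (hD.argmin_subset_Icc hC .univ le_rfl ht (hD.hi_mem .univ le_rfl ht)).1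
  rw [Measure.real, hD.massAt_singleton_zero ht, ENNReal.toReal_ofReal
    (sub_nonneg.2 (hD.strictMono_mass.monotone h1))]
  rw [hD.m_zero ht]
  refine Tendsto.sub_const ?_ _
  have h2 : Tendsto (fun x => D.label x t) (𝓝[>] 0) (𝓝 (D.hi univ 0 t)) := by
    refine tendsto_order.2 ⟨fun c hc => ?_, fun c hc => ?_⟩
    · filter_upwards [self_mem_nhdsWithin] with x hx
      exact hc.trans_le (hD.argmin_mono (hD.hi_mem .univ le_rfl ht)
        (hD.label_mem (le_of_lt hx) ht) hx)
    · have hlim : Tendsto (fun x : ℝ => (x, t)) (𝓝[>] 0) (𝓝[quarter] (0, t)) := by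
        refine tendsto_nhdsWithin_iff.2 ⟨?_, ?_⟩
        · exact ((by fun_prop : Continuous fun x : ℝ => (x, t)).tendsto _).mono_left
            nhdsWithin_le_nhds
        · filter_upwards [self_mem_nhdsWithin] with x hx using ⟨le_of_lt hx, ht⟩
      filter_upwards [hlim.eventually (hD.eventually_hi_lt .univ hc), self_mem_nhdsWithin]
        with x h hx
      exact (hD.le_hi .univ (le_of_lt hx) ht (hD.label_mem (le_of_lt hx) ht)).trans_lt h
  refine ((hD.continuous_mass.tendsto _).comp h2).congr' ?_
  filter_upwards [self_mem_nhdsWithin] with x hx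
  exact (hD.m_eq hx ht).symm

lemma integrable_massMeasure_iff (hD : D.Admissible) {f : ℝ → ℝ} {S : Set ℝ}
    (hS : MeasurableSet S) :
    Integrable f (D.massMeasure.restrict S) ↔ IntegrableOn (fun s => f s * D.dens s) S := by
  rw [massMeasure, restrict_withDensity hS, integrable_withDensity_iff_integrable_smul'
    hD.measurable_dens.ennreal_ofReal (by simp)]
  refine integrable_congr (ae_of_all _ fun s => ?_)
  simp only [smul_eq_mul, ENNReal.toReal_ofReal (hD.dens_pos s).le, mul_comm]

lemma integral_massMeasure (hD : D.Admissible) (f : ℝ → ℝ) {S : Set ℝ} (hS : MeasurableSet S) :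
    ∫ s in S, f s ∂D.massMeasure = ∫ s in S, f s * D.dens s := by
  rw [massMeasure, setIntegral_withDensity_eq_setIntegral_toReal_smul
    hD.measurable_dens.ennreal_ofReal (by simp) f hS]
  refine integral_congr_ae (ae_of_all _ fun s => ?_)
  simp only [smul_eq_mul, ENNReal.toReal_ofReal (hD.dens_pos s).le, mul_comm]

lemma integrable_massAt (hD : D.Admissible) (ht : 0 ≤ t) {f : ℝ → ℝ} (hf : Measurable f)
    (hint : Integrable fun s => f (D.pos s t) * D.dens s) : Integrable f (D.massAt t) := by
  rw [massAt, integrable_map_measure hf.aestronglyMeasurable (hD.measurable_pos ht).aemeasurable,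
    hD.integrable_massMeasure_iff measurableSet_Ioi]
  exact hint.integrableOn

/-- Since f vanishes at 0, where `pos` puts the labels that have not entered, the integral may run
over all labels. -/
lemma integral_massAt (hD : D.Admissible) (ht : 0 ≤ t) {f : ℝ → ℝ} (hf : Measurable f)
    (h0 : f 0 = 0) : ∫ x, f x ∂D.massAt t = ∫ s, f (D.pos s t) * D.dens s := by
  rw [massAt, integral_map (hD.measurable_pos ht).aemeasurable hf.aestronglyMeasurable,
    hD.integral_massMeasure _ measurableSet_Ioi]
  refine setIntegral_eq_integral_of_forall_compl_eq_zero fun s hs => ?_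
  rw [hD.pos_of_le_neg ht (not_lt.1 hs), h0, zero_mul]

end Admissible

end Data
end PressurelessGas

/-! ### ρ(·, t) is the derivative of m(·, t) -/

namespace PressurelessGas

namespace Data

variable {D : Data} {C : ℝ} {I : Set ℝ} {x t x' t' s s' c T R S : ℝ}

namespace Admissible

lemma pos_lt_of_lt_lo (hD : D.Admissible) (hx : 0 < x) (ht : 0 ≤ t) (h : s < D.lo univ x t) :
    D.pos s t < x := by
  refine lt_of_le_of_ne ((hD.pos_le_iff hx.le ht).2
    (h.le.trans (hD.lo_le_hi .univ hx.le ht))) fun he => ?_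
  have := hD.lo_pos_le ht (he ▸ hx)
  rw [he] at this
  linarith

lemma le_lo_of_pos_lt (hD : D.Admissible) (ht : 0 ≤ t) (h : D.pos s t < x) :
    s ≤ D.lo univ x t :=
  (hD.le_hi_pos ht).trans (hD.hi_lt_lo pos_nonneg ht h)

/-- Integration against `m` in terms of the labels. -/
lemma integral_mul_m_sub (hD : D.Admissible) (hC : ∀ s, |D.vel s| < C) (ht : 0 ≤ t) (hT : t ≤ T)
    {h : ℝ → ℝ} (hh : Integrable h) (hR : ∀ x, R < x → h x = 0) (hS : R + C * t ≤ S) :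
    ∫ x in Ioi (0 : ℝ), h x * (D.m x t - D.mass (-T)) =
      ∫ s in Ioc (-T) S, (∫ x in Ioi (D.pos s t), h x) * D.dens s := by
  -- For almost every x ≤ R, m(x, t) minus the mass at -T is the mass of the labels above -T with
  -- position less than x. The identity is Fubini for this set.
  have hmeas : MeasurableSet {q : ℝ × ℝ | D.pos q.1 t < q.2} :=
    measurableSet_lt ((hD.measurable_pos ht).comp measurable_fst) measurable_snd
  have hint : Integrable (fun q : ℝ × ℝ => {q : ℝ × ℝ | D.pos q.1 t < q.2}.indicator
      (fun q => D.dens q.1 * h q.2) q)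
      ((volume.restrict (Ioc (-T) S)).prod (volume.restrict (Ioi 0))) :=
    (Integrable.mul_prod (hD.dens_intervalIntegrable (-T) S).1 hh.integrableOn).indicator hmeas
  have hswap := integral_integral_swap (f := fun s x => {q : ℝ × ℝ | D.pos q.1 t < q.2}.indicator
      (fun q => D.dens q.1 * h q.2) (s, x)) hint
  have h1 : ∀ s : ℝ, ∫ x in Ioi (0 : ℝ), {q : ℝ × ℝ | D.pos q.1 t < q.2}.indicator
      (fun q => D.dens q.1 * h q.2) (s, x) = (∫ x in Ioi (D.pos s t), h x) * D.dens s := by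
    intro s
    have e : (fun x => {q : ℝ × ℝ | D.pos q.1 t < q.2}.indicator
      (fun q => D.dens q.1 * h q.2) (s, x)) =
      (Ioi (D.pos s t)).indicator fun x => D.dens s * h x := by
      ext x; simp [indicator]
    rw [e, setIntegral_indicator measurableSet_Ioi, Ioi_inter_Ioi,
      sup_eq_right.2 pos_nonneg, integral_const_mul, mul_comm]
  simp only [h1] at hswap
  rw [hswap]
  refine integral_congr_ae ?_
  -- Away from the countably many jumps there is a single minimizer, and the labels with position
  -- less than x fill (-T, lo] up to a null set.
  filter_upwards [ae_restrict_mem measurableSet_Ioi,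
    ae_restrict_of_ae ((hD.countable_jumps ht).ae_notMem (μ := volume))] with x hx hj
  have hx0 : 0 < x := hx
  rcases lt_or_ge R x with hRx | hRx
  · simp [indicator, hR x hRx]
  have hmem := hD.lo_mem .univ hx0.le ht
  have hlo : D.lo univ x t = D.hi univ x t :=
    (hD.lo_le_hi .univ hx0.le ht).eq_or_lt.resolve_right fun h' => hj ⟨hx0, h'⟩
  have hlab : D.label x t = D.lo univ x t := by
    have h2 := hD.label_mem hx0.le ht
    exact le_antisymm (hlo ▸ hD.le_hi .univ hx0.le ht h2) (hD.lo_le .univ hx0.le ht h2)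
  have hb := hD.argmin_subset_Icc hC .univ hx0.le ht hmem
  have h2 : -T ≤ D.lo univ x t := by linarith [hb.1]
  have h3 : D.lo univ x t ≤ S := by linarith [hb.2]
  have e : (fun s => {q : ℝ × ℝ | D.pos q.1 t < q.2}.indicator
      (fun q => D.dens q.1 * h q.2) (s, x)) =ᵐ[volume.restrict (Ioc (-T) S)]
      (Iic (D.lo univ x t)).indicator fun s => D.dens s * h x := by
    filter_upwards [ae_restrict_of_ae ((countable_singleton (D.lo univ x t)).ae_notMem
      (μ := volume))] with s hs
    have hiff : D.pos s t < x ↔ s ≤ D.lo univ x t :=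
      ⟨hD.le_lo_of_pos_lt ht, fun hle => hD.pos_lt_of_lt_lo hx0 ht (lt_of_le_of_ne hle hs)⟩
    simp [indicator, hiff]
  rw [integral_congr_ae e, setIntegral_indicator measurableSet_Iic, Ioc_inter_Iic,
    min_eq_right h3, integral_mul_const, ← intervalIntegral.integral_of_le h2, ← hD.mass_sub,
    hD.m_eq hx0 ht, hlab, mul_comm]

lemma monotoneOn_m (hD : D.Admissible) (ht : 0 ≤ t) :
    MonotoneOn (fun x => D.m x t) (Ioi 0) := by
  intro x hx y hy hxy
  rcases hxy.eq_or_lt with rfl | h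
  · rfl
  simp only
  rw [hD.m_eq hx ht, hD.m_eq hy ht]
  exact hD.strictMono_mass.monotone (hD.argmin_mono (hD.label_mem (le_of_lt hx) ht)
    (hD.label_mem (le_of_lt hy) ht) h)

lemma abs_m_le (hD : D.Admissible) (hC : ∀ s, |D.vel s| < C) (hx : 0 < x) (hxR : x ≤ R)
    (ht : 0 ≤ t) (htR : t ≤ R) :
    |D.m x t| ≤ max |D.mass (-R)| |D.mass (R + C * R)| := by
  have hC0 : 0 < C := (abs_nonneg _).trans_lt (hC 0)
  have h := hD.argmin_subset_Icc hC .univ hx.le ht (hD.label_mem hx.le ht)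
  rw [hD.m_eq hx ht]
  refine abs_le_max_abs_abs (hD.strictMono_mass.monotone (by linarith [h.1]))
    (hD.strictMono_mass.monotone (h.2.trans ?_))
  have := mul_le_mul_of_nonneg_left htR hC0.le
  linarith

lemma integrableOn_mul_m (hD : D.Admissible) (ht : 0 ≤ t) {h : ℝ → ℝ} (hh : Integrable h)
    (hR : ∀ x, R < x → h x = 0) : IntegrableOn (fun x => h x * D.m x t) (Ioi 0) := by
  obtain ⟨C, hC0, hC⟩ := hD.exists_speed_bound
  have hmm : AEStronglyMeasurable (fun x => D.m x t) (volume.restrict (Ioi (0 : ℝ))) :=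
    (aemeasurable_restrict_of_monotoneOn measurableSet_Ioi
      (hD.monotoneOn_m ht)).aestronglyMeasurable
  refine Integrable.mono' (hh.norm.const_mul
    (max |D.mass (-(max R t))| |D.mass (max R t + C * max R t)|)).integrableOn
    (hh.aestronglyMeasurable.restrict.mul hmm) ?_
  filter_upwards [ae_restrict_mem measurableSet_Ioi] with x hx
  rcases lt_or_ge R x with h | h
  · simp [hR x h]
  · rw [norm_mul, mul_comm]
    exact mul_le_mul_of_nonneg_right (hD.abs_m_le hC hx (h.trans (le_max_left _ _)) ht
      (le_max_right _ _)) (norm_nonneg _)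

/-- The image of the mass measure is the derivative of `m`. -/
lemma isDensity_massAt (hD : D.Admissible) (ht : 0 ≤ t) : D.IsDensity t (D.massAt t) where
  neg := hD.massAt_Iio_zero ht
  locallyFinite := hD.massAt_Icc_lt_top ht
  atom _ := hD.atom_massAt ht
  noAtom := hD.noAtom_massAt ht
  distribDeriv φ hφ hc hsupp := by
    obtain ⟨C, hC0, hC⟩ := hD.exists_speed_bound
    have hz : ∀ x, x ≤ 0 → φ x = 0 := fun x hx => by
      by_contra h
      exact absurd (hsupp (subset_tsupport _ h)) (not_lt.2 hx)
    have hd : Continuous (deriv φ) := hφ.continuous_deriv (by simp)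
    have hdc : HasCompactSupport (deriv φ) := hc.deriv
    have hint : Integrable (deriv φ) := hd.integrable_of_hasCompactSupport hdc
    obtain ⟨R, hR⟩ := hc.isCompact.isBounded.subset_closedBall 0
    have hRφ : ∀ x, R < x → φ x = 0 := fun x hx => by
      by_contra h
      have := hR (subset_tsupport _ h)
      rw [Real.closedBall_eq_Icc] at this
      linarith [this.2]
    have hRd : ∀ x, R < x → deriv φ x = 0 := fun x hx => by
      by_contra h
      have := hR (support_deriv_subset h)
      rw [Real.closedBall_eq_Icc] at this
      linarith [this.2]
    have hFTC : ∀ a, ∫ x in Ioi a, deriv φ x = -φ a := fun a => by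
      have := integral_Ioi_of_hasDerivAt_of_tendsto' (f := φ) (f' := deriv φ) (a := a) (m := 0)
        (fun x _ => (hφ.differentiable (by simp) x).hasDerivAt) hint.integrableOn ?_
      · rw [this, zero_sub]
      · refine tendsto_const_nhds.congr' ?_
        filter_upwards [eventually_gt_atTop R] with x hx using (hRφ x hx).symm
    have hL := hD.integral_mul_m_sub hC ht le_rfl hint hRd (le_refl (R + C * t))
    have hm := hD.integrableOn_mul_m ht hint hRd
    simp only [mul_sub, hFTC] at hL
    rw [integral_sub hm (hint.integrableOn.mul_const _), integral_mul_const, hFTC,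
      hz 0 le_rfl, neg_zero, zero_mul, sub_zero] at hL
    rw [hL, hD.integral_massAt ht hφ.continuous.measurable (hz 0 le_rfl)]
    simp only [neg_mul, integral_neg, neg_neg]
    refine (setIntegral_eq_integral_of_forall_compl_eq_zero fun s hs => ?_).symm
    rcases le_or_gt s (-t) with h | h
    · rw [hD.pos_of_le_neg ht h, hz 0 le_rfl, zero_mul]
    · have h2 : R + C * t < s := by
        by_contra! h'
        exact hs ⟨h, h'⟩
      have := hD.le_pos_add hC (s := s) ht
      rw [hRφ _ (by linarith), zero_mul]

end Admissible

end Data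
end PressurelessGas

/-! ### Test functions along Lipschitz paths -/

namespace PressurelessGas

/-- Bounded measurable functions with bounded support are integrable. -/
lemma integrable_of_bounded_of_support {f : ℝ × ℝ → ℝ} (hm : Measurable f) {B : ℝ}
    (hB : ∀ p, |f p| ≤ B) {a b : ℝ × ℝ} (h0 : ∀ p, f p ≠ 0 → p ∈ Icc a b) :
    Integrable f (volume.prod volume) := by
  rw [← integrableOn_iff_integrable_of_support_subset (s := Icc a b) h0]
  refine Measure.integrableOn_of_bounded (M := B) ?_ hm.aestronglyMeasurable
    (ae_of_all _ hB)
  exact (isCompact_Icc.measure_lt_top (μ := (volume : Measure ℝ).prod volume)).ne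

namespace IsTest

variable {φ : ℝ × ℝ → ℝ}

lemma exists_box (hφ : IsTest φ) : ∃ R : ℝ, 0 < R ∧ ∀ p ∈ tsupport φ,
    (0 < p.1 ∧ p.1 ≤ R) ∧ (0 < p.2 ∧ p.2 ≤ R) := by
  obtain ⟨R, hR⟩ := hφ.compactSupport.isCompact.isBounded.exists_norm_le
  refine ⟨max R 1, by positivity, fun p hp => ?_⟩
  have h1 := hφ.support hp
  have h2 := (hR p hp).trans (le_max_left R 1)
  exact ⟨⟨h1.1, (le_abs_self _).trans ((norm_fst_le p).trans h2)⟩,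
    ⟨h1.2, (le_abs_self _).trans ((norm_snd_le p).trans h2)⟩⟩

lemma fderiv_eq_zero {p : ℝ × ℝ} (hp : p ∉ tsupport φ) : fderiv ℝ φ p = 0 := by
  by_contra h
  exact hp (support_fderiv_subset ℝ h)

lemma continuous_fderiv (hφ : IsTest φ) : Continuous (fderiv ℝ φ) :=
  hφ.smooth.continuous_fderiv (by simp)

lemma continuous_dx (hφ : IsTest φ) : Continuous fun p : ℝ × ℝ => dx φ p.1 p.2 := by
  unfold dx
  exact hφ.continuous_fderiv.clm_apply continuous_const

lemma continuous_dt (hφ : IsTest φ) : Continuous fun p : ℝ × ℝ => dt φ p.1 p.2 := by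
  unfold dt
  exact hφ.continuous_fderiv.clm_apply continuous_const

lemma dx_eq_zero {x t : ℝ} (hp : (x, t) ∉ tsupport φ) : dx φ x t = 0 := by
  simp [dx, fderiv_eq_zero hp]

lemma dt_eq_zero {x t : ℝ} (hp : (x, t) ∉ tsupport φ) : dt φ x t = 0 := by
  simp [dt, fderiv_eq_zero hp]

lemma eq_zero {p : ℝ × ℝ} (hp : p ∉ tsupport φ) : φ p = 0 := image_eq_zero_of_notMem_tsupport hp

lemma exists_bound_fderiv (hφ : IsTest φ) : ∃ B : ℝ, ∀ p, ‖fderiv ℝ φ p‖ ≤ B := by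
  obtain ⟨B, hB⟩ := hφ.continuous_fderiv.bounded_above_of_compact_support
    (hφ.compactSupport.fderiv ℝ)
  exact ⟨B, hB⟩

lemma exists_bound (hφ : IsTest φ) : ∃ B : ℝ, (∀ p, |φ p| ≤ B) ∧ (∀ x t, |dx φ x t| ≤ B) ∧
    ∀ x t, |dt φ x t| ≤ B := by
  obtain ⟨B, hB⟩ := hφ.smooth.continuous.bounded_above_of_compact_support hφ.compactSupport
  obtain ⟨B', hB'⟩ := hφ.exists_bound_fderiv
  refine ⟨max B B', fun p => (hB p).trans (le_max_left _ _), fun x t => ?_, fun x t => ?_⟩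
  · refine le_trans ?_ (le_max_right B B')
    refine ((fderiv ℝ φ (x, t)).le_opNorm (1, 0)).trans ?_
    simpa [Prod.norm_def] using hB' (x, t)
  · refine le_trans ?_ (le_max_right B B')
    refine ((fderiv ℝ φ (x, t)).le_opNorm (0, 1)).trans ?_
    simpa [Prod.norm_def] using hB' (x, t)

lemma fderiv_apply (φ : ℝ × ℝ → ℝ) (x t a b : ℝ) :
    fderiv ℝ φ (x, t) (a, b) = a * dx φ x t + b * dt φ x t := by
  have : ((a, b) : ℝ × ℝ) = a • (1, 0) + b • (0, 1) := by simp
  rw [this, map_add, map_smul, map_smul]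
  rfl

lemma exists_lipschitz (hφ : IsTest φ) : ∃ K, LipschitzWith K φ :=
  ⟨_, hφ.smooth.lipschitzWith_of_hasCompactSupport hφ.compactSupport (by simp)
    |>.choose_spec⟩

/-- The total derivative of a test function along a Lipschitz path has integral zero. -/
lemma integral_transport (hφ : IsTest φ) {X : ℝ → ℝ} {K : NNReal} (hX : LipschitzWith K X)
    (z : ℝ) : ∫ t in Ioi (0 : ℝ), (dt φ (X t + z) t + dx φ (X t + z) t * deriv X t) = 0 := by
  obtain ⟨R, hR, hbox⟩ := hφ.exists_box
  obtain ⟨L, hL⟩ := hφ.exists_lipschitz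
  have hf : LipschitzWith (L * max (K + 0) 1) fun t => φ (X t + z, t) :=
    hL.comp ((hX.add (LipschitzWith.const z)).prodMk LipschitzWith.id)
  -- A Lipschitz function is absolutely continuous, so its derivative integrates to the difference
  -- of the end values, and both lie outside the support of φ.
  have h1 := (hf.lipschitzOnWith (s := uIcc 0 (R + 1))).absolutelyContinuousOnInterval
    |>.integral_deriv_eq_sub
  have hz1 : (X (R + 1) + z, R + 1) ∉ tsupport φ := fun h => by linarith [(hbox _ h).2.2]
  have hz0 : (X 0 + z, (0 : ℝ)) ∉ tsupport φ := fun h => by linarith [(hbox _ h).2.1]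
  rw [eq_zero hz1, eq_zero hz0, sub_zero, intervalIntegral.integral_of_le
    (show (0 : ℝ) ≤ R + 1 by linarith)] at h1
  have h2 : ∫ t in Ioi (0 : ℝ), (dt φ (X t + z) t + dx φ (X t + z) t * deriv X t) =
      ∫ t in Ioc 0 (R + 1), (dt φ (X t + z) t + dx φ (X t + z) t * deriv X t) := by
    apply setIntegral_eq_of_subset_of_forall_sdiff_eq_zero measurableSet_Ioi Ioc_subset_Ioi_self
    intro t ht
    have : (X t + z, t) ∉ tsupport φ := fun h =>
      ht.2 ⟨ht.1, (hbox _ h).2.2.trans (le_add_of_nonneg_right zero_le_one)⟩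
    rw [dt_eq_zero this, dx_eq_zero this]; ring
  refine h2.trans (Eq.trans ?_ h1)
  refine integral_congr_ae (ae_restrict_of_ae ?_)
  filter_upwards [hX.ae_differentiableAt_real] with t ht
  have h3 : HasDerivAt (fun t => (X t + z, t)) (deriv X t, (1 : ℝ)) t :=
    (ht.hasDerivAt.add_const z).prodMk (hasDerivAt_id t)
  have h4 : HasDerivAt (fun t => φ (X t + z, t)) (fderiv ℝ φ (X t + z, t) (deriv X t, 1)) t :=
    (hφ.smooth.differentiable (by simp) (X t + z, t)).hasFDerivAt.comp_hasDerivAt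
      (f := fun t => (X t + z, t)) t h3
  rw [h4.deriv, fderiv_apply]
  ring

lemma integral_Ioi_shift (f : ℝ → ℝ) (a : ℝ) :
    ∫ x in Ioi a, f x = ∫ z in Ioi (0 : ℝ), f (a + z) := by
  rw [← integral_indicator measurableSet_Ioi, ← integral_indicator measurableSet_Ioi,
    ← integral_add_left_eq_self _ a]
  refine integral_congr_ae (ae_of_all _ fun z => ?_)
  simp [indicator]

/-- Transport of the part of the quarter plane beyond a Lipschitz path. -/
lemma integral_dt_above (hφ : IsTest φ) {X : ℝ → ℝ} {K : NNReal} (hX : LipschitzWith K X)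
    (h0 : ∀ t, 0 ≤ X t) :
    ∫ t in Ioi (0 : ℝ), ∫ x in Ioi (X t), dt φ x t =
      ∫ t in Ioi (0 : ℝ), φ (X t, t) * deriv X t := by
  obtain ⟨R, hR, hbox⟩ := hφ.exists_box
  obtain ⟨B, hB, hBx, hBt⟩ := hφ.exists_bound
  have hB0 : 0 ≤ B := (abs_nonneg _).trans (hB 0)
  have hsupp : ∀ q : ℝ × ℝ, 0 ≤ q.2 → (X q.1 + q.2, q.1) ∈ tsupport φ →
      q ∈ Icc ((0 : ℝ), (0 : ℝ)) (R, R) := fun q hq h => by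
    have := hbox _ h
    exact ⟨⟨this.2.1.le, hq⟩, ⟨this.2.2, by linarith [this.1.2, h0 q.1]⟩⟩
  have hmap : Continuous fun q : ℝ × ℝ => (X q.1 + q.2, q.1) := by
    have := hX.continuous
    fun_prop
  have hset : MeasurableSet {q : ℝ × ℝ | 0 ≤ q.2} := measurableSet_le measurable_const measurable_snd
  -- For z ≥ 0 the bounds 0 ≤ X and X + z ≤ R confine z to [0, R]. Hence the cut-off to z ≥ 0 before
  -- integrability over the plane is claimed.
  have key : ∀ f : ℝ × ℝ → ℝ, Measurable f → ∀ B', (∀ q, |f q| ≤ B') →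
      (∀ q : ℝ × ℝ, (X q.1 + q.2, q.1) ∉ tsupport φ → f q = 0) →
      Integrable f ((volume.restrict (Ioi 0)).prod (volume.restrict (Ioi 0))) := by
    intro f hf B' hB' hf0
    have h1 : Integrable ({q : ℝ × ℝ | 0 ≤ q.2}.indicator f) (volume.prod volume) := by
      refine integrable_of_bounded_of_support (hf.indicator hset) (B := B') (fun q => ?_)
        (a := (0, 0)) (b := (R, R)) fun q hq => ?_
      · unfold indicator
        split_ifs
        · exact hB' q
        · simpa using (abs_nonneg _).trans (hB' q)
      · have h1 := indicator_apply_ne_zero.1 hq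
        exact hsupp q h1.1 (by by_contra h; exact h1.2 (hf0 q h))
    rw [Measure.prod_restrict]
    refine (h1.integrableOn (s := Ioi 0 ×ˢ Ioi 0)).congr_fun (fun q hq => ?_)
      (measurableSet_Ioi.prod measurableSet_Ioi)
    exact indicator_of_mem (s := {q : ℝ × ℝ | 0 ≤ q.2}) (show 0 ≤ q.2 from le_of_lt hq.2) f
  have hi1 := key (fun q => dt φ (X q.1 + q.2) q.1) (hφ.continuous_dt.comp hmap).measurable B
    (fun q => hBt _ _) fun q hq => dt_eq_zero hq
  have hi2 := key (fun q => dx φ (X q.1 + q.2) q.1 * deriv X q.1)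
    ((hφ.continuous_dx.comp hmap).measurable.mul ((measurable_deriv X).comp measurable_fst))
    (B * K) (fun q => by
      rw [abs_mul]
      exact mul_le_mul (hBx _ _) (norm_deriv_le_of_lipschitz hX) (abs_nonneg _) hB0)
    fun q hq => by rw [dx_eq_zero hq, zero_mul]
  have hx : ∀ t, ∫ z in Ioi (0 : ℝ), dx φ (X t + z) t = -φ (X t, t) := fun t => by
    have hd : ∀ z ∈ Ici (0 : ℝ), HasDerivAt (fun z => φ (X t + z, t)) (dx φ (X t + z) t) z := by
      intro z _
      have h3 : HasDerivAt (fun z => (X t + z, t)) ((1 : ℝ), (0 : ℝ)) z :=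
        ((hasDerivAt_id z).const_add (X t)).prodMk (hasDerivAt_const z t)
      exact (hφ.smooth.differentiable (by simp)
        (X t + z, t)).hasFDerivAt.comp_hasDerivAt
          (f := fun z => (X t + z, t)) z h3
    have hcont : Continuous fun z => dx φ (X t + z) t :=
      hφ.continuous_dx.comp (by fun_prop : Continuous fun z => (X t + z, t))
    have hint : IntegrableOn (fun z => dx φ (X t + z) t) (Ioi 0) := by
      rw [← Ioc_union_Ioi_eq_Ioi hR.le]
      refine (hcont.integrableOn_Icc.mono_set Ioc_subset_Icc_self).union ?_
      refine integrableOn_zero.congr_fun (fun z hz => ?_) measurableSet_Ioi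
      exact (dx_eq_zero fun h => by linarith [(hbox _ h).1.2, h0 t, show R < z from hz]).symm
    have := integral_Ioi_of_hasDerivAt_of_tendsto' hd hint (m := 0) ?_
    · rw [this, add_zero, zero_sub]
    · refine tendsto_const_nhds.congr' ?_
      filter_upwards [eventually_gt_atTop R] with z hz
      exact (eq_zero fun h => by linarith [(hbox _ h).1.2, h0 t]).symm
  -- With x = X(t) + z the domain no longer depends on t. For fixed z, `integral_transport` trades
  -- φ_t for -φ_x X', and integrating φ_x over z > 0 leaves -φ(X(t), t).
  have hshift : ∀ t, ∫ x in Ioi (X t), dt φ x t = ∫ z in Ioi (0 : ℝ), dt φ (X t + z) t :=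
    fun t => integral_Ioi_shift _ _
  simp only [hshift]
  rw [integral_integral_swap hi1]
  have h1 : ∀ z, Integrable (fun t => dt φ (X t + z) t) (volume.restrict (Ioi 0)) →
      Integrable (fun t => dx φ (X t + z) t * deriv X t) (volume.restrict (Ioi 0)) →
      ∫ t in Ioi (0 : ℝ), dt φ (X t + z) t =
      -∫ t in Ioi (0 : ℝ), dx φ (X t + z) t * deriv X t := fun z hz1 hz2 => by
    have := hφ.integral_transport hX z
    rw [integral_add hz1 hz2] at this
    linarith
  have h2 : ∫ z in Ioi (0 : ℝ), ∫ t in Ioi (0 : ℝ), dt φ (X t + z) t =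
      ∫ z in Ioi (0 : ℝ), -∫ t in Ioi (0 : ℝ), dx φ (X t + z) t * deriv X t := by
    refine integral_congr_ae ?_
    filter_upwards [hi1.prod_left_ae, hi2.prod_left_ae] with z hz1 hz2 using h1 z hz1 hz2
  rw [h2, integral_neg, ← integral_integral_swap hi2, ← integral_neg]
  refine integral_congr_ae (ae_of_all _ fun t => ?_)
  simp only [integral_mul_const, hx]
  ring

end IsTest

end PressurelessGas

/-! ### The weak equations -/

namespace PressurelessGas

/-- Bounded measurable functions whose support is bounded and lies in the quarter plane. -/
structure IsBoxed (g : ℝ × ℝ → ℝ) (R B : ℝ) : Prop where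
  measurable : Measurable g
  bound : ∀ p, |g p| ≤ B
  support : ∀ p, g p ≠ 0 → (0 < p.1 ∧ p.1 ≤ R) ∧ (0 < p.2 ∧ p.2 ≤ R)

namespace Data

variable {D : Data} {C : ℝ} {I : Set ℝ} {x t x' t' s s' c T R S B : ℝ} {g φ : ℝ × ℝ → ℝ}

namespace Admissible

lemma IsBoxed.eq_zero (hg : IsBoxed g R B) (hx : x ≤ 0) : g (x, t) = 0 := by
  by_contra h
  linarith [(hg.support _ h).1.1]

/-- Only labels between -R and R + C R can be in the box: earlier ones must have entered by the time
R, later ones have speed at most C. -/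
lemma integrable_label (hD : D.Admissible) (hg : IsBoxed g R B) {w : ℝ → ℝ} (hw : Measurable w)
    (hwb : ∀ R : ℝ, ∃ K : ℝ, ∀ s : ℝ, |s| ≤ R → |w s| ≤ K) :
    Integrable (fun q : ℝ × ℝ => g (D.pos q.1 (max q.2 0), q.2) * w q.1)
      (volume.prod (volume.restrict (Ioi 0))) := by
  obtain ⟨C, hC0, hC⟩ := hD.exists_speed_bound
  obtain ⟨K, hK⟩ := hwb (|R| + C * |R|)
  have hB0 : 0 ≤ B := (abs_nonneg _).trans (hg.bound 0)
  have hsupp : ∀ q : ℝ × ℝ, g (D.pos q.1 (max q.2 0), q.2) ≠ 0 →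
      (0 < q.2 ∧ q.2 ≤ R) ∧ -R ≤ q.1 ∧ q.1 ≤ R + C * R := fun q hq => by
    obtain ⟨⟨h1, h2⟩, h3, h4⟩ := hg.support _ hq
    simp only at h1 h2 h3 h4
    rw [max_eq_left h3.le] at h1 h2
    refine ⟨⟨h3, h4⟩, ?_, ?_⟩
    · by_contra! h
      rw [hD.pos_of_le_neg h3.le (by linarith)] at h1
      exact lt_irrefl _ h1
    · have := hD.le_pos_add hC (s := q.1) h3.le
      have := mul_le_mul_of_nonneg_left h4 hC0.le
      linarith
  have h1 : Integrable (fun q : ℝ × ℝ => g (D.pos q.1 (max q.2 0), q.2) * w q.1)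
      (volume.prod volume) := by
    refine integrable_of_bounded_of_support ?_ (B := B * |K|) (fun q => ?_)
      (a := (-R, 0)) (b := (R + C * R, R)) fun q hq => ?_
    · exact (hg.measurable.comp (hD.measurable_pos_max.prodMk measurable_snd)).mul
        (hw.comp measurable_fst)
    · by_cases h : g (D.pos q.1 (max q.2 0), q.2) = 0
      · rw [h, zero_mul, abs_zero]; positivity
      · obtain ⟨⟨h1, h2⟩, h3, h4⟩ := hsupp q h
        rw [abs_mul]
        refine mul_le_mul (hg.bound _) ((hK _ ?_).trans (le_abs_self K)) (abs_nonneg _) hB0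
        have h5 : 0 < R := h1.trans_le h2
        have h6 : 0 < C * R := mul_pos hC0 h5
        rw [abs_of_pos h5, abs_le]
        constructor <;> linarith
    · obtain ⟨⟨h1, h2⟩, h3, h4⟩ := hsupp q (left_ne_zero_of_mul hq)
      exact ⟨⟨h3, h1.le⟩, ⟨h4, h2⟩⟩
  have h2 := h1.restrict (s := univ ×ˢ Ioi 0)
  rwa [← Measure.prod_restrict, Measure.restrict_univ] at h2

/-- Exchange of the integrations over the labels and over the time. -/
lemma integral_label_swap (hD : D.Admissible) (hg : IsBoxed g R B) {w : ℝ → ℝ} (hw : Measurable w)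
    (hwb : ∀ R : ℝ, ∃ K : ℝ, ∀ s : ℝ, |s| ≤ R → |w s| ≤ K) :
    ∫ t in Ioi (0 : ℝ), ∫ s, g (D.pos s t, t) * w s =
      ∫ s, (∫ t in Ioi (0 : ℝ), g (D.pos s t, t)) * w s := by
  have h1 := integral_integral_swap
    (f := fun s t => g (D.pos s (max t 0), t) * w s) (hD.integrable_label hg hw hwb)
  have h2 : ∫ t in Ioi (0 : ℝ), ∫ s, g (D.pos s t, t) * w s =
      ∫ t in Ioi (0 : ℝ), ∫ s, g (D.pos s (max t 0), t) * w s :=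
    setIntegral_congr_fun measurableSet_Ioi fun t ht => by
      simp only [max_eq_left (le_of_lt (mem_Ioi.1 ht))]
  rw [h2, ← h1]
  congr 1
  ext s
  rw [integral_mul_const]
  congr 1
  exact setIntegral_congr_fun measurableSet_Ioi fun t ht => by
      simp only [max_eq_left (le_of_lt (mem_Ioi.1 ht))]

/-- Reduces integrals against ρ(dx, t) dt to integrals over labels and times. Here g is a version of
the integrand that is measurable on the whole plane. -/
lemma hasDoubleIntegral_massAt (hD : D.Admissible) (hg : IsBoxed g R B) {f : ℝ → ℝ → ℝ}
    (hf : ∀ x t, 0 < t → f x t = g (x, t)) {c : ℝ}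
    (hc : ∫ t in Ioi (0 : ℝ), ∫ s, g (D.pos s t, t) * D.dens s = c) :
    HasDoubleIntegral D.massAt f c := by
  have hint := hD.integrable_label hg hD.measurable_dens hD.dens_locallyBounded
  have hg1 : ∀ t, Measurable fun x => g (x, t) := fun t =>
    hg.measurable.comp (by fun_prop : Measurable fun x : ℝ => (x, t))
  have hfe : ∀ t ∈ Ioi (0 : ℝ), (fun x => f x t) = fun x => g (x, t) := fun t ht => by
    ext x; exact hf x t ht
  have he : ∀ t ∈ Ioi (0 : ℝ), ∫ x, f x t ∂D.massAt t = ∫ s, g (D.pos s t, t) * D.dens s :=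
    fun t ht => by
      rw [hfe t ht]
      exact hD.integral_massAt (le_of_lt ht) (hg1 t) (IsBoxed.eq_zero hg le_rfl)
  refine ⟨?_, ?_, ?_⟩
  · filter_upwards [hint.prod_left_ae, ae_restrict_mem measurableSet_Ioi] with t h ht
    rw [hfe t ht]
    refine hD.integrable_massAt (le_of_lt ht) (hg1 t) ?_
    simpa only [max_eq_left (le_of_lt (mem_Ioi.1 ht))] using h
  · refine IntegrableOn.congr_fun (f := fun t => ∫ s, g (D.pos s (max t 0), t) * D.dens s)
      hint.integral_prod_right (fun t ht => ?_) measurableSet_Ioi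
    simp only [max_eq_left (le_of_lt (mem_Ioi.1 ht)), he t ht]
  · rw [← hc]
    exact setIntegral_congr_fun measurableSet_Ioi he

lemma ae_deriv_pos (hD : D.Admissible) (hs : s ∉ D.fanLabels) :
    ∀ᵐ t ∂(volume : Measure ℝ), 0 < t → 0 < D.pos s t →
      deriv (fun θ => D.pos s (max θ 0)) t = D.speedMax (D.pos s t, t) := by
  filter_upwards [hD.ae_hasDerivAt_pos hs] with t h ht hpos
  rw [← hD.u_eq_speedMax hpos ht]
  refine HasDerivAt.deriv ((h ht hpos).congr_of_eventuallyEq ?_)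
  filter_upwards [lt_mem_nhds ht] with θ hθ
  rw [max_eq_left hθ.le]

/-- The derivative of the trajectory is u almost everywhere off the boundary; on the boundary φ_x
vanishes, so the velocity there plays no role. -/
lemma integral_transport_pos (hD : D.Admissible) (hφ : IsTest φ) (hs : s ∉ D.fanLabels) :
    ∫ t in Ioi (0 : ℝ), (dt φ (D.pos s t) t +
      dx φ (D.pos s t) t * D.speedMax (D.pos s t, t)) = 0 := by
  obtain ⟨C, hC0, hC⟩ := hD.exists_speed_bound
  refine Eq.trans ?_ (hφ.integral_transport (hD.lipschitzWith_pos hC s) 0)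
  refine integral_congr_ae ?_
  filter_upwards [ae_restrict_of_ae (hD.ae_deriv_pos hs), ae_restrict_mem measurableSet_Ioi]
    with t h ht
  rw [max_eq_left (le_of_lt (mem_Ioi.1 ht)), add_zero]
  rcases (pos_nonneg (D := D) (s := s) (t := t)).eq_or_lt with h0 | h0
  · have : (D.pos s t, t) ∉ tsupport φ := fun h => by
      have := (hφ.support h).1
      rw [← h0] at this
      exact lt_irrefl (0 : ℝ) this
    rw [IsTest.dx_eq_zero this, zero_mul, zero_mul]
  · rw [h ht h0]

lemma speedMax_bound (hD : D.Admissible) (hC : ∀ s, |D.vel s| < C) {p : ℝ × ℝ} (h1 : 0 < p.1)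
    (h2 : 0 < p.2) : |D.speedMax p| ≤ C := by
  have := hD.abs_u_le hC h1 h2
  rwa [hD.u_eq_speedMax h1 h2] at this

/-- Products with the velocity stay in the class of bounded functions on boxes. -/
lemma isBoxed_mul_speedMax (hD : D.Admissible) (hC : ∀ s, |D.vel s| < C) (hg : IsBoxed g R B) :
    IsBoxed (fun p => g p * D.speedMax p) R (B * C) where
  measurable := hg.measurable.mul hD.measurable_speedMax
  bound p := by
    have hB0 : 0 ≤ B := (abs_nonneg _).trans (hg.bound 0)
    have hC0 : 0 < C := (abs_nonneg _).trans_lt (hC 0)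
    by_cases h : g p = 0
    · rw [h, zero_mul, abs_zero]; positivity
    · obtain ⟨⟨h1, -⟩, h2, -⟩ := hg.support p h
      rw [abs_mul]
      exact mul_le_mul (hg.bound p) (hD.speedMax_bound hC h1 h2) (abs_nonneg _) hB0
  support p hp := hg.support p (left_ne_zero_of_mul hp)

lemma mul_u_eq (hD : D.Admissible) (hg : IsBoxed g R B) (ht : 0 < t) :
    g (x, t) * D.u x t = g (x, t) * D.speedMax (x, t) := by
  rcases le_or_gt x 0 with h | h
  · rw [IsBoxed.eq_zero hg h, zero_mul, zero_mul]
  · rw [hD.u_eq_speedMax h ht]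

end Admissible

lemma _root_.PressurelessGas.IsTest.exists_isBoxed (hφ : IsTest φ) : ∃ R B, IsBoxed φ R B ∧
    IsBoxed (fun p => dt φ p.1 p.2) R B ∧ IsBoxed (fun p => dx φ p.1 p.2) R B := by
  obtain ⟨R, hR, hbox⟩ := hφ.exists_box
  obtain ⟨B, h1, h2, h3⟩ := hφ.exists_bound
  refine ⟨R, B, ⟨hφ.smooth.continuous.measurable, h1, fun p hp => hbox p ?_⟩,
    ⟨hφ.continuous_dt.measurable, fun p => h3 _ _, fun p hp => hbox p ?_⟩,
    ⟨hφ.continuous_dx.measurable, fun p => h2 _ _, fun p hp => hbox p ?_⟩⟩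
  · exact subset_tsupport _ hp
  · by_contra h; exact hp (IsTest.dt_eq_zero h)
  · by_contra h; exact hp (IsTest.dx_eq_zero h)

lemma _root_.PressurelessGas.IsBoxed.add {f : ℝ × ℝ → ℝ} {B' : ℝ} (hf : IsBoxed f R B)
    (hg : IsBoxed g R B') : IsBoxed (fun p => f p + g p) R (B + B') where
  measurable := hf.measurable.add hg.measurable
  bound p := (abs_add_le _ _).trans (add_le_add (hf.bound p) (hg.bound p))
  support p hp := by
    by_cases h : f p = 0
    · exact hg.support p fun h' => hp (by rw [h, h', add_zero])
    · exact hf.support p h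

namespace Admissible

lemma ae_integral_transport (hD : D.Admissible) (hφ : IsTest φ) (w : ℝ → ℝ) :
    ∫ s, (∫ t in Ioi (0 : ℝ), (dt φ (D.pos s t) t +
      dx φ (D.pos s t) t * D.speedMax (D.pos s t, t))) * w s = 0 := by
  refine integral_eq_zero_of_ae ?_
  filter_upwards [D.countable_fanLabels.ae_notMem (μ := volume)] with s hs
  simp [hD.integral_transport_pos hφ hs]

/-- Conservation of momentum. -/
lemma momentum_massAt (hD : D.Admissible) (hφ : IsTest φ) :
    HasDoubleIntegral D.massAt (fun x t => dt φ x t * D.u x t + dx φ x t * D.u x t ^ 2) 0 := by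
  obtain ⟨C, hC0, hC⟩ := hD.exists_speed_bound
  obtain ⟨R, B, -, ht, hx⟩ := hφ.exists_isBoxed
  have hg1 := ht.add (hD.isBoxed_mul_speedMax hC hx)
  have hg := hD.isBoxed_mul_speedMax hC hg1
  refine hD.hasDoubleIntegral_massAt hg (fun x t ht0 => ?_) ?_
  · have h1 := hD.mul_u_eq ht ht0 (x := x)
    have h2 := hD.mul_u_eq hx ht0 (x := x)
    have h3 := hD.mul_u_eq (hD.isBoxed_mul_speedMax hC hx) ht0 (x := x)
    simp only at h1 h2 h3 ⊢
    rw [h1, sq, ← mul_assoc, h2, h3]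
    ring
  · have hi1 := hD.integrable_label hg hD.measurable_dens hD.dens_locallyBounded
    have hi2 := hD.integrable_label hg1 (hD.measurable_vel.mul hD.measurable_dens)
      hD.vel_mul_dens_locallyBounded
    -- Weighted with the starting momentum vel dens, the transport identity gives zero. It remains
    -- to replace, at almost every time, one factor u in (φ_t + φ_x u) u by `vel`; this is
    -- `integral_pos_mul_u` with the test function φ_t + φ_x u.
    have h := hD.integral_label_swap hg1 (hD.measurable_vel.mul hD.measurable_dens)
      hD.vel_mul_dens_locallyBounded
    rw [hD.ae_integral_transport hφ] at h
    refine Eq.trans ?_ h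
    refine integral_congr_ae ?_
    filter_upwards [hi1.prod_left_ae, hi2.prod_left_ae, ae_restrict_mem measurableSet_Ioi]
      with t h1 h2 ht
    have ht0 : 0 < t := ht
    simp only [max_eq_left ht0.le] at h1 h2
    have e : (fun s => (dt φ (D.pos s t) t + dx φ (D.pos s t) t * D.speedMax (D.pos s t, t)) *
        D.speedMax (D.pos s t, t) * D.dens s -
        (dt φ (D.pos s t) t + dx φ (D.pos s t) t * D.speedMax (D.pos s t, t)) *
        (D.vel * D.dens) s) = fun s =>
        (dt φ (D.pos s t) t + dx φ (D.pos s t) t * D.speedMax (D.pos s t, t)) *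
        (D.u (D.pos s t) t - D.vel s) * D.dens s := by
      ext s
      have := hD.mul_u_eq hg1 ht0 (x := D.pos s t)
      simp only at this
      rw [mul_sub, this, Pi.mul_apply]; ring
    have h3 := (h1.sub h2).congr (ae_of_all _ fun s => congrFun e s)
    have h4 := integral_sub h1 h2
    rw [e] at h4
    have h5 := hD.integral_pos_mul_u ht0
      (g := fun x => dt φ x t + dx φ x t * D.speedMax (x, t))
      (IsBoxed.eq_zero hg1 le_rfl) h3
    rw [h5] at h4
    exact sub_eq_zero.1 h4.symm

/-- Conservation of mass. -/
lemma continuity_massAt (hD : D.Admissible) (hφ : IsTest φ) :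
    HasDoubleIntegral D.massAt (fun x t => dt φ x t + dx φ x t * D.u x t) 0 := by
  obtain ⟨C, hC0, hC⟩ := hD.exists_speed_bound
  obtain ⟨R, B, -, ht, hx⟩ := hφ.exists_isBoxed
  have hg := ht.add (hD.isBoxed_mul_speedMax hC hx)
  refine hD.hasDoubleIntegral_massAt hg (fun x t ht0 => ?_) ?_
  · rw [hD.mul_u_eq hx ht0 (x := x)]
  · rw [hD.integral_label_swap hg hD.measurable_dens hD.dens_locallyBounded]
    exact hD.ae_integral_transport hφ _

/-- The potential form of the conservation of mass. -/
lemma mass_massAt (hD : D.Admissible) (hφ : IsTest φ) :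
    HasDoubleIntegral D.massAt (fun x t => φ (x, t) * D.u x t)
      (∫ t in Ioi (0 : ℝ), ∫ x in Ioi (0 : ℝ), dt φ x t * D.m x t) := by
  obtain ⟨C, hC0, hC⟩ := hD.exists_speed_bound
  obtain ⟨R, B, hbφ, hbt, -⟩ := hφ.exists_isBoxed
  have hB0 : 0 ≤ B := (abs_nonneg _).trans (hbφ.bound 0)
  have hg := hD.isBoxed_mul_speedMax hC hbφ
  refine hD.hasDoubleIntegral_massAt hg (fun x t ht0 => hD.mul_u_eq hbφ ht0) ?_
  rw [hD.integral_label_swap hg hD.measurable_dens hD.dens_locallyBounded]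
  have hinner : ∀ s, s ∉ D.fanLabels →
      ∫ t in Ioi (0 : ℝ), φ (D.pos s t, t) * D.speedMax (D.pos s t, t) =
      ∫ t in Ioi (0 : ℝ), ∫ x in Ioi (D.pos s (max t 0)), dt φ x t := fun s hs => by
    rw [hφ.integral_dt_above (hD.lipschitzWith_pos hC s) fun t => pos_nonneg]
    refine integral_congr_ae ?_
    filter_upwards [ae_restrict_of_ae (hD.ae_deriv_pos hs), ae_restrict_mem measurableSet_Ioi]
      with t h ht
    rw [max_eq_left (le_of_lt (mem_Ioi.1 ht))]
    rcases (pos_nonneg (D := D) (s := s) (t := t)).eq_or_lt with h0 | h0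
    · rw [IsBoxed.eq_zero hbφ h0.ge, zero_mul, zero_mul]
    · rw [h ht h0]
  -- The transport identity for the constant path 0. It removes the constant mass at -R by which m
  -- is shifted below.
  have hzero : ∫ t in Ioi (0 : ℝ), ∫ x in Ioi (0 : ℝ), dt φ x t = 0 := by
    rw [hφ.integral_dt_above (LipschitzWith.const (0 : ℝ)) fun t => le_rfl]
    simp
  have hdt : ∀ t, Integrable fun x => dt φ x t := fun t => by
    have hc : Continuous fun x => dt φ x t :=
      hφ.continuous_dt.comp (by fun_prop : Continuous fun x : ℝ => (x, t))
    refine hc.integrable_of_hasCompactSupport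
      (HasCompactSupport.intro (isCompact_Icc (a := 0) (b := R)) fun x hx => ?_)
    by_contra h
    exact hx ⟨(hbt.support (x, t) h).1.1.le, (hbt.support (x, t) h).1.2⟩
  have hprod : Integrable (fun q : ℝ × ℝ => dt φ q.2 q.1) (volume.prod volume) :=
    integrable_of_bounded_of_support (hbt.measurable.comp measurable_swap)
      (fun q => hbt.bound (q.2, q.1)) (a := (0, 0)) (b := (R, R)) fun q hq => by
        have := hbt.support (q.2, q.1) hq
        exact ⟨⟨this.2.1.le, this.1.1.le⟩, ⟨this.2.2, this.1.2⟩⟩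
  have hPhi : Integrable (fun q : ℝ × ℝ => (∫ x in Ioi (D.pos q.1 (max q.2 0)), dt φ x q.2) *
      D.dens q.1) ((volume.restrict (Ioc (-R) (R + C * R))).prod (volume.restrict (Ioi 0))) := by
    have hset : MeasurableSet {q : (ℝ × ℝ) × ℝ | D.pos q.1.1 (max q.1.2 0) < q.2} :=
      measurableSet_lt (hD.measurable_pos_max.comp measurable_fst) measurable_snd
    have hmeas : Measurable fun q : ℝ × ℝ =>
        ∫ x in Ioi (D.pos q.1 (max q.2 0)), dt φ x q.2 := by
      have h1 : Measurable ({q : (ℝ × ℝ) × ℝ | D.pos q.1.1 (max q.1.2 0) < q.2}.indicator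
          fun q => dt φ q.2 q.1.2) :=
        (hbt.measurable.comp (by fun_prop : Measurable fun q : (ℝ × ℝ) × ℝ =>
          (q.2, q.1.2))).indicator hset
      have h2 := (h1.stronglyMeasurable.integral_prod_right' (ν := volume)).measurable
      have h3 : ∀ q : ℝ × ℝ, ∫ x in Ioi (D.pos q.1 (max q.2 0)), dt φ x q.2 =
          ∫ x, {q : (ℝ × ℝ) × ℝ | D.pos q.1.1 (max q.1.2 0) < q.2}.indicator
            (fun q => dt φ q.2 q.1.2) (q, x) := fun q => by
        rw [← integral_indicator measurableSet_Ioi]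
        rfl
      simp only [h3]
      exact h2
    refine Integrable.mono' ((hprod.norm.integral_prod_left.restrict (s := Ioi 0)).mul_prod
      (hD.dens_intervalIntegrable (-R) (R + C * R)).1).swap
      (hmeas.mul (hD.measurable_dens.comp measurable_fst)).aestronglyMeasurable
      (ae_of_all _ fun q => ?_)
    rw [norm_mul]
    refine mul_le_mul ((norm_integral_le_integral_norm _).trans
      (setIntegral_le_integral (hdt _).norm (ae_of_all _ fun x => norm_nonneg _)))
      (abs_of_pos (hD.dens_pos _)).le (norm_nonneg _) (integral_nonneg fun _ => norm_nonneg _)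
  have hvanish : ∀ s, s ∉ Ioc (-R) (R + C * R) → ∀ t ∈ Ioi (0 : ℝ),
      φ (D.pos s t, t) * D.speedMax (D.pos s t, t) = 0 := fun s hs t ht => by
    by_contra h
    obtain ⟨⟨h1, h2⟩, h3, h4⟩ := hbφ.support _ (left_ne_zero_of_mul h)
    refine hs ⟨?_, ?_⟩
    · by_contra! h
      simp only at h1 h4
      rw [hD.pos_of_le_neg h3.le (by linarith)] at h1
      exact lt_irrefl _ h1
    · have := hD.le_pos_add hC (s := s) h3.le
      have := mul_le_mul_of_nonneg_left h4 hC0.le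
      simp only at h2 this
      linarith
  have hleft : ∫ s, (∫ t in Ioi (0 : ℝ), φ (D.pos s t, t) * D.speedMax (D.pos s t, t)) *
      D.dens s = ∫ s in Ioc (-R) (R + C * R), ∫ t in Ioi (0 : ℝ),
        (∫ x in Ioi (D.pos s (max t 0)), dt φ x t) * D.dens s := by
    rw [← setIntegral_eq_integral_of_forall_compl_eq_zero (s := Ioc (-R) (R + C * R))
      (fun s hs => by rw [setIntegral_congr_fun measurableSet_Ioi (hvanish s hs)]; simp)]
    refine integral_congr_ae (ae_restrict_of_ae ?_)
    filter_upwards [D.countable_fanLabels.ae_notMem (μ := volume)] with s hs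
    rw [integral_mul_const, hinner s hs]
  -- The label window (-R, R + C R] is chosen once for all times t ≤ R; for later times φ_t
  -- vanishes.
  have hslice : ∀ t ∈ Ioi (0 : ℝ), ∫ x in Ioi (0 : ℝ), dt φ x t * D.m x t =
      (∫ s in Ioc (-R) (R + C * R), (∫ x in Ioi (D.pos s (max t 0)), dt φ x t) * D.dens s) +
        (∫ x in Ioi (0 : ℝ), dt φ x t) * D.mass (-R) := fun t ht => by
    have ht0 : 0 < t := ht
    rcases le_or_gt t R with hle | hlt
    · have hRz : ∀ x, R < x → dt φ x t = 0 := fun x hx => by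
        by_contra h
        exact hx.not_ge (hbt.support (x, t) h).1.2
      have hL := hD.integral_mul_m_sub hC ht0.le hle (hdt t) hRz (S := R + C * R)
        (by nlinarith)
      simp only [mul_sub] at hL
      rw [integral_sub (hD.integrableOn_mul_m ht0.le (hdt t) hRz)
        ((hdt t).integrableOn.mul_const _), integral_mul_const, sub_eq_iff_eq_add] at hL
      rw [hL, max_eq_left ht0.le]
    · have hz : ∀ x, dt φ x t = 0 := fun x => by
        by_contra h
        exact hlt.not_ge (hbt.support (x, t) h).2.2
      simp [hz]
  have hB : Integrable (fun t => (∫ x in Ioi (0 : ℝ), dt φ x t) * D.mass (-R))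
      (volume.restrict (Ioi 0)) := by
    have h1 := hprod.restrict (s := Ioi 0 ×ˢ Ioi 0)
    rw [← Measure.prod_restrict] at h1
    exact h1.integral_prod_left.mul_const _
  rw [hleft, integral_integral_swap hPhi, setIntegral_congr_fun measurableSet_Ioi hslice,
    integral_add hPhi.integral_prod_right hB, integral_mul_const, hzero, zero_mul, add_zero]

end Admissible

end Data
end PressurelessGas

/-! ### Initial condition and boundary condition for u -/

namespace PressurelessGas

/-- Minimizers of `ε P + Q` for small `ε`, where `P` is differentiable and `Q` is quadratic to
leading order. -/
lemma tendsto_minimizer_div {ι : Type*} {l : Filter ι} {a c : ℝ} (hc : 0 < c) {P Q : ℝ → ℝ}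
    (hP : ∀ δ > 0, ∀ᶠ r in 𝓝 (0 : ℝ), |P r - a * r| ≤ δ * |r|)
    (hQ : ∀ δ > 0, ∀ᶠ r in 𝓝 (0 : ℝ), |Q r - c * r ^ 2 / 2| ≤ δ * r ^ 2)
    {ε r : ι → ℝ} (hε : ∀ᶠ i in l, 0 < ε i) (hε0 : Tendsto ε l (𝓝 0)) (hr : Tendsto r l (𝓝 0))
    (hmin : ∀ᶠ i in l, ε i * P (r i) + Q (r i) ≤
      ε i * P (-(a / c) * ε i) + Q (-(a / c) * ε i)) :
    Tendsto (fun i => r i / ε i) l (𝓝 (-(a / c))) := by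
  have hb : Tendsto (fun i => -(a / c) * ε i) l (𝓝 0) := by
    simpa using hε0.const_mul (-(a / c))
  set k := a / c with hk
  have hkc : k * c = a := by rw [hk]; field_simp
  -- The competitor -k ε is the minimizer of the model ε a r + c r² / 2, and the model exceeds its
  -- minimum by c (r + k ε)² / 2. The errors are at most δ times squares of r and ε; with 4 δ ≤ c /
  -- 4 half of the excess absorbs the part with r.
  have hsq : ∀ η > 0, ∀ᶠ i in l, (r i / ε i + k) ^ 2 ≤ η := by
    intro η hη
    obtain ⟨δ, hδ, h1, h2⟩ : ∃ δ > 0, 4 * δ ≤ c / 4 ∧ δ * (1 + 6 * k ^ 2) ≤ c / 4 * η := by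
      refine ⟨min (c / 16) (c / 4 * η / (1 + 6 * k ^ 2)), lt_min (by positivity) (by positivity),
        ?_, ?_⟩
      · linarith [min_le_left (c / 16) (c / 4 * η / (1 + 6 * k ^ 2))]
      · exact (le_div_iff₀ (by positivity)).1 (min_le_right _ _)
    filter_upwards [hε, hmin, hr.eventually (hP δ hδ), hr.eventually (hQ δ hδ),
      hb.eventually (hP δ hδ), hb.eventually (hQ δ hδ)] with i hi hm p1 q1 p2 q2
    have e1 := (abs_le.1 p1).1
    have e2 := (abs_le.1 q1).1
    have e3 := (abs_le.1 p2).2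
    have e4 := (abs_le.1 q2).2
    have f1 : ε i * (a * r i - δ * |r i|) ≤ ε i * P (r i) :=
      mul_le_mul_of_nonneg_left (by linarith) hi.le
    have f2 : ε i * P (-k * ε i) ≤ ε i * (a * (-k * ε i) + δ * |-k * ε i|) :=
      mul_le_mul_of_nonneg_left (by linarith) hi.le
    have g1 : ε i * |r i| ≤ (ε i ^ 2 + r i ^ 2) / 2 := by
      nlinarith [sq_nonneg (ε i - |r i|), sq_abs (r i)]
    have g2 : ε i * |-k * ε i| ≤ (ε i ^ 2 + (-k * ε i) ^ 2) / 2 := by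
      nlinarith [sq_nonneg (ε i - |-k * ε i|), sq_abs (-k * ε i)]
    have g3 := mul_le_mul_of_nonneg_left g1 hδ.le
    have g4 := mul_le_mul_of_nonneg_left g2 hδ.le
    have main : c / 2 * (r i + k * ε i) ^ 2 ≤
        δ * (ε i ^ 2 + 2 * r i ^ 2 + 2 * (k * ε i) ^ 2) := by
      have : c / 2 * (r i + k * ε i) ^ 2 =
          ε i * (a * r i) + c * r i ^ 2 / 2 -
            (ε i * (a * (-k * ε i)) + c * (-k * ε i) ^ 2 / 2) := by
        rw [← hkc]; ring
      rw [this]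
      linarith [mul_nonneg hδ.le (sq_nonneg (r i)), mul_nonneg hδ.le (sq_nonneg (k * ε i))]
    have h3 : r i ^ 2 ≤ 2 * (r i + k * ε i) ^ 2 + 2 * (k * ε i) ^ 2 := by
      nlinarith [sq_nonneg (r i + 2 * (k * ε i))]
    have h4 : c / 4 * (r i + k * ε i) ^ 2 ≤ c / 4 * η * ε i ^ 2 := by
      have h5 := mul_le_mul_of_nonneg_left h3 hδ.le
      have h6 := mul_le_mul_of_nonneg_right h1 (sq_nonneg (r i + k * ε i))
      have h7 := mul_le_mul_of_nonneg_right h2 (sq_nonneg (ε i))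
      linarith
    have h8 : (r i + k * ε i) ^ 2 ≤ η * ε i ^ 2 := by
      have : 0 < c / 4 := by positivity
      rw [mul_assoc] at h4
      exact le_of_mul_le_mul_left h4 this
    have h9 : r i / ε i + k = (r i + k * ε i) / ε i := by field_simp
    rw [h9, div_pow, div_le_iff₀ (by positivity)]
    exact h8
  rw [Metric.tendsto_nhds]
  intro η hη
  filter_upwards [hsq ((η / 2) ^ 2) (by positivity)] with i hi
  rw [Real.dist_eq, sub_neg_eq_add]
  have := abs_le_of_sq_le_sq' hi (by positivity)
  rw [abs_lt]; constructor <;> linarith [this.1, this.2]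

/-- The first moment of an integrable function near a point of differentiability. -/
lemma first_moment_quadratic {w : ℝ → ℝ} (hw : ∀ a b : ℝ, IntervalIntegrable w volume a b)
    {x b : ℝ} (hb : HasDerivAt (fun s => ∫ η in (0 : ℝ)..s, w η) b x) {δ : ℝ} (hδ : 0 < δ) :
    ∀ᶠ r in 𝓝 (0 : ℝ), |(∫ η in x..(x + r), (η - x) * w η) - b * r ^ 2 / 2| ≤ δ * r ^ 2 := by
  set W : ℝ → ℝ := fun s => ∫ η in x..s, w η with hW
  have hWd : HasDerivAt W b x := by
    have h1 : W = fun s => (∫ η in (0 : ℝ)..s, w η) - ∫ η in (0 : ℝ)..x, w η := by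
      ext s
      exact (intervalIntegral.integral_interval_sub_left (hw _ _) (hw _ _)).symm
    rw [h1]
    exact hb.sub_const _
  have hW0 : W x = 0 := by simp [hW]
  have hWc : Continuous W := intervalIntegral.continuous_primitive hw x
  have hlo := hWd.isLittleO.def (half_pos hδ)
  simp only [hW0, sub_zero, smul_eq_mul, Real.norm_eq_abs] at hlo
  obtain ⟨ρ, hρ, hball⟩ := Metric.eventually_nhds_iff.1 hlo
  filter_upwards [Metric.ball_mem_nhds (0 : ℝ) hρ] with r hr
  have hr' : |r| < ρ := by simpa using hr
  -- Integration by parts replaces w, known only through its primitive W, by W, which is b (η - x)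
  -- up to a small relative error.
  have hparts : ∫ η in x..(x + r), (η - x) * w η = r * W (x + r) - ∫ η in x..(x + r), W η := by
    have hAC := (hw x (x + r)).absolutelyContinuousOnInterval_intervalIntegral (c := x) (by simp)
    have hid : AbsolutelyContinuousOnInterval (fun η : ℝ => η - x) x (x + r) :=
      ((LipschitzWith.id.sub (LipschitzWith.const x)).lipschitzOnWith
        (s := uIcc x (x + r))).absolutelyContinuousOnInterval
    have h := hid.integral_mul_deriv_eq_deriv_mul hAC
    have h1 : ∫ η in x..(x + r), (η - x) * deriv (fun s => ∫ η in x..s, w η) η =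
        ∫ η in x..(x + r), (η - x) * w η := by
      refine intervalIntegral.integral_congr_ae ?_
      filter_upwards [(hw x (x + r)).ae_hasDerivAt_integral] with η h1 h2
      rw [(h1 (uIoc_subset_uIcc h2) x (by simp)).deriv]
    rw [h1] at h
    rw [h]
    simp [hW]
  have hbd : ∀ η ∈ uIoc x (x + r), ‖W η - (η - x) * b‖ ≤ δ / 2 * |r| := fun η hη => by
    have h1 : |η - x| ≤ |r| := by
      have := abs_sub_left_of_mem_uIcc (uIoc_subset_uIcc hη)
      simpa using this
    refine (hball (y := η) (by rw [Real.dist_eq]; exact h1.trans_lt hr')).trans ?_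
    exact mul_le_mul_of_nonneg_left h1 (by positivity)
  have h2 := intervalIntegral.norm_integral_le_of_norm_le_const hbd
  have hI : ∫ η in x..(x + r), (η - x) * b = b * r ^ 2 / 2 := by
    rw [intervalIntegral.integral_mul_const, intervalIntegral.integral_comp_sub_right (fun y => y)]
    simp
    ring
  rw [intervalIntegral.integral_sub (hWc.intervalIntegrable _ _)
    ((by fun_prop : Continuous fun η : ℝ => (η - x) * b).intervalIntegrable _ _), hI] at h2
  simp only [add_sub_cancel_left, Real.norm_eq_abs] at h2
  have h3 := hball (y := x + r) (by simpa [Real.dist_eq] using hr')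
  simp only [add_sub_cancel_left] at h3
  rw [hparts]
  have h4 : r * W (x + r) - (∫ η in x..(x + r), W η) - b * r ^ 2 / 2 =
      r * (W (x + r) - r * b) - ((∫ η in x..(x + r), W η) - b * r ^ 2 / 2) := by ring
  rw [h4]
  refine (abs_sub _ _).trans ?_
  rw [abs_mul]
  have h5 := mul_le_mul_of_nonneg_left h3 (abs_nonneg r)
  have h6 : |r| * |r| = r ^ 2 := by rw [← sq, sq_abs]
  nlinarith

lemma eventually_abs_sub_le_of_hasDerivAt {f : ℝ → ℝ} {a x : ℝ} (hf : HasDerivAt f a x) {δ : ℝ}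
    (hδ : 0 < δ) : ∀ᶠ r in 𝓝 (0 : ℝ), |f (x + r) - f x - a * r| ≤ δ * |r| := by
  have h : Tendsto (fun r : ℝ => x + r) (𝓝 0) (𝓝 x) := by
    have := (by fun_prop : Continuous fun r : ℝ => x + r).tendsto 0
    rwa [add_zero] at this
  filter_upwards [h.eventually (hf.isLittleO.def hδ)] with r hr
  simpa [mul_comm] using hr

namespace Data

variable {D : Data} {C : ℝ} {I : Set ℝ} {x t x' t' s s' c T R S B a b : ℝ} {g φ : ℝ × ℝ → ℝ}

namespace Admissible

lemma ener_sub_of_nonneg (hD : D.Admissible) (ha : 0 ≤ a) (hb : 0 ≤ b) :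
    D.ener b - D.ener a = ∫ s in a..b, s * D.dens s := by
  rw [hD.ener_sub]
  refine intervalIntegral.integral_congr fun s hs => ?_
  have : 0 ≤ s := (le_min ha hb).trans hs.1
  simp [arm, this]

lemma ener_sub_of_nonpos (hD : D.Admissible) (ha : a ≤ 0) (hb : b ≤ 0) :
    D.ener b - D.ener a = ∫ s in a..b, s * (D.vel s * D.dens s) := by
  rw [hD.ener_sub]
  refine intervalIntegral.integral_congr fun s hs => ?_
  rcases (hs.2.trans (max_le ha hb)).eq_or_lt with h | h
  · simp [arm, h]
  · simp [arm, h.not_ge]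

/-- The mean of the label with respect to the mass lies between a and b; on the negative side the
weight is the momentum, which is positive there. -/
lemma ener_bounds_of_nonneg (hD : D.Admissible) (ha : 0 ≤ a) (hab : a ≤ b) :
    a * (D.mass b - D.mass a) ≤ D.ener b - D.ener a ∧
      D.ener b - D.ener a ≤ b * (D.mass b - D.mass a) := by
  have hi : IntervalIntegrable (fun s => s * D.dens s) volume a b :=
    (hD.dens_intervalIntegrable a b).continuousOn_mul continuousOn_id
  rw [hD.ener_sub_of_nonneg ha (ha.trans hab), hD.mass_sub,
    ← intervalIntegral.integral_const_mul, ← intervalIntegral.integral_const_mul]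
  exact ⟨intervalIntegral.integral_mono_on hab ((hD.dens_intervalIntegrable a b).const_mul a) hi
      fun s hs => mul_le_mul_of_nonneg_right hs.1 (hD.dens_pos s).le,
    intervalIntegral.integral_mono_on hab hi ((hD.dens_intervalIntegrable a b).const_mul b)
      fun s hs => mul_le_mul_of_nonneg_right hs.2 (hD.dens_pos s).le⟩

lemma ener_bounds_of_neg (hD : D.Admissible) (hb : b < 0) (hab : a ≤ b) :
    a * (D.mom b - D.mom a) ≤ D.ener b - D.ener a ∧
      D.ener b - D.ener a ≤ b * (D.mom b - D.mom a) := by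
  have hv := hD.vel_mul_dens_intervalIntegrable a b
  have hi : IntervalIntegrable (fun s => s * (D.vel s * D.dens s)) volume a b :=
    hv.continuousOn_mul continuousOn_id
  have hp : ∀ s ∈ Icc a b, 0 ≤ D.vel s * D.dens s := fun s hs =>
    mul_nonneg (hD.vel_pos_of_neg (hs.2.trans_lt hb)).le (hD.dens_pos s).le
  rw [hD.ener_sub_of_nonpos (hab.trans hb.le) hb.le, hD.mom_sub,
    ← intervalIntegral.integral_const_mul, ← intervalIntegral.integral_const_mul]
  exact ⟨intervalIntegral.integral_mono_on hab (hv.const_mul a) hi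
      fun s hs => mul_le_mul_of_nonneg_right hs.1 (hp s hs),
    intervalIntegral.integral_mono_on hab hi (hv.const_mul b)
      fun s hs => mul_le_mul_of_nonneg_right hs.2 (hp s hs)⟩

lemma pot_lo_eq_pot_hi (hD : D.Admissible) (hx : 0 ≤ x) (ht : 0 ≤ t) :
    D.pot (D.lo univ x t) x t = D.pot (D.hi univ x t) x t :=
  le_antisymm ((hD.lo_mem .univ hx ht).2 _ (mem_univ _)) ((hD.hi_mem .univ hx ht).2 _ (mem_univ _))

/-- `u` lies between the velocities of the outermost initial particles. -/
lemma u_bounds_of_nonneg (hD : D.Admissible) (hx : 0 < x) (ht : 0 < t) (h : 0 ≤ D.lo univ x t) :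
    (x - D.hi univ x t) / t ≤ D.u x t ∧ D.u x t ≤ (x - D.lo univ x t) / t := by
  rw [hD.u_eq hx ht]
  have hle := hD.lo_le_hi .univ hx.le ht.le
  have hpot := hD.pot_lo_eq_pot_hi hx.le ht.le
  unfold speed
  split_ifs with h1
  · exact ⟨by rw [h1], le_rfl⟩
  · have hm := sub_pos.2 (hD.strictMono_mass (lt_of_le_of_ne hle h1))
    -- Equal potentials at `lo` and `hi` mean t Δmom = x Δmass - Δener, so bounds on Δener / Δmass
    -- become bounds on the mean velocity.
    obtain ⟨e1, e2⟩ := hD.ener_bounds_of_nonneg h hle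
    unfold pot at hpot
    rw [div_le_div_iff₀ ht hm, div_le_div_iff₀ hm ht]
    constructor <;> nlinarith

/-- `u` lies between the velocities of the outermost boundary particles. -/
lemma u_bounds_of_neg (hD : D.Admissible) (hx : 0 < x) (ht : 0 < t) (h : D.hi univ x t < 0) :
    0 < t + D.lo univ x t ∧ x / (t + D.hi univ x t) ≤ D.u x t ∧
      D.u x t ≤ x / (t + D.lo univ x t) := by
  obtain ⟨C, hC0, hC⟩ := hD.exists_speed_bound
  have hle := hD.lo_le_hi .univ hx.le ht.le
  have hpot := hD.pot_lo_eq_pot_hi hx.le ht.le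
  have h0 : 0 < t + D.lo univ x t := by
    have := hD.le_of_mem_argmin_of_neg hC hx.le .univ (hD.lo_mem .univ hx.le ht.le)
      (hle.trans_lt h)
    by_contra! h
    nlinarith
  refine ⟨h0, ?_⟩
  rw [hD.u_eq hx ht]
  unfold speed
  split_ifs with h1 h2
  · linarith
  · exact ⟨by rw [h1], le_rfl⟩
  · have hm := sub_pos.2 (hD.strictMono_mass (lt_of_le_of_ne hle h1))
    -- Here Δener lies between the endpoints times Δmom, so x Δmass = t Δmom + Δener lies between (t
    -- + lo) Δmom and (t + hi) Δmom.
    obtain ⟨e1, e2⟩ := hD.ener_bounds_of_neg h hle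
    unfold pot at hpot
    rw [div_le_div_iff₀ (by linarith) hm, div_le_div_iff₀ hm h0]
    constructor <;> nlinarith

/-- For s = x + r the potential is, up to a constant, t P(r) + Q(r), where P is the increment of
`mom`, with slope vel dens, and Q is the first moment of the density about x, close to dens r² / 2.
So r is close to -t vel(x). -/
lemma tendsto_argmin_initial (hD : D.Admissible) (hx : 0 < x)
    (h1 : HasDerivAt D.mass (D.dens x) x) (h2 : HasDerivAt D.mom (D.vel x * D.dens x) x)
    {σ : ℝ → ℝ} (hσ : ∀ t, 0 < t → σ t ∈ D.argmin univ x t) :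
    Tendsto σ (𝓝[>] 0) (𝓝 x) ∧ Tendsto (fun t => (x - σ t) / t) (𝓝[>] 0) (𝓝 (D.vel x)) := by
  obtain ⟨C, hC0, hC⟩ := hD.exists_speed_bound
  have hid : Tendsto (fun t : ℝ => t) (𝓝[>] 0) (𝓝 0) := nhdsWithin_le_nhds
  have hsmall : ∀ᶠ t in 𝓝[>] (0 : ℝ), 0 < t ∧ C * t ≤ x := by
    filter_upwards [Ioo_mem_nhdsGT (div_pos hx hC0)] with t ht
    exact ⟨ht.1, by rw [mul_comm]; exact ((lt_div_iff₀ hC0).1 ht.2).le⟩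
  have hlim : Tendsto σ (𝓝[>] 0) (𝓝 x) := by
    have hl : Tendsto (fun t : ℝ => x - C * t) (𝓝[>] 0) (𝓝 x) := by
      simpa using (hid.const_mul C).const_sub x
    have hu : Tendsto (fun t : ℝ => x + C * t) (𝓝[>] 0) (𝓝 x) := by
      simpa using (hid.const_mul C).const_add x
    refine tendsto_of_tendsto_of_tendsto_of_le_of_le' hl hu ?_ ?_
    · filter_upwards [hsmall] with t ht using
        hD.le_of_mem_argmin hC hx.le ht.1.le .univ (subset_univ _) ht.2 (hσ t ht.1)
    · filter_upwards [hsmall] with t ht using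
        (hD.argmin_subset_Icc hC .univ hx.le ht.1.le (hσ t ht.1)).2
  refine ⟨hlim, ?_⟩
  have key := tendsto_minimizer_div (l := 𝓝[>] (0 : ℝ)) (ε := fun t => t)
    (r := fun t => σ t - x) (hD.dens_pos x)
    (P := fun r => D.mom (x + r) - D.mom x)
    (Q := fun r => D.ener (x + r) - D.ener x - x * (D.mass (x + r) - D.mass x))
    (fun δ hδ => eventually_abs_sub_le_of_hasDerivAt h2 hδ) (fun δ hδ => ?_)
    (by filter_upwards [self_mem_nhdsWithin] with t ht using ht) hid
    (by simpa using hlim.sub_const x) ?_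
  · rw [mul_div_assoc, div_self (hD.dens_pos x).ne', mul_one] at key
    refine (neg_neg (D.vel x) ▸ key.neg).congr fun t => ?_
    rw [← neg_div, neg_sub]
  · filter_upwards [first_moment_quadratic hD.dens_intervalIntegrable h1 hδ,
      lt_mem_nhds (neg_lt_zero.2 hx)] with r hr hr0
    convert hr using 3
    rw [hD.ener_sub_of_nonneg hx.le (by linarith), hD.mass_sub,
      ← intervalIntegral.integral_const_mul, ← intervalIntegral.integral_sub
      ((hD.dens_intervalIntegrable _ _).continuousOn_mul (g := fun s => s) continuousOn_id)
      ((hD.dens_intervalIntegrable _ _).const_mul _)]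
    simp only [sub_mul]
  · filter_upwards [self_mem_nhdsWithin] with t ht
    have := (hσ t ht).2 (x + -(D.vel x * D.dens x / D.dens x) * t) (mem_univ _)
    unfold pot at this
    rw [add_sub_cancel]
    linarith

/-- The initial conditions. -/
lemma ae_initial (hD : D.Admissible) :
    ∀ᵐ x ∂(volume.restrict (Ioi (0 : ℝ))),
      Tendsto (fun t => D.u x t) (𝓝[>] 0) (𝓝 (D.u₀ x)) ∧
      Tendsto (fun t => D.m x t) (𝓝[>] 0) (𝓝 (∫ y in (0 : ℝ)..x, D.ρ₀ y)) := by
  obtain ⟨C, hC0, hC⟩ := hD.exists_speed_bound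
  filter_upwards [ae_restrict_of_ae hD.ae_hasDerivAt_pot, ae_restrict_mem measurableSet_Ioi]
    with x ⟨h1, h2, _⟩ hx
  have hx0 : 0 < x := hx
  constructor
  · obtain ⟨hlo, hlo'⟩ := hD.tendsto_argmin_initial hx h1 h2
      (fun t ht => hD.lo_mem .univ hx0.le (le_of_lt ht))
    obtain ⟨hhi, hhi'⟩ := hD.tendsto_argmin_initial hx h1 h2
      (fun t ht => hD.hi_mem .univ hx0.le (le_of_lt ht))
    rw [← vel_of_pos hx0]
    refine tendsto_of_tendsto_of_tendsto_of_le_of_le' hhi' hlo' ?_ ?_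
    · filter_upwards [hlo.eventually (lt_mem_nhds hx0), self_mem_nhdsWithin] with t h ht
      exact (hD.u_bounds_of_nonneg hx0 ht (le_of_lt h)).1
    · filter_upwards [hlo.eventually (lt_mem_nhds hx0), self_mem_nhdsWithin] with t h ht
      exact (hD.u_bounds_of_nonneg hx0 ht (le_of_lt h)).2
  · obtain ⟨hl, -⟩ := hD.tendsto_argmin_initial hx h1 h2
      (fun t ht => hD.label_mem hx0.le (le_of_lt ht))
    rw [← mass_of_nonneg hx0.le]
    refine ((hD.continuous_mass.tendsto x).comp hl).congr' ?_
    filter_upwards [self_mem_nhdsWithin] with t ht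
    exact (hD.m_eq hx0 (le_of_lt ht)).symm

lemma hi_zero_eq (hD : D.Admissible) (ht : 0 ≤ t) (h : D.G 0 t < D.F 0 t) :
    D.hi univ 0 t = -t := by
  have h1 := hD.hi_mem .univ le_rfl ht
  rw [hD.argmin_univ_of_G_lt le_rfl ht h] at h1
  exact hD.argmin_Iic_zero ht h1

lemma tendsto_prodMk_quarter (ht : 0 ≤ t) :
    Tendsto (fun x : ℝ => (x, t)) (𝓝[>] 0) (𝓝[quarter] (0, t)) := by
  refine tendsto_nhdsWithin_iff.2 ⟨?_, ?_⟩
  · exact ((by fun_prop : Continuous fun x : ℝ => (x, t)).tendsto _).mono_left nhdsWithin_le_nhds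
  · filter_upwards [self_mem_nhdsWithin] with x hx using ⟨le_of_lt hx, ht⟩

/-- Near an inflow point of the boundary all minimizers are close to the label `-t`. -/
lemma tendsto_argmin_boundary (hD : D.Admissible) (ht : 0 ≤ t) (h : D.G 0 t < D.F 0 t)
    {σ : ℝ → ℝ} (hσ : ∀ x, 0 < x → σ x ∈ D.argmin univ x t) :
    Tendsto σ (𝓝[>] 0) (𝓝 (-t)) := by
  obtain ⟨C, hC0, hC⟩ := hD.exists_speed_bound
  refine tendsto_order.2 ⟨fun c hc => ?_, fun c hc => ?_⟩
  · filter_upwards [self_mem_nhdsWithin] with x hx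
    exact hc.trans_le (hD.argmin_subset_Icc hC .univ (le_of_lt hx) ht (hσ x hx)).1
  · rw [← hD.hi_zero_eq ht h] at hc
    filter_upwards [(tendsto_prodMk_quarter ht).eventually (hD.eventually_hi_lt .univ hc),
      self_mem_nhdsWithin] with x h1 hx
    exact (hD.le_hi .univ (le_of_lt hx) ht (hσ x hx)).trans_lt h1

/-- The roles change: x is the small parameter, P is minus the increment of `mass`, and Q is the
first moment of vel dens about -t. For s = -t + r this gives r close to x / ub(t). -/
lemma tendsto_div_argmin_boundary (hD : D.Admissible) (ht : 0 < t) (h : D.G 0 t < D.F 0 t)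
    (h1 : HasDerivAt D.mass (D.dens (-t)) (-t))
    (h2 : HasDerivAt D.mom (D.vel (-t) * D.dens (-t)) (-t))
    {σ : ℝ → ℝ} (hσ : ∀ x, 0 < x → σ x ∈ D.argmin univ x t) :
    Tendsto (fun x => x / (t + σ x)) (𝓝[>] 0) (𝓝 (D.ub t)) := by
  have hid : Tendsto (fun t : ℝ => t) (𝓝[>] 0) (𝓝 0) := nhdsWithin_le_nhds
  have hlim := hD.tendsto_argmin_boundary ht.le h hσ
  have hv : 0 < D.vel (-t) := hD.vel_pos_of_neg (neg_lt_zero.2 ht)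
  have hd := hD.dens_pos (-t)
  have key := tendsto_minimizer_div (l := 𝓝[>] (0 : ℝ)) (ε := fun x => x)
    (r := fun x => σ x - -t) (a := -D.dens (-t)) (mul_pos hv hd)
    (P := fun r => -D.mass (-t + r) - -D.mass (-t))
    (Q := fun r => D.ener (-t + r) - D.ener (-t) + t * (D.mom (-t + r) - D.mom (-t)))
    (fun δ hδ => eventually_abs_sub_le_of_hasDerivAt h1.neg hδ) (fun δ hδ => ?_)
    (by filter_upwards [self_mem_nhdsWithin] with t ht using ht) hid
    (by simpa using hlim.sub_const (-t)) ?_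
  · have e : -(-D.dens (-t) / (D.vel (-t) * D.dens (-t))) = (D.ub t)⁻¹ := by
      rw [vel_of_neg (neg_lt_zero.2 ht), neg_neg] at hv ⊢
      field_simp
    rw [e] at key
    have := key.inv₀ (inv_ne_zero (hD.ub_pos t ht).ne')
    rw [inv_inv] at this
    refine this.congr fun x => ?_
    rw [inv_div, sub_neg_eq_add, add_comm]
  · filter_upwards [first_moment_quadratic hD.vel_mul_dens_intervalIntegrable h2 hδ,
      gt_mem_nhds ht] with r hr hr0
    convert hr using 3
    rw [hD.ener_sub_of_nonpos (by linarith) (by linarith), hD.mom_sub,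
      ← intervalIntegral.integral_const_mul, ← intervalIntegral.integral_add
      ((hD.vel_mul_dens_intervalIntegrable _ _).continuousOn_mul (g := fun s => s)
        continuousOn_id)
      ((hD.vel_mul_dens_intervalIntegrable _ _).const_mul _)]
    refine intervalIntegral.integral_congr fun η _ => ?_
    ring
  · filter_upwards [self_mem_nhdsWithin] with x hx
    have := (hσ x hx).2
      (-t + -(-D.dens (-t) / (D.vel (-t) * D.dens (-t))) * x) (mem_univ _)
    unfold pot at this
    rw [add_sub_cancel]
    linarith

/-- The boundary condition for the velocity. -/
lemma ae_boundary (hD : D.Admissible) :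
    ∀ᵐ t ∂(volume.restrict (Ioi (0 : ℝ))), D.G 0 t < D.F 0 t →
      Tendsto (fun x => D.u x t) (𝓝[>] 0) (𝓝 (D.ub t)) := by
  -- The primitives are differentiable at almost every label s; reflection turns this into almost
  -- every time t = -s.
  have hae := (Measure.measurePreserving_neg (volume : Measure ℝ)).quasiMeasurePreserving.ae
    hD.ae_hasDerivAt_pot
  filter_upwards [ae_restrict_of_ae hae, ae_restrict_mem measurableSet_Ioi]
    with t ⟨h1, h2, _⟩ ht h
  have ht0 : 0 < t := ht
  have hmem_hi : ∀ x, 0 < x → D.hi univ x t ∈ D.argmin univ x t := fun x hx =>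
    hD.hi_mem .univ hx.le ht0.le
  have hlo := hD.tendsto_div_argmin_boundary ht0 h h1 h2
    (fun x hx => hD.lo_mem .univ (le_of_lt hx) ht0.le)
  have hhi := hD.tendsto_div_argmin_boundary ht0 h h1 h2 hmem_hi
  have hneg := (hD.tendsto_argmin_boundary ht0.le h hmem_hi).eventually
    (gt_mem_nhds (neg_lt_zero.2 ht0))
  refine tendsto_of_tendsto_of_tendsto_of_le_of_le' hhi hlo ?_ ?_
  · filter_upwards [hneg, self_mem_nhdsWithin] with x h hx
    exact (hD.u_bounds_of_neg hx ht0 h).2.1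
  · filter_upwards [hneg, self_mem_nhdsWithin] with x h hx
    exact (hD.u_bounds_of_neg hx ht0 h).2.2

end Admissible

end Data
end PressurelessGas

/-! ### Boundary condition for the momentum -/

namespace PressurelessGas

lemma continuousAt_deriv_of_contDiffAt {k : ℝ → ℝ} {a : ℝ} (hk : ContDiffAt ℝ 1 k a) :
    ContinuousAt (deriv k) a := by
  have h : deriv k = fun s => fderiv ℝ k s 1 := funext fun s => fderiv_apply_one_eq_deriv.symm
  rw [h]
  exact ((hk.fderiv_right (m := 0) (by simp)).continuousAt).clm_apply continuousAt_const

/-- A local inverse of a `C¹` function on the line with positive derivative. -/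
lemma exists_local_inverse_of_deriv_pos {k : ℝ → ℝ} {a : ℝ} (hk : ContDiffAt ℝ 1 k a)
    (hpos : 0 < deriv k a) :
    ∃ Λ : ℝ → ℝ, (∀ᶠ s in 𝓝 a, Λ (k s) = s) ∧
      ∀ᶠ y in 𝓝 (k a), HasDerivAt Λ (deriv k (Λ y))⁻¹ y ∧ 0 < deriv k (Λ y) := by
  have hst : ∀ᶠ s in 𝓝 a, HasStrictDerivAt k (deriv k s) s :=
    (hk.eventually (by simp)).mono fun s hs => hs.hasStrictDerivAt (by simp)
  have hc : ContinuousAt (deriv k) a := continuousAt_deriv_of_contDiffAt hk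
  have h0 := hst.self_of_nhds
  have hl := h0.eventually_left_inverse hpos.ne'
  have hr := h0.eventually_right_inverse hpos.ne'
  have hlim : Tendsto (h0.localInverse k _ a hpos.ne') (𝓝 (k a)) (𝓝 a) := by
    have := (h0.to_localInverse hpos.ne').hasDerivAt.continuousAt.tendsto
    rwa [hl.self_of_nhds] at this
  refine ⟨h0.localInverse k _ a hpos.ne', hl, ?_⟩
  -- The inverse function theorem at a gives the derivative at k(a) only. At nearby y it is applied
  -- again at Λ(y), where the same Λ is still a left inverse on a neighbourhood.
  filter_upwards [hr, hlim.eventually hst, hlim.eventually (hc.eventually (lt_mem_nhds hpos)),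
    hlim.eventually (eventually_eventually_nhds.2 hl)] with y h1 h2 h3 h4
  refine ⟨?_, h3⟩
  have := (h2.to_local_left_inverse h3.ne' h4).hasDerivAt
  rwa [h1] at this

/-- A measure on a half open interval with given values on initial segments. -/
lemma restrict_Ioc_eq_withDensity {μ : Measure ℝ} {r : ℝ → ℝ} {ε : ℝ}
    (hr : IntegrableOn r (Ioc 0 ε)) (h0 : ∀ x ∈ Ioc 0 ε, 0 ≤ r x)
    (h : ∀ a ∈ Icc 0 ε, μ (Ioc 0 a) = ENNReal.ofReal (∫ x in (0 : ℝ)..a, r x)) :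
    μ.restrict (Ioc 0 ε) =
      (volume.restrict (Ioc 0 ε)).withDensity fun x => ENNReal.ofReal (r x) := by
  rcases lt_or_ge ε 0 with hε | hε
  · simp [Ioc_eq_empty hε.not_gt]
  have : IsFiniteMeasure (μ.restrict (Ioc 0 ε)) := ⟨by
    rw [Measure.restrict_apply_univ, h ε ⟨hε, le_rfl⟩]
    exact ENNReal.ofReal_lt_top⟩
  refine Measure.ext_of_Iic _ _ fun a => ?_
  have e : Iic a ∩ Ioc 0 ε = Ioc 0 (max 0 (min a ε)) := by
    ext x
    simp only [mem_inter_iff, mem_Iic, mem_Ioc, le_max_iff, le_min_iff]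
    constructor
    · rintro ⟨h1, h2, h3⟩; exact ⟨h2, Or.inr ⟨h1, h3⟩⟩
    · rintro ⟨h1, h2 | h2⟩
      · linarith
      · exact ⟨h2.1, h1, h2.2⟩
  have hb : max 0 (min a ε) ≤ ε := max_le hε (min_le_right _ _)
  have hsub : Ioc 0 (max 0 (min a ε)) ⊆ Ioc 0 ε := Ioc_subset_Ioc_right hb
  rw [Measure.restrict_apply measurableSet_Iic, e, h _ ⟨le_max_left _ _, hb⟩,
    withDensity_apply _ measurableSet_Iic, Measure.restrict_restrict measurableSet_Iic, e,
    intervalIntegral.integral_of_le (le_max_left _ _),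
    ofReal_integral_eq_lintegral_ofReal (hr.mono_set hsub)]
  filter_upwards [ae_restrict_mem measurableSet_Ioc] with x hx using h0 x (hsub hx)

namespace Data

variable {D : Data} {C : ℝ} {x t s : ℝ}

namespace Admissible

lemma hasDerivAt_pot (hD : D.Admissible) (h : ContinuousAt (D.kern x t) s) :
    HasDerivAt (fun σ => D.pot σ x t) (D.kern x t s) s := by
  have hm : Measurable (D.kern x t) :=
    (((hD.measurable_vel.mul hD.measurable_dens).const_mul t).sub
      (hD.measurable_dens.const_mul x)).add hD.measurable_arm
  have := intervalIntegral.integral_hasDerivAt_right (hD.kern_intervalIntegrable x t 0 s)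
    hm.stronglyMeasurable.stronglyMeasurableAtFilter h
  refine this.congr_of_eventuallyEq (Eventually.of_forall fun σ => ?_)
  simp only
  rw [← hD.pot_sub, pot_zero, sub_zero]

lemma hasDerivAt_mass (hD : D.Admissible) (h : ContinuousAt D.dens s) :
    HasDerivAt D.mass (D.dens s) s :=
  intervalIntegral.integral_hasDerivAt_right (hD.dens_intervalIntegrable 0 s)
    hD.measurable_dens.stronglyMeasurable.stronglyMeasurableAtFilter h

/-- A minimizing label reaches the point by its free flight. -/
lemma flight_eq_of_mem_argmin (hD : D.Admissible) (hv : ContinuousAt D.vel s)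
    (hd : ContinuousAt D.dens s) (hs : s < 0) (h : s ∈ D.argmin univ x t) :
    (t + s) * D.vel s = x := by
  have e : D.kern x t =ᶠ[𝓝 s] fun σ => ((t + σ) * D.vel σ - x) * D.dens σ := by
    filter_upwards [gt_mem_nhds hs] with σ hσ using kern_of_nonpos hσ.le
  have hc : ContinuousAt (D.kern x t) s := by
    refine ContinuousAt.congr ?_ e.symm
    exact (((continuousAt_const.add continuousAt_id).mul hv).sub continuousAt_const).mul hd
  have hmin : IsLocalMin (fun σ => D.pot σ x t) s :=
    Eventually.of_forall fun σ => h.2 σ (mem_univ _)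
  have h0 := hmin.hasDerivAt_eq_zero (hD.hasDerivAt_pot hc)
  rw [kern_of_nonpos hs.le] at h0
  exact sub_eq_zero.1 ((mul_eq_zero.1 h0).resolve_right (hD.dens_pos s).ne')

lemma massAt_Ioc_zero (hD : D.Admissible) (ht : 0 ≤ t) (h : D.G 0 t < D.F 0 t) (hx : 0 ≤ x) :
    D.massAt t (Ioc 0 x) = ENNReal.ofReal (D.mass (D.hi univ x t) - D.mass (-t)) := by
  have h0 : D.massAt t (Iic 0) = 0 := by
    rw [hD.massAt_Iic ht le_rfl, hD.hi_zero_eq ht h, sub_self, ENNReal.ofReal_zero]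
  rw [← hD.massAt_Iic ht hx, ← Iic_union_Ioc_eq_Iic hx,
    measure_union (Iic_disjoint_Ioc le_rfl) measurableSet_Ioc, h0, zero_add]

lemma contDiffOn_vel (hub : ContDiffOn ℝ 1 D.ub (Ioi 0)) : ContDiffOn ℝ 1 D.vel (Iio 0) := by
  refine (hub.comp contDiff_neg.contDiffOn fun s (hs : s < 0) => neg_pos.2 hs).congr
    fun s hs => vel_of_neg hs

lemma continuousOn_dens (hub : ContinuousOn D.ub (Ioi 0)) (hρ : ContinuousOn D.ρb (Ioi 0)) :
    ContinuousOn D.dens (Iio 0) := by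
  refine ((hρ.mul hub).comp continuous_neg.continuousOn fun s (hs : s < 0) => neg_pos.2 hs).congr
    fun s hs => dens_of_neg hs

/-- The boundary condition for the momentum. -/
lemma exists_density_near_boundary (hD : D.Admissible) (hub : ContDiffOn ℝ 1 D.ub (Ioi 0))
    (hρ : ContinuousOn D.ρb (Ioi 0)) (ht : 0 < t) (h : D.G 0 t < D.F 0 t) :
    ∃ ε : ℝ, 0 < ε ∧ ∃ r : ℝ → ℝ,
      ContinuousOn r (Ioo 0 ε) ∧
      (∀ x ∈ Ioo 0 ε, 0 ≤ r x ∧ HasDerivAt (fun z => D.m z t) (r x) x) ∧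
      (D.massAt t).restrict (Ioo 0 ε) =
        (volume.restrict (Ioo 0 ε)).withDensity (fun x => ENNReal.ofReal (r x)) ∧
      Tendsto (fun x => r x * D.u x t) (𝓝[>] 0) (𝓝 (D.ρb t * D.ub t)) := by
  have hnt : -t < 0 := neg_lt_zero.2 ht
  have hvC : ∀ s < 0, ContDiffAt ℝ 1 D.vel s := fun s hs =>
    (contDiffOn_vel hub).contDiffAt (Iio_mem_nhds hs)
  have hdC : ∀ s < 0, ContinuousAt D.dens s := fun s hs =>
    (continuousOn_dens hub.continuousOn hρ).continuousAt (Iio_mem_nhds hs)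
  -- The free flight position at time t. At s = -t its derivative is vel(-t) > 0, since the factor t
  -- + s vanishes, so it can be inverted there.
  set k : ℝ → ℝ := fun s => (t + s) * D.vel s with hkdef
  have hkC : ∀ s < 0, ContDiffAt ℝ 1 k s := fun s hs =>
    (contDiffAt_const.add contDiffAt_id).mul (hvC s hs)
  have hk0 : k (-t) = 0 := by simp [hkdef]
  have hk' : deriv k (-t) = D.vel (-t) := by
    have h1 : HasDerivAt (fun s : ℝ => t + s) 1 (-t) := (hasDerivAt_id _).const_add t
    have h2 := ((hvC (-t) hnt).differentiableAt (by simp)).hasDerivAt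
    have h3 : HasDerivAt k (1 * D.vel (-t) + (t + -t) * deriv D.vel (-t)) (-t) := h1.mul h2
    rw [h3.deriv]
    ring
  have hpos : 0 < deriv k (-t) := hk' ▸ hD.vel_pos_of_neg hnt
  obtain ⟨Λ, hΛk, hΛ⟩ := exists_local_inverse_of_deriv_pos (hkC _ hnt) hpos
  rw [hk0] at hΛ
  have hΛ0 : Λ 0 = -t := hk0 ▸ hΛk.self_of_nhds
  have hΛc : Tendsto Λ (𝓝 0) (𝓝 (-t)) := hΛ0 ▸ hΛ.self_of_nhds.1.continuousAt.tendsto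
  have hΛneg : ∀ᶠ y in 𝓝 0, Λ y < 0 := hΛc.eventually (gt_mem_nhds hnt)
  -- All minimizers are squeezed to -t as x tends to 0, and each satisfies k(σ) = x by the first
  -- order condition. Injectivity of k near -t makes the minimizer unique.
  have hmin : ∀ᶠ x in 𝓝[>] 0, ∀ σ ∈ D.argmin univ x t, σ = Λ x := by
    obtain ⟨a, b, ⟨ha, hb⟩, hab⟩ := mem_nhds_iff_exists_Ioo_subset.1
      (hΛk.and (gt_mem_nhds hnt))
    have hlo := hD.tendsto_argmin_boundary ht.le h
      (fun x hx => hD.lo_mem .univ (le_of_lt hx) ht.le)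
    have hhi := hD.tendsto_argmin_boundary ht.le h
      (fun x hx => hD.hi_mem .univ (le_of_lt hx) ht.le)
    filter_upwards [hlo.eventually (lt_mem_nhds ha), hhi.eventually (gt_mem_nhds hb),
      self_mem_nhdsWithin] with x h1 h2 hx σ hσ
    obtain ⟨h3, h4⟩ := hab (show σ ∈ Ioo a b from
      ⟨h1.trans_le (hD.lo_le .univ (le_of_lt hx) ht.le hσ),
        (hD.le_hi .univ (le_of_lt hx) ht.le hσ).trans_lt h2⟩)
    have h5 : k σ = x :=
      hD.flight_eq_of_mem_argmin (hvC σ h4).continuousAt (hdC σ h4) h4 hσ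
    rw [← h3, h5]
  obtain ⟨δ, hδ, hball⟩ := Metric.eventually_nhds_iff_ball.1 (hΛ.and hΛneg)
  obtain ⟨δ', hδ', hmin'⟩ := (mem_nhdsGT_iff_exists_Ioo_subset).1 hmin
  have hδ'0 : 0 < δ' := hδ'
  -- Strictly below both radii, so that the properties hold up to and including the endpoint ε.
  obtain ⟨ε, hε, hεlt⟩ := exists_between (lt_min hδ hδ'0)
  have hεδ : ε < δ := hεlt.trans_le (min_le_left _ _)
  have hεδ' : ε < δ' := hεlt.trans_le (min_le_right _ _)
  have hin : ∀ x ∈ Icc 0 ε, x ∈ Metric.ball (0 : ℝ) δ := fun x hx => by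
    rw [Real.ball_eq_Ioo]
    exact ⟨by linarith [hx.1], by linarith [hx.2]⟩
  have harg : ∀ x ∈ Ioc 0 ε, ∀ σ ∈ D.argmin univ x t, σ = Λ x := fun x hx =>
    hmin' ⟨hx.1, hx.2.trans_lt hεδ'⟩
  have hm : ∀ x ∈ Ioc 0 ε, D.m x t = D.mass (Λ x) := fun x hx => by
    rw [hD.m_eq hx.1 ht.le, harg x hx _ (hD.label_mem hx.1.le ht.le)]
  set r : ℝ → ℝ := fun x => D.dens (Λ x) * (deriv k (Λ x))⁻¹ with hrdef
  have hrpos : ∀ x ∈ Icc 0 ε, 0 ≤ r x := fun x hx =>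
    mul_nonneg (hD.dens_pos _).le (inv_nonneg.2 (hball x (hin x hx)).1.2.le)
  have hder : ∀ x ∈ Icc 0 ε, HasDerivAt (fun z => D.mass (Λ z)) (r x) x := fun x hx =>
    (hD.hasDerivAt_mass (hdC _ (hball x (hin x hx)).2)).comp x (hball x (hin x hx)).1.1
  have hrc : ∀ x ∈ Icc 0 ε, ContinuousAt r x := fun x hx => by
    obtain ⟨⟨h1, h2⟩, h3⟩ := hball x (hin x hx)
    have hk'c := continuousAt_deriv_of_contDiffAt (hkC _ h3)
    exact (ContinuousAt.comp (hdC _ h3) h1.continuousAt).mul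
      ((ContinuousAt.comp hk'c h1.continuousAt).inv₀ h2.ne')
  have hrint : ∀ a ∈ Icc 0 ε, IntervalIntegrable r volume 0 a := fun a ha =>
    ContinuousOn.intervalIntegrable_of_Icc ha.1 fun x hx =>
      (hrc x ⟨hx.1, hx.2.trans ha.2⟩).continuousWithinAt
  have hmeas : (D.massAt t).restrict (Ioc 0 ε) =
      (volume.restrict (Ioc 0 ε)).withDensity fun x => ENNReal.ofReal (r x) := by
    refine restrict_Ioc_eq_withDensity (hrint ε ⟨hε.le, le_rfl⟩).1
      (fun x hx => hrpos x ⟨hx.1.le, hx.2⟩) fun a ha => ?_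
    -- At a = 0 this is the inflow condition, which gives the label -t = Λ(0). So the mass in (0, a]
    -- is the increment of the primitive of r.
    have hhi : D.hi univ a t = Λ a := by
      rcases ha.1.eq_or_lt with rfl | ha0
      · rw [hΛ0, hD.hi_zero_eq ht.le h]
      · exact harg a ⟨ha0, ha.2⟩ _ (hD.hi_mem .univ ha.1 ht.le)
    rw [hD.massAt_Ioc_zero ht.le h ha.1, hhi, ← hΛ0]
    rw [intervalIntegral.integral_eq_sub_of_hasDerivAt (f := fun z => D.mass (Λ z))
      (fun x hx => ?_) (hrint a ha)]
    rw [uIcc_of_le ha.1] at hx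
    exact hder x ⟨hx.1, hx.2.trans ha.2⟩
  refine ⟨ε, hε, r, fun x hx => (hrc x ⟨hx.1.le, hx.2.le⟩).continuousWithinAt,
    fun x hx => ⟨hrpos x ⟨hx.1.le, hx.2.le⟩, ?_⟩, ?_, ?_⟩
  · refine (hder x ⟨hx.1.le, hx.2.le⟩).congr_of_eventuallyEq ?_
    filter_upwards [Ioo_mem_nhds hx.1 hx.2] with z hz using hm z ⟨hz.1, hz.2.le⟩
  · have := congrArg (fun μ : Measure ℝ => μ.restrict (Ioo 0 ε)) hmeas
    simpa only [restrict_withDensity measurableSet_Ioo,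
      Measure.restrict_restrict measurableSet_Ioo,
      inter_eq_self_of_subset_left Ioo_subset_Ioc_self] using this
  · have hu : ∀ x ∈ Ioc 0 ε, D.u x t = D.vel (Λ x) := fun x hx => by
      have hneg := (hball x (hin x ⟨hx.1.le, hx.2⟩)).2
      have hmem := hD.lo_mem .univ hx.1.le ht.le
      have hlo := harg x hx _ hmem
      have hhi := harg x hx _ (hD.hi_mem .univ hx.1.le ht.le)
      rw [hlo] at hmem
      have hk1 := hD.flight_eq_of_mem_argmin (hvC _ hneg).continuousAt (hdC _ hneg) hneg hmem
      have ht' : t + Λ x ≠ 0 := fun h0 => by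
        rw [h0, zero_mul] at hk1
        exact hx.1.ne hk1
      rw [hD.u_eq hx.1 ht, hlo, hhi, speed, if_pos rfl, if_neg hneg.not_ge,
        div_eq_iff ht', mul_comm, hk1]
    have hv : ContinuousAt (fun x => D.vel (Λ x)) 0 :=
      ContinuousAt.comp (g := D.vel) (hΛ0 ▸ (hvC _ hnt).continuousAt) hΛ.self_of_nhds.1.continuousAt
    have hlim := ((hrc 0 ⟨le_rfl, hε.le⟩).mul hv).tendsto.mono_left
      (nhdsWithin_le_nhds (s := Ioi 0))
    -- At the boundary the derivative of k is vel(-t) and cancels the velocity, which leaves the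
    -- label density at -t, the rate of inflow of mass.
    have e : r 0 * D.vel (Λ 0) = D.ρb t * D.ub t := by
      have := (hD.ub_pos t ht).ne'
      simp only [hrdef]
      rw [hΛ0, hk', dens_of_neg hnt, vel_of_neg hnt, neg_neg]
      field_simp
    rw [Pi.mul_apply, e] at hlim
    refine hlim.congr' ?_
    filter_upwards [Ioc_mem_nhdsGT hε] with x hx
    rw [Pi.mul_apply, hu x hx]

end Admissible

end Data
end PressurelessGas

/-! ### Assembly -/

namespace PressurelessGas

namespace Data

variable {D : Data} {C : ℝ} {x t s : ℝ}

namespace Admissible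

/-- The value at x = 0 is kept because ρ(·, t) may have an atom there; only x < 0 is changed, where
the measure vanishes. -/
lemma aemeasurable_u_massAt (hD : D.Admissible) (ht : 0 < t) :
    AEMeasurable (fun x => D.u x t) (D.massAt t) := by
  refine ⟨fun x => if x = 0 then D.u 0 t else D.speedMax (x, t), ?_, ?_⟩
  · exact Measurable.ite (measurableSet_singleton 0) measurable_const
      (hD.measurable_speedMax.comp (by fun_prop))
  · have h : ∀ᵐ x ∂D.massAt t, x ∉ Iio (0 : ℝ) :=
      measure_eq_zero_iff_ae_notMem.1 (hD.massAt_Iio_zero ht.le)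
    filter_upwards [h] with x hx
    rcases (notMem_Iio.1 hx).eq_or_lt with rfl | hx0
    · simp
    · rw [if_neg hx0.ne', hD.u_eq_speedMax hx0 ht]

lemma isGeneralizedSolution (hD : D.Admissible) :
    IsGeneralizedSolution D.m D.u D.massAt where
  measurable_m := by
    have h : (fun p : Ioi (0 : ℝ) × Ioi (0 : ℝ) => D.m p.1 p.2) =
        fun p => D.massMax (p.1, p.2) :=
      funext fun p => hD.m_eq_massMax p.1.2 (le_of_lt p.2.2)
    rw [h]
    exact hD.measurable_massMax.comp (by fun_prop)
  measurable_u := by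
    have h : (fun p : Ioi (0 : ℝ) × Ioi (0 : ℝ) => D.u p.1 p.2) =
        fun p => D.speedMax (p.1, p.2) :=
      funext fun p => hD.u_eq_speedMax p.1.2 p.2.2
    rw [h]
    exact hD.measurable_speedMax.comp (by fun_prop)
  locallyBounded R := by
    obtain ⟨C, -, hC⟩ := hD.exists_speed_bound
    exact ⟨max (max |D.mass (-R)| |D.mass (R + C * R)|) C, fun x hx t ht =>
      ⟨(hD.abs_m_le hC hx.1 hx.2 ht.1.le ht.2).trans (le_max_left _ _),
        (hD.abs_u_le hC hx.1 ht.1).trans (le_max_right _ _)⟩⟩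
  boundedVariation := by
    filter_upwards [ae_restrict_mem measurableSet_Ioi] with t ht
    exact (hD.monotoneOn_m (le_of_lt ht)).locallyBoundedVariationOn
  aemeasurable_u := by
    filter_upwards [ae_restrict_mem measurableSet_Ioi] with t ht
    exact hD.aemeasurable_u_massAt ht
  mass _ hφ := hD.mass_massAt hφ
  momentum _ hψ := hD.momentum_massAt hψ

lemma isDistributionalSolution (hD : D.Admissible) :
    IsDistributionalSolution D.massAt D.u where
  mass _ hφ := hD.continuity_massAt hφ
  momentum _ hψ := hD.momentum_massAt hψ

end Admissible

end Data
end PressurelessGas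

theorem theorem4p3 (D : PressurelessGas.Data) (hD : D.Admissible) :
    ∃ ρ : ℝ → Measure ℝ,
      -- `ρ` is the derivative of `m`, together with the possible Dirac mass at `x = 0`
      (∀ t : ℝ, 0 < t → D.IsDensity t (ρ t)) ∧
      -- `(ρ, u)` is a solution in the quarter plane
      PressurelessGas.IsGeneralizedSolution D.m D.u ρ ∧
      PressurelessGas.IsDistributionalSolution ρ D.u ∧
      -- initial conditions
      (∀ᵐ x ∂(volume.restrict (Ioi (0 : ℝ))),
        Tendsto (fun t => D.u x t) (𝓝[>] 0) (𝓝 (D.u₀ x)) ∧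
        Tendsto (fun t => D.m x t) (𝓝[>] 0) (𝓝 (∫ y in (0 : ℝ)..x, D.ρ₀ y))) ∧
      -- boundary condition for the velocity
      (∀ᵐ t ∂(volume.restrict (Ioi (0 : ℝ))), D.G 0 t < D.F 0 t →
        Tendsto (fun x => D.u x t) (𝓝[>] 0) (𝓝 (D.ub t))) ∧
      -- boundary condition for the momentum; near `x = 0` the measure `ρ(·, t)` is given by the
      -- continuous function `r = ∂ₓ m(·, t)`
      (ContDiffOn ℝ 1 D.ub (Ioi 0) → LocallyLipschitzOn (Ioi 0) D.ρb →
        ∀ t : ℝ, 0 < t → D.G 0 t < D.F 0 t →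
          ∃ ε : ℝ, 0 < ε ∧ ∃ r : ℝ → ℝ,
            ContinuousOn r (Ioo 0 ε) ∧
            (∀ x ∈ Ioo 0 ε, 0 ≤ r x ∧ HasDerivAt (fun z => D.m z t) (r x) x) ∧
            (ρ t).restrict (Ioo 0 ε) =
              (volume.restrict (Ioo 0 ε)).withDensity (fun x => ENNReal.ofReal (r x)) ∧
            Tendsto (fun x => r x * D.u x t) (𝓝[>] 0) (𝓝 (D.ρb t * D.ub t))) :=
  ⟨D.massAt, fun _ ht => hD.isDensity_massAt ht.le, hD.isGeneralizedSolution,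
    hD.isDistributionalSolution, hD.ae_initial, hD.ae_boundary,
    fun hub hρ _ ht h => hD.exists_density_near_boundary hub hρ.continuousOn ht h⟩
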